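/- A graph consists of a set of vertices, a set of edges, and an incidence relation assigning to each edge two (not necessarily distinct) vertices; self-loops (which count twice in the degree) and multiple edges are allowed. All graphs are connected and have a basepoint. A graph $\Gamma$ is viewed as a one-dimensional CW complex with the path metric in which every edge has length one, and $B_r(\Gamma)$ denotes the ball of radius $r$ about the basepoint. For an integer $k\ge 3$ let $\mathcal G_k$ be the set of infinite graphs all of whose vertices have degree $k$, let $\mathcal G_{\le k}$ be the set of infinite graphs all of whose vertices have degree at most $k$, and let $\mathcal G_{<\infty}$ be the set of infinite graphs all of whose vertices have finite degree, each considered up to isomorphism fixing the basepoint. Let $\mathcal G_\star$ be any one of these spaces, with the topology that has as a basis the sets $\{\Delta\in\mathcal G_\star \mid B_r(\Gamma)\cong B_r(\Delta)\}$ for $\Gamma\in\mathcal G_\star$ and integers $r\ge 0$, where $\cong$ is isomorphism fixing the basepoint. The rank of a graph is the rank of its fundamental group. A graph is one-ended if its end space $\varprojlim_{K}\pi_0(\Gamma\setminus K)$, where $K$ runs over the compact subsets of $\Gamma$, is a single point. A map is proper if preimages of compact sets are compact, and a proper homotopy equivalence is a proper continuous map $f$ which has a proper continuous map $g$ such that $f\circ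 g$ and $g\circ f$ are homotopic to the identity through homotopies that are proper maps. The Loch Ness Monster graph is a ray with vertices $0,1,2,\dots$ with one self-loop attached at every vertex. **Proposition.** For every integer $k\ge 3$, the set of one-ended graphs of infinite rank is a dense $G_\delta$ subset of $\mathcal G_k$ and a dense $G_\delta$ subset of $\mathcal G_{\le k}$; it is also a dense $G_\delta$ subset of $\mathcal G_{<\infty}$. In each of these spaces, this set is exactly the set of graphs that are proper homotopy equivalent to the Loch Ness Monster graph. -/

import Mathlib

open scoped unitInterval

/-! ### Pointed graphs, with self-loops and multiple edges allowed -/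

/-- A graph with a basepoint: a set of vertices, a set of edges, an incidence relation giving each
edge its two (not necessarily distinct, and unordered) end vertices, and a base vertex.  Different
edges may have the same end vertices. -/
structure PointedGraph where
  /-- the vertex set -/
  V : Type
  /-- the edge set -/
  E : Type
  /-- the unordered pair of end vertices of an edge -/
  ends : E → Sym2 V
  /-- the basepoint -/
  base : V

namespace PointedGraph

/-- The degree of a vertex: the number of edges incident to it, a self-loop counting twice. -/
noncomputable def degree (Γ : PointedGraph) (v : Γ.V) : ℕ∞ :=
  {e | v ∈ Γ.ends e}.encard + {e | Γ.ends e = s(v, v)}.encard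

/-- The adjacency relation on vertices. -/
def adjGraph (Γ : PointedGraph) : SimpleGraph Γ.V where
  Adj u v := u ≠ v ∧ ∃ e, Γ.ends e = s(u, v)
  symm := ⟨fun _ _ h => ⟨h.1.symm, h.2.imp fun _ he => he.trans Sym2.eq_swap⟩⟩
  loopless := ⟨fun _ h => h.1 rfl⟩

/-- The distance of a vertex from the basepoint in the path metric (all edges have length one). -/
noncomputable def height (Γ : PointedGraph) (v : Γ.V) : ℕ∞ :=
  Γ.adjGraph.edist Γ.base v

/-- Isomorphisms of graphs that fix the basepoint. -/
structure Iso (Γ Δ : PointedGraph) where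
  /-- the bijection of vertices -/
  onV : Γ.V ≃ Δ.V
  /-- the bijection of edges -/
  onE : Γ.E ≃ Δ.E
  ends_onE : ∀ e, Δ.ends (onE e) = (Γ.ends e).map onV
  onV_base : onV Γ.base = Δ.base

/-- The identity isomorphism. -/
def Iso.refl (Γ : PointedGraph) : Iso Γ Γ where
  onV := Equiv.refl _
  onE := Equiv.refl _
  ends_onE e := by simp
  onV_base := rfl

/-- The inverse isomorphism. -/
def Iso.symm {Γ Δ : PointedGraph} (f : Iso Γ Δ) : Iso Δ Γ where
  onV := f.onV.symm
  onE := f.onE.symm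
  ends_onE e := by
    have h := f.ends_onE (f.onE.symm e)
    rw [Equiv.apply_symm_apply] at h
    rw [h, Sym2.map_map]
    simp
  onV_base := by rw [← f.onV_base, Equiv.symm_apply_apply]

/-- The composite of two isomorphisms. -/
def Iso.trans {Γ Δ Θ : PointedGraph} (f : Iso Γ Δ) (g : Iso Δ Θ) : Iso Γ Θ where
  onV := f.onV.trans g.onV
  onE := f.onE.trans g.onE
  ends_onE e := by
    rw [Equiv.trans_apply, g.ends_onE, f.ends_onE, Sym2.map_map]
    rfl
  onV_base := by rw [Equiv.trans_apply, f.onV_base, g.onV_base]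

theorem height_le_of_edge (Γ : PointedGraph) (r : ℕ) (e : Γ.E)
    (h : ∃ v ∈ Γ.ends e, Γ.height v < r) : ∀ w ∈ Γ.ends e, Γ.height w ≤ r := by
  obtain ⟨v, hv, hr⟩ := h
  intro w hw
  by_cases hvw : v = w
  · exact hvw ▸ hr.le
  · have hadj : Γ.adjGraph.Adj v w := ⟨hvw, e, (Sym2.mem_and_mem_iff hvw).1 ⟨hv, hw⟩⟩
    calc Γ.height w ≤ Γ.height v + Γ.adjGraph.edist v w := Γ.adjGraph.edist_triangle
      _ = Γ.height v + 1 := by rw [SimpleGraph.edist_eq_one_iff_adj.2 hadj]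
      _ ≤ r := Order.add_one_le_of_lt hr

/-- The closed ball of radius `r` about the basepoint for the path metric.  Since `r` is an integer
it is a subgraph: it consists of the vertices at distance at most `r` and the edges that have
an end vertex at distance less than `r` (no interior point of an edge joining two vertices at
distance exactly `r` is at distance at most `r`). -/
noncomputable def ball (Γ : PointedGraph) (r : ℕ) : PointedGraph where
  V := {v : Γ.V // Γ.height v ≤ r}
  E := {e : Γ.E // ∃ v ∈ Γ.ends e, Γ.height v < r}
  ends e := (Γ.ends e.1).attachWith (Γ.height_le_of_edge r e.1 e.2)
  base := ⟨Γ.base, by simp [height]⟩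

/-- `B_r(Γ) ≅ B_r(Δ)`, by an isomorphism fixing the basepoint. -/
def BallIso (r : ℕ) (Γ Δ : PointedGraph) : Prop :=
  Nonempty (Iso (Γ.ball r) (Δ.ball r))

/-! ### The graph as a topological space -/

instance (Γ : PointedGraph) : TopologicalSpace Γ.V := ⊥

instance (Γ : PointedGraph) : DiscreteTopology Γ.V := ⟨rfl⟩

instance (Γ : PointedGraph) : TopologicalSpace Γ.E := ⊥

instance (Γ : PointedGraph) : DiscreteTopology Γ.E := ⟨rfl⟩

/-- The gluing of the two ends of the `1`-cell of each edge to the end vertices of that edge.  The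
characteristic map of the cell uses an arbitrarily chosen order of the two end vertices. -/
inductive Glue (Γ : PointedGraph) : Γ.V ⊕ Γ.E × I → Γ.V ⊕ Γ.E × I → Prop
  | left (e : Γ.E) : Glue Γ (Sum.inr (e, 0)) (Sum.inl (Γ.ends e).out.1)
  | right (e : Γ.E) : Glue Γ (Sum.inr (e, 1)) (Sum.inl (Γ.ends e).out.2)

/-- The `1`-dimensional CW complex with a `0`-cell for every vertex and a `1`-cell for every edge,
with its quotient (weak) topology. -/
def Realization (Γ : PointedGraph) : Type := Quot Γ.Glue

instance (Γ : PointedGraph) : TopologicalSpace Γ.Realization :=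
  inferInstanceAs (TopologicalSpace (Quot Γ.Glue))

/-- A vertex as a point of the realization. -/
def vertexPoint (Γ : PointedGraph) (v : Γ.V) : Γ.Realization := Quot.mk _ (Sum.inl v)

end PointedGraph

/-! ### Rank, ends, proper homotopy equivalence -/

/-- The rank of a group: the least cardinality of a generating set (`⊤` if no generating set is
finite).  For a free group this is the cardinality of a basis. -/
noncomputable def groupRank (H : Type*) [Group H] : ℕ∞ :=
  ⨅ S : {S : Set H // Subgroup.closure S = ⊤}, S.1.encard

/-- The rank of a connected graph: the rank of its fundamental group. -/
noncomputable def PointedGraph.rank (Γ : PointedGraph) : ℕ∞ :=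
  groupRank (FundamentalGroup Γ.Realization (Γ.vertexPoint Γ.base))

/-- For `K ⊆ L`, the map `π₀(X \ L) → π₀(X \ K)` induced by inclusion. -/
def piZeroCompl {X : Type*} [TopologicalSpace X] {K L : Set X} (h : K ⊆ L) :
    ZerothHomotopy (Lᶜ : Set X) → ZerothHomotopy (Kᶜ : Set X) :=
  ZerothHomotopy.lift
    (fun x => ZerothHomotopy.mk (Set.inclusion (Set.compl_subset_compl.2 h) x))
    fun _ _ p => ZerothHomotopy.sound (p.map (continuous_inclusion (Set.compl_subset_compl.2 h)))

/-- The set of ends of a space: the inverse limit of the sets `π₀(X \ K)`, over the compact subsets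
`K` of `X` ordered by inclusion. -/
def EndSpace (X : Type*) [TopologicalSpace X] : Type _ :=
  {s : (K : {K : Set X // IsCompact K}) → ZerothHomotopy ((K.1)ᶜ : Set X) //
    ∀ (K L : {K : Set X // IsCompact K}) (h : K.1 ⊆ L.1), piZeroCompl h (s L) = s K}

/-- A space is one-ended if it has exactly one end. -/
def OneEnded (X : Type*) [TopologicalSpace X] : Prop :=
  Nonempty (Unique (EndSpace X))

/-- A map is proper if preimages of compact sets are compact. -/
def ProperFun {X Y : Type*} [TopologicalSpace X] [TopologicalSpace Y] (f : X → Y) : Prop :=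
  ∀ K : Set Y, IsCompact K → IsCompact (f ⁻¹' K)

/-- Two maps are properly homotopic if there is a homotopy `I × X → Y` between them that is a
proper map. -/
def ProperlyHomotopic {X Y : Type*} [TopologicalSpace X] [TopologicalSpace Y] (f g : C(X, Y)) :
    Prop :=
  ∃ H : ContinuousMap.Homotopy f g, ProperFun H

/-- Two spaces are proper homotopy equivalent. -/
def ProperHomotopyEquivalent (X Y : Type*) [TopologicalSpace X] [TopologicalSpace Y] : Prop :=
  ∃ (f : C(X, Y)) (g : C(Y, X)), ProperFun f ∧ ProperFun g ∧
    ProperlyHomotopic (g.comp f) (ContinuousMap.id X) ∧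
    ProperlyHomotopic (f.comp g) (ContinuousMap.id Y)

/-! ### The spaces of graphs -/

/-- The connected, infinite pointed graphs all of whose vertex degrees lie in `D`. -/
structure GraphIn (D : Set ℕ∞) where
  /-- the underlying pointed graph -/
  graph : PointedGraph
  connected : ConnectedSpace graph.Realization
  infinite : Infinite graph.V ∨ Infinite graph.E
  degree_mem : ∀ v, graph.degree v ∈ D

/-- Isomorphism fixing the basepoint. -/
instance GraphIn.isoSetoid (D : Set ℕ∞) : Setoid (GraphIn D) where
  r Γ Δ := Nonempty (PointedGraph.Iso Γ.graph Δ.graph)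
  iseqv :=
    { refl := fun Γ => ⟨.refl Γ.graph⟩
      symm := fun ⟨f⟩ => ⟨f.symm⟩
      trans := fun ⟨f⟩ ⟨g⟩ => ⟨f.trans g⟩ }

/-- The set of connected, infinite graphs with a basepoint and with all vertex degrees in `D`,
considered up to isomorphism fixing the basepoint. -/
def GraphSpace (D : Set ℕ∞) : Type 1 := Quotient (GraphIn.isoSetoid D)

namespace GraphSpace

/-- The set of isomorphism classes of the graphs with a given property. -/
def classes {D : Set ℕ∞} (p : PointedGraph → Prop) : Set (GraphSpace D) :=
  Quotient.mk (GraphIn.isoSetoid D) '' {Γ | p Γ.graph}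

/-- The basic set `𝓤_(Γ, r)` of all `Δ` with `B_r(Γ) ≅ B_r(Δ)`. -/
def basicSet {D : Set ℕ∞} (Γ : GraphIn D) (r : ℕ) : Set (GraphSpace D) :=
  classes (PointedGraph.BallIso r Γ.graph)

/-- The local topology, comparing the `r`-balls of the basepoint. -/
instance (D : Set ℕ∞) : TopologicalSpace (GraphSpace D) :=
  TopologicalSpace.generateFrom {U | ∃ (Γ : GraphIn D) (r : ℕ), U = basicSet Γ r}

/-- The one-ended graphs of infinite rank. -/
def oneEndedInfiniteRank (D : Set ℕ∞) : Set (GraphSpace D) :=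
  classes fun Γ => OneEnded Γ.Realization ∧ Γ.rank = ⊤

/-- The graphs that are proper homotopy equivalent to `Λ`. -/
def properHomotopyClass (D : Set ℕ∞) (Λ : PointedGraph) : Set (GraphSpace D) :=
  classes fun Γ => ProperHomotopyEquivalent Γ.Realization Λ.Realization

end GraphSpace

/-- The space `𝓖_k` of infinite `k`-regular graphs. -/
abbrev RegularGraphs (k : ℕ) : Type 1 := GraphSpace {(k : ℕ∞)}

/-- The space `𝓖_{≤ k}` of infinite graphs with all degrees at most `k`. -/
abbrev BoundedDegreeGraphs (k : ℕ) : Type 1 := GraphSpace (Set.Iic (k : ℕ∞))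

/-- The space `𝓖_{< ∞}` of infinite, locally finite graphs. -/
abbrev LocallyFiniteGraphs : Type 1 := GraphSpace (Set.Iio (⊤ : ℕ∞))

/-- The Loch Ness Monster graph: a ray with vertices `0, 1, 2, …`, and a self-loop attached at every
vertex. -/
def lochNessMonster : PointedGraph where
  V := ℕ
  E := ℕ ⊕ ℕ
  ends := Sum.elim (fun n => s(n, n + 1)) (fun n => s(n, n))
  base := 0

/-!
One-endedness and the rank are proper homotopy invariants, and the Loch Ness Monster graph is
one-ended of infinite rank. Conversely, a one-ended locally finite graph has a spanning tree `T`
that is directed towards the end: every vertex has a parent, finitely many descendants, and an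
ancestor in common with every other vertex. Flowing along `T` towards the end does not give a
proper map of the graph, but both ends of any edge outside `T` can be slid along `T` to one vertex
of a fixed ray in `T`, provided that only finitely many edges are moved to the same vertex. This
turns the edges outside `T` into loops on the ray, and the rest of the tree then retracts properly
onto the ray along the flow. As the loops may be placed as far out as desired, the result is a ray
whose `i`-th loop is attached at some vertex `n i ≥ i`, and sliding this loop back to the vertex
`i` gives the Loch Ness Monster graph.

The condition of being one-ended of infinite rank is a countable intersection of conditions on
balls: for every `r`, some sphere of radius larger than `r` is connected in a shell around the
ball of radius `r`, and for every `n`, some ball contains a finite subgraph with `n` more edges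
than vertices. This gives a `Gδ`. For density, a ball is completed by a ray with multiple edges
that absorbs the missing half-edges on the boundary of the ball and has the prescribed degree
everywhere.
-/

/-- The relation on the disjoint union of vertices and `1`-cells that glues the ends of the cell of
the edge `e` to the vertices `s e` and `t e`. -/
inductive OneComplex.Glue {V E : Type*} (s t : E → V) : V ⊕ E × I → V ⊕ E × I → Prop
  | left (e : E) : Glue s t (Sum.inr (e, 0)) (Sum.inl (s e))
  | right (e : E) : Glue s t (Sum.inr (e, 1)) (Sum.inl (t e))

/-- The one-dimensional CW complex with vertices `V` and with a `1`-cell from `s e` to `t e` for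
every `e : E`.  It is the realization of a graph with a prescribed orientation of the edges, so that
no arbitrary choices enter its characteristic maps. -/
def OneComplex {V E : Type*} (s t : E → V) : Type _ := Quot (OneComplex.Glue s t)

namespace OneComplex

section basic

variable {V E : Type*} {s t : E → V}

/-- A vertex as a point of the complex. -/
def vtx (s t : E → V) (v : V) : OneComplex s t := Quot.mk _ (Sum.inl v)

/-- The characteristic map of an edge. -/
def edge (s t : E → V) (e : E) (x : I) : OneComplex s t := Quot.mk _ (Sum.inr (e, x))

instance : TopologicalSpace (OneComplex s t) :=
  ⨆ e, TopologicalSpace.coinduced (edge s t e) inferInstance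

@[simp] theorem edge_zero (e : E) : edge s t e 0 = vtx s t (s e) := Quot.sound (.left e)

@[simp] theorem edge_one (e : E) : edge s t e 1 = vtx s t (t e) := Quot.sound (.right e)

theorem isOpen_iff {U : Set (OneComplex s t)} :
    IsOpen U ↔ ∀ e, IsOpen (edge s t e ⁻¹' U) := by
  rw [isOpen_iSup_iff]
  simp only [isOpen_coinduced]

theorem isClosed_iff {U : Set (OneComplex s t)} :
    IsClosed U ↔ ∀ e, IsClosed (edge s t e ⁻¹' U) := by
  simp only [← isOpen_compl_iff, isOpen_iff, Set.preimage_compl]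

theorem continuous_iff {Z : Type*} [TopologicalSpace Z] {f : OneComplex s t → Z} :
    Continuous f ↔ ∀ e, Continuous fun x => f (edge s t e x) := by
  rw [continuous_iSup_dom]
  simp only [continuous_coinduced_dom, Function.comp_def]

@[fun_prop]
theorem continuous_edge (e : E) : Continuous (edge s t e) := continuous_iff.1 continuous_id e

/-- The characteristic map of an edge, as a path. -/
def edgePath (s t : E → V) (e : E) : Path (vtx s t (s e)) (vtx s t (t e)) where
  toFun := edge s t e
  continuous_toFun := continuous_edge e
  source' := edge_zero e
  target' := edge_one e

theorem eq_vtx_or_eq_edge (x : OneComplex s t) :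
    (∃ v, x = vtx s t v) ∨ ∃ e r, r ≠ 0 ∧ r ≠ 1 ∧ x = edge s t e r := by
  obtain ⟨v | ⟨e, r⟩, rfl⟩ := Quot.exists_rep x
  · exact .inl ⟨v, rfl⟩
  · by_cases h0 : r = 0
    · exact .inl ⟨s e, h0 ▸ edge_zero e⟩
    by_cases h1 : r = 1
    · exact .inl ⟨t e, h1 ▸ edge_one e⟩
    exact .inr ⟨e, r, h0, h1, rfl⟩

@[elab_as_elim]
theorem ind {p : OneComplex s t → Prop} (vtx : ∀ v, p (vtx s t v))
    (edge : ∀ e r, p (edge s t e r)) (x : OneComplex s t) : p x := by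
  obtain ⟨v | ⟨e, r⟩, rfl⟩ := Quot.exists_rep x
  exacts [vtx v, edge e r]

section lift

variable {Z : Type*} (fV : V → Z) (fE : E → I → Z) (h0 : ∀ e, fE e 0 = fV (s e))
  (h1 : ∀ e, fE e 1 = fV (t e))

/-- A map out of the complex, from its values on vertices and on edges. -/
def lift : OneComplex s t → Z :=
  Quot.lift (Sum.elim fV fun x => fE x.1 x.2) (by
    rintro _ _ (e | e)
    exacts [h0 e, h1 e])

@[simp] theorem lift_vtx (v : V) : lift fV fE h0 h1 (vtx s t v) = fV v := rfl

@[simp] theorem lift_edge (e : E) (r : I) : lift fV fE h0 h1 (edge s t e r) = fE e r := rfl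

theorem continuous_lift [TopologicalSpace Z] (h : ∀ e, Continuous (fE e)) :
    Continuous (lift fV fE h0 h1) := continuous_iff.2 h

end lift

/-! ### Separation and compactness -/

open Classical in
/-- The open cell containing a point, with the coordinate of the point in it. -/
noncomputable def cell : OneComplex s t → V ⊕ E × I :=
  lift Sum.inl (fun e r => if r = 0 then Sum.inl (s e) else if r = 1 then Sum.inl (t e)
    else Sum.inr (e, r)) (by simp) (by simp)

theorem cell_vtx (v : V) : cell (vtx s t v) = Sum.inl v := rfl

theorem cell_edge {e : E} {r : I} (h0 : r ≠ 0) (h1 : r ≠ 1) :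
    cell (edge s t e r) = Sum.inr (e, r) := by
  simp [cell, h0, h1]

theorem vtx_injective : Function.Injective (vtx s t) := fun v w h => by
  simpa only [cell_vtx, Sum.inl.injEq] using congrArg cell h

theorem edge_ne_vtx {e : E} {r : I} (h0 : r ≠ 0) (h1 : r ≠ 1) (v : V) :
    edge s t e r ≠ vtx s t v := fun h => by
  simpa [cell_edge h0 h1, cell_vtx] using congrArg cell h

theorem edge_eq_vtx {e : E} {r : I} {v : V} (h : edge s t e r = vtx s t v) :
    (r = 0 ∧ s e = v) ∨ (r = 1 ∧ t e = v) := by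
  by_cases h0 : r = 0
  · exact .inl ⟨h0, vtx_injective (by rw [← h, h0, edge_zero])⟩
  by_cases h1 : r = 1
  · exact .inr ⟨h1, vtx_injective (by rw [← h, h1, edge_one])⟩
  exact absurd h (edge_ne_vtx h0 h1 v)

theorem edge_eq_edge {e e' : E} {r r' : I} (h0 : r ≠ 0) (h1 : r ≠ 1)
    (h : edge s t e' r' = edge s t e r) : e' = e ∧ r' = r := by
  by_cases h0' : r' = 0
  · exact absurd (by rw [← h, h0', edge_zero]) (edge_ne_vtx h0 h1 (s e'))
  by_cases h1' : r' = 1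
  · exact absurd (by rw [← h, h1', edge_one]) (edge_ne_vtx h0 h1 (t e'))
  simpa [cell_edge h0 h1, cell_edge h0' h1'] using congrArg cell h

open Classical in
/-- Barycentric coordinates with respect to the vertices, and for each edge two functions that
vanish on the vertices and together separate the interior points of the edge.  They witness that the
complex is Hausdorff. -/
noncomputable def coordinates : OneComplex s t → (V → ℝ) × (E → ℝ × ℝ) :=
  lift (fun v => (Pi.single v 1, 0))
    (fun e r => ((1 - (r : ℝ)) • Pi.single (s e) 1 + (r : ℝ) • Pi.single (t e) 1,
      Pi.single e ((r : ℝ) * (1 - r), (r : ℝ) ^ 2 * (1 - r))))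
    (by simp [Prod.mk_zero_zero]) (by simp [Prod.mk_zero_zero])

theorem continuous_coordinates : Continuous (coordinates (s := s) (t := t)) := by
  classical
  refine continuous_lift _ _ _ _ fun e => .prodMk (by fun_prop) ?_
  exact (continuous_single (A := fun _ : E => ℝ × ℝ) e).comp (by fun_prop)

theorem coordinates_injective : Function.Injective (coordinates (s := s) (t := t)) := by
  classical
  have edge_eq {e : E} {r : I} (h0 : r ≠ 0) (h1 : r ≠ 1) {y : OneComplex s t}
      (h : coordinates (edge s t e r) = coordinates y) : edge s t e r = y := by
    have hr0 : (r : ℝ) ≠ 0 := unitInterval.coe_ne_zero.2 h0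
    have hr1 : 1 - (r : ℝ) ≠ 0 := sub_ne_zero.2 (unitInterval.coe_ne_one.2 h1).symm
    have he := congrFun (congrArg Prod.snd h) e
    induction y using ind with
    | vtx v => simp [coordinates, hr0, hr1, Prod.ext_iff] at he
    | edge e' r' =>
      rcases eq_or_ne e e' with rfl | hne
      · simp only [coordinates, lift_edge, Pi.single_eq_same, Prod.mk.injEq] at he
        have hrr : (r : ℝ) * (r * (1 - r)) = r' * (r * (1 - r)) := by
          linear_combination he.2 - r' * he.1
        rw [Subtype.ext (mul_right_cancel₀ (mul_ne_zero hr0 hr1) hrr)]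
      · simp [coordinates, hr0, hr1, Prod.ext_iff, hne] at he
  intro x y h
  obtain ⟨v, rfl⟩ | ⟨e, r, h0, h1, rfl⟩ := eq_vtx_or_eq_edge x
  · obtain ⟨w, rfl⟩ | ⟨e, r, h0, h1, rfl⟩ := eq_vtx_or_eq_edge y
    · have hv := congrFun (congrArg Prod.fst h) v
      by_contra hvw
      have hne : v ≠ w := fun hvw' => hvw (by rw [hvw'])
      simp [coordinates, hne] at hv
    · exact (edge_eq h0 h1 h.symm).symm
  · exact edge_eq h0 h1 h

instance : T2Space (OneComplex s t) :=
  .of_injective_continuous coordinates_injective continuous_coordinates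

/-- All subsets of `Z` are closed, so `Z` is a discrete closed subset of a compact set. -/
theorem finite_of_subsingleton_inter_edge {K Z : Set (OneComplex s t)} (hK : IsCompact K)
    (hZK : Z ⊆ K) (hZ : ∀ e, {r | r ≠ 0 ∧ r ≠ 1 ∧ edge s t e r ∈ Z}.Subsingleton) :
    Z.Finite := by
  have isClosed_of_subset {W : Set (OneComplex s t)} (hW : W ⊆ Z) : IsClosed W := by
    refine isClosed_iff.2 fun e => (((hZ e).finite.union (Set.toFinite {0, 1})).subset ?_).isClosed
    intro r hr
    by_cases h : r = 0 ∨ r = 1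
    · exact .inr h
    · exact .inl ⟨fun h0 => h (.inl h0), fun h1 => h (.inr h1), hW hr⟩
  refine (hK.of_isClosed_subset (isClosed_of_subset le_rfl) hZK).finite ?_
  rw [isDiscrete_iff_discreteTopology, discreteTopology_iff_isOpen_singleton]
  intro x
  rw [← isClosed_compl_iff, isClosed_induced_iff]
  refine ⟨Z \ {x.1}, isClosed_of_subset Set.sdiff_subset, ?_⟩
  ext y
  simp [Subtype.ext_iff]

theorem finite_vertices {K : Set (OneComplex s t)} (hK : IsCompact K) :
    {v | vtx s t v ∈ K}.Finite := by
  refine (finite_of_subsingleton_inter_edge hK (Set.image_preimage_subset (vtx s t) K)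
    fun e r hr => ?_).of_finite_image vtx_injective.injOn
  obtain ⟨v, -, hv⟩ := hr.2.2
  exact absurd hv.symm (edge_ne_vtx hr.1 hr.2.1 v)

theorem finite_openEdges {K : Set (OneComplex s t)} (hK : IsCompact K) :
    {e | ∃ r, r ≠ 0 ∧ r ≠ 1 ∧ edge s t e r ∈ K}.Finite := by
  choose! r h0 h1 hr using fun (e : E) (h : ∃ r, r ≠ 0 ∧ r ≠ 1 ∧ edge s t e r ∈ K) => h
  refine (finite_of_subsingleton_inter_edge hK (Set.image_subset_iff.2 hr)
    fun e a ha b hb => ?_).of_finite_image fun e _ e' he' h => ?_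
  · obtain ⟨e₁, -, h₁⟩ := ha.2.2
    obtain ⟨e₂, -, h₂⟩ := hb.2.2
    obtain ⟨rfl, rfl⟩ := edge_eq_edge ha.1 ha.2.1 h₁
    obtain ⟨rfl, rfl⟩ := edge_eq_edge hb.1 hb.2.1 h₂
    rfl
  · exact (edge_eq_edge (h0 e' he') (h1 e' he') h).1

/-- Every vertex meets finitely many edges. -/
def LocallyFinite (s t : E → V) : Prop := ∀ v, {e | s e = v}.Finite ∧ {e | t e = v}.Finite

theorem finite_edges (h : LocallyFinite s t) {K : Set (OneComplex s t)} (hK : IsCompact K) :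
    {e | ∃ r, edge s t e r ∈ K}.Finite := by
  refine ((finite_openEdges hK).union
    ((finite_vertices hK).biUnion fun v _ => (h v).1.union (h v).2)).subset ?_
  rintro e ⟨r, hr⟩
  by_cases h0 : r = 0
  · exact .inr (Set.mem_biUnion (x := s e) (by simpa [h0] using hr) (.inl rfl))
  by_cases h1 : r = 1
  · exact .inr (Set.mem_biUnion (x := t e) (by simpa [h1] using hr) (.inr rfl))
  exact .inl ⟨r, h0, h1, hr⟩

/-- The union of a set of vertices and a set of closed edges. -/
def subcomplex (s t : E → V) (A : Set V) (B : Set E) : Set (OneComplex s t) :=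
  vtx s t '' A ∪ ⋃ e ∈ B, Set.range (edge s t e)

theorem isCompact_subcomplex {A : Set V} {B : Set E} (hA : A.Finite) (hB : B.Finite) :
    IsCompact (subcomplex s t A B) :=
  (hA.image _).isCompact.union (hB.isCompact_biUnion fun e _ => isCompact_range (continuous_edge e))

theorem properFun_of_finite {Y : Type*} [TopologicalSpace Y] [T2Space Y] (f : C(OneComplex s t, Y))
    (hV : ∀ K, IsCompact K → {v | f (vtx s t v) ∈ K}.Finite)
    (hE : ∀ K, IsCompact K → {e | ∃ r, f (edge s t e r) ∈ K}.Finite) : ProperFun f := by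
  refine fun K hK => (isCompact_subcomplex (hV K hK) (hE K hK)).of_isClosed_subset
    (hK.isClosed.preimage f.continuous) fun x hx => ?_
  induction x using ind with
  | vtx v => exact .inl ⟨v, hx, rfl⟩
  | edge e r => exact .inr (Set.mem_biUnion (x := e) ⟨r, hx⟩ ⟨r, rfl⟩)

theorem properFun_prod_of_finite {Y : Type*} [TopologicalSpace Y] [T2Space Y]
    (f : C(I × OneComplex s t, Y))
    (hV : ∀ K, IsCompact K → {v | ∃ τ, f (τ, vtx s t v) ∈ K}.Finite)
    (hE : ∀ K, IsCompact K → {e | ∃ τ r, f (τ, edge s t e r) ∈ K}.Finite) : ProperFun f := by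
  intro K hK
  refine (isCompact_univ.prod (isCompact_subcomplex (hV K hK) (hE K hK))).of_isClosed_subset
    (hK.isClosed.preimage f.continuous) ?_
  rintro ⟨τ, x⟩ hx
  refine ⟨trivial, ?_⟩
  induction x using ind with
  | vtx v => exact .inl ⟨v, ⟨τ, hx⟩, rfl⟩
  | edge e r => exact .inr (Set.mem_biUnion (x := e) ⟨τ, r, hx⟩ ⟨r, rfl⟩)

/-- A homotopy, from its values on vertices and edges.  In `HE` the coordinate along the edge comes
first and the time second. -/
def homotopy {Z : Type*} [TopologicalSpace Z] (f g : C(OneComplex s t, Z)) (HV : V → C(I, Z))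
    (HE : E → C(I × I, Z)) (h0 : ∀ e τ, HE e (0, τ) = HV (s e) τ)
    (h1 : ∀ e τ, HE e (1, τ) = HV (t e) τ) (hfV : ∀ v, HV v 0 = f (vtx s t v))
    (hgV : ∀ v, HV v 1 = g (vtx s t v)) (hf : ∀ e r, HE e (r, 0) = f (edge s t e r))
    (hg : ∀ e r, HE e (r, 1) = g (edge s t e r)) : ContinuousMap.Homotopy f g where
  toFun x := lift (Z := C(I, Z)) HV (fun e r => (HE e).curry r)
    (fun e => ContinuousMap.ext (h0 e)) (fun e => ContinuousMap.ext (h1 e)) x.2 x.1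
  continuous_toFun := by
    have h : Continuous (lift (s := s) (t := t) (Z := C(I, Z)) HV (fun e r => (HE e).curry r)
        (fun e => ContinuousMap.ext (h0 e)) (fun e => ContinuousMap.ext (h1 e))) :=
      continuous_lift _ _ _ _ fun e => (HE e).curry.continuous
    exact (ContinuousMap.uncurry ⟨_, h⟩).continuous.comp continuous_swap
  map_zero_left x := by
    induction x using ind with
    | vtx v => exact hfV v
    | edge e r => exact hf e r
  map_one_left x := by
    induction x using ind with
    | vtx v => exact hgV v
    | edge e r => exact hg e r

end basic

/-! ### Change of orientation -/

section reindex

variable {V E E' : Type*} {s t : E → V} {s' t' : E' → V}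

open Classical in
/-- The map of complexes given by a map of edges that respects the unordered pairs of end
vertices. -/
noncomputable def reindex (φ : E → E') (h : ∀ e, s(s e, t e) = s(s' (φ e), t' (φ e))) :
    C(OneComplex s t, OneComplex s' t') where
  toFun := lift (vtx s' t') (fun e r => edge s' t' (φ e) (if s e = s' (φ e) then r else σ r))
    (fun e => by
      have := Sym2.eq_iff.1 (h e)
      split_ifs with hs
      · rw [edge_zero, hs]
      · rw [unitInterval.symm_zero, edge_one, (this.resolve_left fun h => hs h.1).1])
    (fun e => by
      have := Sym2.eq_iff.1 (h e)
      split_ifs with hs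
      · rw [edge_one]; grind
      · rw [unitInterval.symm_one, edge_zero, (this.resolve_left fun h => hs h.1).2])
  continuous_toFun := continuous_lift _ _ _ _ fun e => by split_ifs <;> fun_prop

theorem reindex_reindex {φ : E → E'} {ψ : E' → E} (h : ∀ e, s(s e, t e) = s(s' (φ e), t' (φ e)))
    (h' : ∀ e, s(s' e, t' e) = s(s (ψ e), t (ψ e))) (hψ : Function.LeftInverse ψ φ)
    (x : OneComplex s t) : reindex ψ h' (reindex φ h x) = x := by
  induction x using ind with
  | vtx v => rfl
  | edge e r =>
    have hs : s' (φ e) = s (ψ (φ e)) ↔ s e = s' (φ e) := by rw [hψ e, eq_comm]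
    simp only [reindex, ContinuousMap.coe_mk, lift_edge]
    by_cases hst : s e = s' (φ e)
    · rw [if_pos hst, if_pos (hs.2 hst), hψ e]
    · rw [if_neg hst, if_neg (hs.not.2 hst), unitInterval.symm_symm, hψ e]

/-- The complex does not depend on the orientation and the indexing of its edges. -/
noncomputable def reindexHomeo (φ : E ≃ E') (h : ∀ e, s(s e, t e) = s(s' (φ e), t' (φ e))) :
    OneComplex s t ≃ₜ OneComplex s' t' :=
  have h' e : s(s' e, t' e) = s(s (φ.symm e), t (φ.symm e)) := by simp [h]
  { toFun := reindex φ h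
    invFun := reindex φ.symm h'
    left_inv := reindex_reindex h h' φ.left_inv
    right_inv := reindex_reindex h' h φ.right_inv
    continuous_toFun := (reindex φ h).continuous
    continuous_invFun := (reindex φ.symm h').continuous }

end reindex

end OneComplex

namespace PointedGraph

variable (Γ : PointedGraph)

/-- The source of an edge, for the orientation chosen in the definition of the realization. -/
noncomputable def src (e : Γ.E) : Γ.V := (Γ.ends e).out.1

/-- The target of an edge, for the orientation chosen in the definition of the realization. -/
noncomputable def tgt (e : Γ.E) : Γ.V := (Γ.ends e).out.2

theorem mk_src_tgt (e : Γ.E) : s(Γ.src e, Γ.tgt e) = Γ.ends e := Quot.out_eq (Γ.ends e)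

/-- The realization carries the quotient topology of the disjoint union of its cells, and the
complex the topology coinduced by the characteristic maps of its edges; they agree. -/
noncomputable def complexHomeo : OneComplex Γ.src Γ.tgt ≃ₜ Γ.Realization where
  toFun := OneComplex.lift Γ.vertexPoint (fun e r => Quot.mk _ (Sum.inr (e, r)))
    (fun e => Quot.sound (.left e)) (fun e => Quot.sound (.right e))
  invFun := Quot.lift (Sum.elim (OneComplex.vtx _ _) fun x => OneComplex.edge _ _ x.1 x.2) (by
    rintro _ _ (e | e)
    exacts [OneComplex.edge_zero e, OneComplex.edge_one e])
  left_inv x := by induction x using OneComplex.ind <;> rfl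
  right_inv x := by
    obtain ⟨v | ⟨e, r⟩, rfl⟩ := Quot.exists_rep x <;> rfl
  continuous_toFun := OneComplex.continuous_lift _ _ _ _ fun e =>
    continuous_quot_mk.comp (continuous_inr.comp (by fun_prop))
  continuous_invFun := by
    refine continuous_quot_lift _ (continuous_sumElim.2 ⟨continuous_of_discreteTopology, ?_⟩)
    rw [continuous_prod_of_discrete_left]
    exact OneComplex.continuous_edge

/-- The realization of a graph may be computed with any orientation and indexing of its edges. -/
noncomputable def realizationHomeo {E : Type*} (s t : E → Γ.V) (φ : E ≃ Γ.E)
    (h : ∀ e, s(s e, t e) = Γ.ends (φ e)) : OneComplex s t ≃ₜ Γ.Realization :=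
  (OneComplex.reindexHomeo φ fun e => (h e).trans (Γ.mk_src_tgt _).symm).trans Γ.complexHomeo

end PointedGraph

/-! ### Proper homotopy equivalences -/

section Proper

variable {X Y Z : Type*} [TopologicalSpace X] [TopologicalSpace Y] [TopologicalSpace Z]

theorem ProperFun.comp {g : Y → Z} {f : X → Y} (hg : ProperFun g) (hf : ProperFun f) :
    ProperFun (g ∘ f) := fun K hK => hf _ (hg K hK)

theorem ProperFun.of_homeomorph (f : X ≃ₜ Y) : ProperFun f := fun _ hK =>
  f.isCompact_preimage.2 hK

theorem ProperlyHomotopic.refl {f : C(X, Y)} (hf : ProperFun f) : ProperlyHomotopic f f := by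
  refine ⟨.refl f, fun K hK => ?_⟩
  have : ContinuousMap.Homotopy.refl f ⁻¹' K = Set.univ ×ˢ (f ⁻¹' K) := by ext ⟨τ, x⟩; simp
  rw [this]
  exact isCompact_univ.prod (hf K hK)

theorem ProperlyHomotopic.symm {f g : C(X, Y)} :
    ProperlyHomotopic f g → ProperlyHomotopic g f := fun ⟨H, hH⟩ =>
  ⟨H.symm, hH.comp (.of_homeomorph (unitInterval.symmHomeomorph.prodCongr (.refl X)))⟩

theorem ProperlyHomotopic.trans {f g h : C(X, Y)} : ProperlyHomotopic f g →
    ProperlyHomotopic g h → ProperlyHomotopic f h := by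
  rintro ⟨H, hH⟩ ⟨H', hH'⟩
  let firstHalf : I × X → I × X :=
    Prod.map (fun τ => ⟨τ / 2, by constructor <;> linarith [τ.2.1, τ.2.2]⟩) id
  let secondHalf : I × X → I × X :=
    Prod.map (fun τ => ⟨(1 + τ) / 2, by constructor <;> linarith [τ.2.1, τ.2.2]⟩) id
  have trans_firstHalf : H.trans H' ∘ firstHalf = H := by
    funext ⟨τ, x⟩
    have hτ : (τ : ℝ) / 2 ≤ 2⁻¹ := by linarith [τ.2.2]
    simp [firstHalf, ContinuousMap.Homotopy.trans_apply, hτ.not_gt, mul_div_cancel₀]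
  have trans_secondHalf : H.trans H' ∘ secondHalf = H' := by
    funext ⟨τ, x⟩
    rcases eq_or_ne τ 0 with rfl | h0
    · simp [secondHalf, ContinuousMap.Homotopy.trans_apply]
    · have hτ : 2⁻¹ < (1 + (τ : ℝ)) / 2 := by
        linarith [unitInterval.coe_pos.2 (unitInterval.pos_iff_ne_zero.2 h0)]
      simp [secondHalf, ContinuousMap.Homotopy.trans_apply, hτ.not_ge, mul_div_cancel₀]
  have range_union : Set.range firstHalf ∪ Set.range secondHalf = Set.univ := by
    refine Set.eq_univ_of_forall fun ⟨τ, x⟩ => ?_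
    rcases le_total (τ : ℝ) (1 / 2) with hτ | hτ
    · exact .inl ⟨(⟨2 * τ, by linarith [τ.2.1], by linarith⟩, x), by simp [firstHalf]⟩
    · exact .inr ⟨(⟨2 * τ - 1, by linarith, by linarith [τ.2.2]⟩, x), by simp [secondHalf]⟩
  refine ⟨H.trans H', fun K hK => ?_⟩
  rw [← Set.inter_univ (_ ⁻¹' K), ← range_union, Set.inter_union_distrib_left,
    ← Set.image_preimage_eq_inter_range, ← Set.image_preimage_eq_inter_range,
    ← Set.preimage_comp, ← Set.preimage_comp, trans_firstHalf, trans_secondHalf]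
  exact ((hH K hK).image (by fun_prop)).union ((hH' K hK).image (by fun_prop))

theorem ProperlyHomotopic.comp_left {f g : C(X, Y)} {h : C(Y, Z)} (hh : ProperFun h) :
    ProperlyHomotopic f g → ProperlyHomotopic (h.comp f) (h.comp g) := fun ⟨H, hH⟩ =>
  ⟨(ContinuousMap.Homotopy.refl h).comp H, fun K hK => hH _ (hh K hK)⟩

theorem ProperlyHomotopic.comp_right [T2Space Y] {f g : C(Y, Z)} {h : C(X, Y)} (hh : ProperFun h) :
    ProperlyHomotopic f g → ProperlyHomotopic (f.comp h) (g.comp h) := by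
  rintro ⟨H, hH⟩
  refine ⟨H.comp (ContinuousMap.Homotopy.refl h), fun K hK => ?_⟩
  refine (isCompact_univ.prod (hh _ ((hH K hK).image continuous_snd))).of_isClosed_subset
    ((hH K hK).isClosed.preimage (f := Prod.map id h) (by fun_prop)) ?_
  rintro ⟨τ, x⟩ hx
  exact ⟨trivial, ⟨(τ, h x), hx, rfl⟩⟩

theorem ProperHomotopyEquivalent.symm :
    ProperHomotopyEquivalent X Y → ProperHomotopyEquivalent Y X :=
  fun ⟨f, g, hf, hg, hgf, hfg⟩ => ⟨g, f, hg, hf, hfg, hgf⟩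

theorem ProperHomotopyEquivalent.trans [T2Space Y] :
    ProperHomotopyEquivalent X Y → ProperHomotopyEquivalent Y Z →
    ProperHomotopyEquivalent X Z := by
  rintro ⟨f, g, hf, hg, hgf, hfg⟩ ⟨f', g', hf', hg', hgf', hfg'⟩
  exact ⟨f'.comp f, g.comp g', hf'.comp hf, hg.comp hg',
    ((hgf'.comp_right hf).comp_left hg).trans hgf,
    ((hfg.comp_right hg').comp_left hf').trans hfg'⟩

theorem ProperHomotopyEquivalent.of_homeomorph (φ : X ≃ₜ Y) : ProperHomotopyEquivalent X Y := by
  refine ⟨φ, φ.symm, .of_homeomorph φ, .of_homeomorph φ.symm, ?_, ?_⟩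
  · rw [φ.symm_comp_toContinuousMap]
    exact .refl (.of_homeomorph (.refl X))
  · rw [φ.toContinuousMap_comp_symm]
    exact .refl (.of_homeomorph (.refl Y))

theorem ProperHomotopyEquivalent.nonempty_homotopyEquiv :
    ProperHomotopyEquivalent X Y → Nonempty (ContinuousMap.HomotopyEquiv X Y) :=
  fun ⟨f, g, _, _, ⟨H, _⟩, ⟨H', _⟩⟩ => ⟨⟨f, g, ⟨H⟩, ⟨H'⟩⟩⟩

/-! ### Ends -/

/-- The map on path components of complements of `f ⁻¹' K` and `K`. -/
def piZeroMap (f : C(X, Y)) (K : Set Y) :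
    ZerothHomotopy ((f ⁻¹' K)ᶜ : Set X) → ZerothHomotopy (Kᶜ : Set Y) :=
  ZerothHomotopy.lift (fun x => ZerothHomotopy.mk ⟨f x.1, x.2⟩)
    fun _ _ p => ZerothHomotopy.sound (p.map (f := fun x : ((f ⁻¹' K)ᶜ : Set X) =>
      (⟨f x.1, x.2⟩ : (Kᶜ : Set Y))) (by fun_prop))

/-- The path component of the complement of a compact set that contains an end. -/
def EndSpace.comp (ε : EndSpace X) (K : Set X) (hK : IsCompact K) : ZerothHomotopy (Kᶜ : Set X) :=
  ε.1 ⟨K, hK⟩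

theorem EndSpace.piZeroCompl_comp (ε : EndSpace X) {K L : Set X} (hK : IsCompact K)
    (hL : IsCompact L) (h : K ⊆ L) : piZeroCompl h (ε.comp L hL) = ε.comp K hK :=
  ε.2 ⟨K, hK⟩ ⟨L, hL⟩ h

@[ext]
theorem EndSpace.ext {ε ε' : EndSpace X} (h : ∀ K hK, ε.comp K hK = ε'.comp K hK) : ε = ε' :=
  Subtype.ext (funext fun K => h K.1 K.2)

/-- The end given by a compatible family of path components. -/
def EndSpace.mk (c : ∀ K : Set X, IsCompact K → ZerothHomotopy (Kᶜ : Set X))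
    (h : ∀ K L hK hL, ∀ h : K ⊆ L, piZeroCompl h (c L hL) = c K hK) : EndSpace X :=
  ⟨fun K => c K.1 K.2, fun K L => h K.1 L.1 K.2 L.2⟩

/-- The map on end spaces induced by a proper map. -/
def EndSpace.map (f : C(X, Y)) (hf : ProperFun f) (ε : EndSpace X) : EndSpace Y :=
  .mk (fun K hK => piZeroMap f K (ε.comp (f ⁻¹' K) (hf _ hK))) fun K L hK hL h => by
    rw [← ε.piZeroCompl_comp (hf _ hK) (hf _ hL) (Set.preimage_mono h)]
    generalize ε.comp (f ⁻¹' L) _ = z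
    induction z using ZerothHomotopy.rec with
    | mk x => rfl

theorem EndSpace.comp_map (f : C(X, Y)) (hf : ProperFun f) (ε : EndSpace X) (K : Set Y)
    (hK : IsCompact K) :
    (ε.map f hf).comp K hK = piZeroMap f K (ε.comp (f ⁻¹' K) (hf _ hK)) := rfl

theorem EndSpace.map_map_of_properlyHomotopic_id {f : C(X, Y)} {g : C(Y, X)} (hf : ProperFun f)
    (hg : ProperFun g) (h : ProperlyHomotopic (g.comp f) (ContinuousMap.id X)) (ε : EndSpace X) :
    (ε.map f hf).map g hg = ε := by
  obtain ⟨H, hH⟩ := h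
  ext K hK
  -- Points outside the track `L` of `K` stay outside `K` during the whole homotopy.
  set L : Set X := Prod.snd '' (H ⁻¹' K)
  have hL : IsCompact L := (hH _ hK).image continuous_snd
  have hKL : K ⊆ L := fun x hx => ⟨(1, x), by simpa using hx, rfl⟩
  have hKL' : f ⁻¹' (g ⁻¹' K) ⊆ L := fun x hx => ⟨(0, x), by simpa using hx, rfl⟩
  rw [← ε.piZeroCompl_comp hK hL hKL, comp_map, comp_map,
    ← ε.piZeroCompl_comp (hf _ (hg _ hK)) hL hKL']
  generalize ε.comp L hL = z
  induction z using ZerothHomotopy.rec with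
  | mk x =>
    have hx : ∀ τ, H (τ, x.1) ∈ Kᶜ := fun τ hτ => x.2 ⟨(τ, x.1), hτ, rfl⟩
    exact ZerothHomotopy.sound ⟨⟨fun τ => ⟨H (τ, x.1), hx τ⟩, by fun_prop⟩,
      Subtype.ext (H.apply_zero _), Subtype.ext (H.apply_one _)⟩

theorem OneEnded.of_properHomotopyEquivalent (hX : OneEnded X)
    (h : ProperHomotopyEquivalent X Y) : OneEnded Y := by
  obtain ⟨f, g, hf, hg, -, hfg⟩ := h
  obtain ⟨u⟩ := hX
  refine ⟨⟨⟨u.default.map f hf⟩, fun ε => ?_⟩⟩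
  rw [← EndSpace.map_map_of_properlyHomotopic_id hg hf hfg ε]
  exact congrArg _ (u.uniq _)

end Proper

/-! ### Rank -/

section Rank

theorem groupRank_le_of_surjective {G H : Type*} [Group G] [Group H] (φ : G →* H)
    (hφ : Function.Surjective φ) : groupRank H ≤ groupRank G := by
  refine le_iInf fun S => ?_
  have h : Subgroup.closure (φ '' S.1) = ⊤ := by
    rw [← MonoidHom.map_closure, S.2, ← MonoidHom.range_eq_map, MonoidHom.range_eq_top.2 hφ]
  exact (iInf_le _ ⟨φ '' S.1, h⟩).trans (Set.encard_image_le _ _)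

theorem groupRank_congr {G H : Type*} [Group G] [Group H] (φ : G ≃* H) :
    groupRank G = groupRank H :=
  le_antisymm (groupRank_le_of_surjective φ.symm.toMonoidHom φ.symm.surjective)
    (groupRank_le_of_surjective φ.toMonoidHom φ.surjective)

theorem groupRank_fundamentalGroup_congr {X Y : Type*} [TopologicalSpace X] [TopologicalSpace Y]
    [PathConnectedSpace Y] (e : ContinuousMap.HomotopyEquiv X Y) (x : X) (y : Y) :
    groupRank (FundamentalGroup X x) = groupRank (FundamentalGroup Y y) := by
  let F := FundamentalGroupoidFunctor.equivOfHomotopyEquiv (X := TopCat.of X) (Y := TopCat.of Y) e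
  calc groupRank (FundamentalGroup X x)
      = groupRank (FundamentalGroup Y (e x)) :=
        groupRank_congr (F.fullyFaithfulFunctor.mulEquivEnd (FundamentalGroupoid.mk x))
    _ = groupRank (FundamentalGroup Y y) :=
        groupRank_congr (FundamentalGroup.fundamentalGroupMulEquivOfPathConnected (e x) y)

end Rank

namespace OneComplex

/-! ### Sliding the ends of edges -/

section slide

variable {V E₀ E₁ : Type*} {s₀ t₀ : E₀ → V} {a b a' b' : E₁ → V}

/-- The inclusion of a complex into the complex obtained by attaching further edges. -/
def incl (s₀ t₀ : E₀ → V) (a b : E₁ → V) :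
    C(OneComplex s₀ t₀, OneComplex (Sum.elim s₀ a) (Sum.elim t₀ b)) where
  toFun := lift (vtx _ _) (fun e => edge _ _ (Sum.inl e)) (fun e => edge_zero (Sum.inl e))
    (fun e => edge_one (Sum.inl e))
  continuous_toFun := continuous_lift _ _ _ _ fun _ => continuous_edge _

@[simp] theorem incl_vtx (v : V) : incl s₀ t₀ a b (vtx _ _ v) = vtx _ _ v := rfl

theorem LocallyFinite.sumElim (h : LocallyFinite s₀ t₀) (ha : ∀ v, {i | a i = v}.Finite)
    (hb : ∀ v, {i | b i = v}.Finite) : LocallyFinite (Sum.elim s₀ a) (Sum.elim t₀ b) := by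
  refine fun v => ⟨(((h v).1.image Sum.inl).union ((ha v).image Sum.inr)).subset ?_,
    (((h v).2.image Sum.inl).union ((hb v).image Sum.inr)).subset ?_⟩
  all_goals
    rintro (e | i) h
    · exact .inl ⟨e, h, rfl⟩
    · exact .inr ⟨i, h, rfl⟩

theorem properFun_incl (h : LocallyFinite (Sum.elim s₀ a) (Sum.elim t₀ b)) :
    ProperFun (incl s₀ t₀ a b) :=
  properFun_of_finite _ (fun _ hK => finite_vertices hK) fun _ hK =>
    (finite_edges h hK).preimage (f := Sum.inl) Sum.inl_injective.injOn

/-- A family of paths of which only finitely many meet a given compact set. -/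
def LocallyFinitePaths {X J : Type*} [TopologicalSpace X] {x y : J → X}
    (α : ∀ i, Path (x i) (y i)) : Prop :=
  ∀ K, IsCompact K → {i | ∃ r, α i r ∈ K}.Finite

theorem LocallyFinitePaths.symm {X J : Type*} [TopologicalSpace X] {x y : J → X}
    {α : ∀ i, Path (x i) (y i)} (h : LocallyFinitePaths α) :
    LocallyFinitePaths fun i => (α i).symm := fun K hK =>
  (h K hK).subset fun _ ⟨r, hr⟩ => ⟨σ r, hr⟩

theorem LocallyFinitePaths.finite_source {α : ∀ i, Path (vtx s₀ t₀ (a i)) (vtx s₀ t₀ (b i))}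
    (h : LocallyFinitePaths α) (v : V) : {i | a i = v}.Finite := by
  refine (h {vtx s₀ t₀ v} isCompact_singleton).subset ?_
  rintro i rfl
  exact ⟨0, by simp⟩

theorem LocallyFinitePaths.finite_target {α : ∀ i, Path (vtx s₀ t₀ (a i)) (vtx s₀ t₀ (b i))}
    (h : LocallyFinitePaths α) (v : V) : {i | b i = v}.Finite :=
  h.symm.finite_source v

variable (α : ∀ i, Path (vtx s₀ t₀ (a i)) (vtx s₀ t₀ (a' i)))
  (β : ∀ i, Path (vtx s₀ t₀ (b i)) (vtx s₀ t₀ (b' i)))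

/-- The path, parametrized by `[0, 3]`, that runs along `α i`, the edge `i`, and back along
`β i`. -/
noncomputable def slidePath (i : E₁) (x : ℝ) : OneComplex (Sum.elim s₀ a') (Sum.elim t₀ b') :=
  if x ≤ 1 then incl s₀ t₀ a' b' ((α i).extend x) else
    if x ≤ 2 then (edgePath (Sum.elim s₀ a') (Sum.elim t₀ b') (Sum.inr i)).extend (x - 1) else
      incl s₀ t₀ a' b' ((β i).extend (3 - x))

@[fun_prop]
theorem continuous_slidePath (i : E₁) : Continuous (slidePath α β i) := by
  refine Continuous.if_le (by fun_prop) (Continuous.if_le (by fun_prop) (by fun_prop)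
    continuous_id continuous_const ?_) continuous_id continuous_const ?_
  · rintro x rfl
    norm_num
  · rintro x rfl
    rw [if_pos one_le_two]
    norm_num

theorem slidePath_zero (i : E₁) : slidePath α β i 0 = vtx _ _ (a i) := by
  simp [slidePath]

theorem slidePath_one (i : E₁) : slidePath α β i 1 = vtx _ _ (a' i) := by
  simp [slidePath]

theorem slidePath_two (i : E₁) : slidePath α β i 2 = vtx _ _ (b' i) := by
  norm_num [slidePath]

theorem slidePath_three (i : E₁) : slidePath α β i 3 = vtx _ _ (b i) := by
  norm_num [slidePath]

theorem slidePath_one_add (i : E₁) (r : I) :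
    slidePath α β i (1 + r) = edge _ _ (Sum.inr i) r := by
  rcases eq_or_ne r 0 with rfl | h0
  · simp [slidePath_one]
  · have hr : 0 < (r : ℝ) := unitInterval.coe_pos.2 (unitInterval.pos_iff_ne_zero.2 h0)
    rw [slidePath, if_neg (by linarith), if_pos (by linarith [r.2.2]), add_sub_cancel_left,
      Path.extend_apply _ r.2]
    rfl

theorem slidePath_mem (i : E₁) (x : ℝ) :
    (∃ r, slidePath α β i x = incl s₀ t₀ a' b' (α i r)) ∨
    (∃ r, slidePath α β i x = edge _ _ (Sum.inr i) r) ∨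
    (∃ r, slidePath α β i x = incl s₀ t₀ a' b' (β i r)) := by
  unfold slidePath
  split_ifs
  exacts [.inl ⟨_, rfl⟩, .inr (.inl ⟨_, rfl⟩), .inr (.inr ⟨_, rfl⟩)]

/-- The map between two complexes that differ by sliding the edges of `E₁` along paths. -/
noncomputable def slideMap : C(OneComplex (Sum.elim s₀ a) (Sum.elim t₀ b),
    OneComplex (Sum.elim s₀ a') (Sum.elim t₀ b')) where
  toFun := lift (vtx _ _) (Sum.rec (fun e r => edge _ _ (Sum.inl e) r)
    (fun i r => slidePath α β i (3 * r)))
    (by rintro (e | i)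
        · exact edge_zero (Sum.inl e)
        · simpa using slidePath_zero α β i)
    (by rintro (e | i)
        · exact edge_one (Sum.inl e)
        · simpa using slidePath_three α β i)
  continuous_toFun := continuous_lift _ _ _ _ (by
    rintro (e | i)
    · exact continuous_edge _
    · exact (continuous_slidePath α β i).comp (by fun_prop))

theorem slideMap_inr (i : E₁) (r : I) :
    slideMap α β (edge _ _ (Sum.inr i) r) = slidePath α β i (3 * r) := rfl

theorem slideMap_incl (x : OneComplex s₀ t₀) :
    slideMap α β (incl s₀ t₀ a b x) = incl s₀ t₀ a' b' x := by
  induction x using ind <;> rfl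

/-- Sliding there and back maps the edge `i` to the path that runs along `α i` and back, then along
the edge, then along `β i` and back; up to the retracing it is the reparametrization of
`slidePath` by this function. -/
noncomputable def slideParam (r : ℝ) : ℝ :=
  if r ≤ 1 / 3 then 1 - 3 * r else if r ≤ 2 / 3 then 9 * r - 3 else 5 - 3 * r

@[fun_prop]
theorem continuous_slideParam : Continuous slideParam := by
  refine Continuous.if_le (by fun_prop) (Continuous.if_le (by fun_prop) (by fun_prop)
    continuous_id continuous_const ?_) continuous_id continuous_const ?_
  all_goals
    rintro x rfl
    norm_num

theorem slideMap_slidePath (i : E₁) (r : I) :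
    slideMap (fun i => (α i).symm) (fun i => (β i).symm) (slidePath α β i (3 * r)) =
      slidePath (fun i => (α i).symm) (fun i => (β i).symm) i (slideParam r) := by
  have hr0 := r.2.1
  have hr1 := r.2.2
  unfold slideParam
  split_ifs with h1 h2
  · conv_lhs => rw [slidePath, if_pos (by linarith)]
    conv_rhs => rw [slidePath, if_pos (by linarith)]
    rw [slideMap_incl, Path.extend_symm_apply, sub_sub_cancel]
  · conv_lhs => rw [slidePath, if_neg (by linarith), if_pos (by linarith),
      Path.extend_apply _ (show 3 * (r : ℝ) - 1 ∈ I by constructor <;> linarith)]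
    refine (slideMap_inr _ _ _ _).trans (congrArg _ ?_)
    simp only
    ring
  · conv_lhs => rw [slidePath, if_neg (by linarith), if_neg (by linarith), slideMap_incl]
    rcases hr1.eq_or_lt with h3 | h3
    · norm_num [h3, slidePath_two]
    · conv_rhs => rw [slidePath, if_neg (by linarith), if_neg (by linarith)]
      rw [Path.extend_symm_apply]
      congr 2
      ring

/-- On the edges of `E₁`, the linear interpolation between the two parametrizations of
`slidePath`. -/
noncomputable def slideHomotopy : ContinuousMap.Homotopy
    ((slideMap (fun i => (α i).symm) (fun i => (β i).symm)).comp (slideMap α β))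
    (ContinuousMap.id (OneComplex (Sum.elim s₀ a) (Sum.elim t₀ b))) :=
  homotopy _ _ (fun v => .const _ (vtx _ _ v))
    (Sum.rec (fun e => ⟨fun x => edge _ _ (Sum.inl e) x.1, by fun_prop⟩)
      (fun i => ⟨fun x => slidePath (fun i => (α i).symm) (fun i => (β i).symm) i
        ((1 - x.2) * slideParam x.1 + x.2 * (1 + x.1)), by fun_prop⟩))
    (by rintro (e | i) τ
        · exact edge_zero _
        · simp [slideParam, slidePath_one])
    (by rintro (e | i) τ
        · exact edge_one _
        · suffices h : (1 - (τ : ℝ)) * slideParam 1 + τ * (1 + 1) = 2 by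
            simp [h, slidePath_two]
          norm_num [slideParam]
          ring)
    (fun _ => rfl) (fun _ => rfl)
    (by rintro (e | i) r
        · rfl
        · refine Eq.trans ?_ (slideMap_slidePath α β i r).symm
          simp)
    (by rintro (e | i) r
        · rfl
        · refine Eq.trans ?_ (slidePath_one_add (fun i => (α i).symm) (fun i => (β i).symm) i r)
          simp)

variable {α β} (h₀ : LocallyFinite s₀ t₀) (hα : LocallyFinitePaths α) (hβ : LocallyFinitePaths β)
include h₀ hα hβ

theorem finite_slidePath {K : Set (OneComplex (Sum.elim s₀ a') (Sum.elim t₀ b'))}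
    (hK : IsCompact K) : {i | ∃ x, slidePath α β i x ∈ K}.Finite := by
  have h := h₀.sumElim hα.finite_target hβ.finite_target
  have hK' := properFun_incl h K hK
  refine ((hα _ hK').union (((finite_edges h hK).preimage
    Sum.inr_injective.injOn).union (hβ _ hK'))).subset ?_
  rintro i ⟨x, hx⟩
  obtain ⟨r, hr⟩ | ⟨r, hr⟩ | ⟨r, hr⟩ := slidePath_mem α β i x <;> rw [hr] at hx
  exacts [.inl ⟨r, hx⟩, .inr (.inl ⟨r, hx⟩), .inr (.inr ⟨r, hx⟩)]

theorem properFun_slideMap : ProperFun (slideMap α β) := by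
  refine properFun_of_finite _ (fun K hK => finite_vertices hK) fun K hK => ?_
  have h := h₀.sumElim hα.finite_target hβ.finite_target
  refine ((((finite_edges h hK).preimage Sum.inl_injective.injOn).image Sum.inl).union
    ((finite_slidePath h₀ hα hβ hK).image Sum.inr)).subset ?_
  rintro (e | i) ⟨r, hr⟩
  · exact .inl ⟨e, ⟨r, hr⟩, rfl⟩
  · exact .inr ⟨i, ⟨_, hr⟩, rfl⟩

theorem properFun_slideHomotopy : ProperFun (slideHomotopy α β) := by
  refine properFun_prod_of_finite (slideHomotopy α β).toContinuousMap
    (fun K hK => (finite_vertices hK).subset fun _ ⟨_, hτ⟩ => hτ) fun K hK => ?_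
  have h := h₀.sumElim hα.finite_source hβ.finite_source
  refine ((((finite_edges h hK).preimage Sum.inl_injective.injOn).image Sum.inl).union
    ((finite_slidePath h₀ hα.symm hβ.symm hK).image Sum.inr)).subset ?_
  rintro (e | i) ⟨τ, r, hr⟩
  · exact .inl ⟨e, ⟨r, hr⟩, rfl⟩
  · exact .inr ⟨i, ⟨_, hr⟩, rfl⟩

theorem properHomotopyEquivalent_slide : ProperHomotopyEquivalent
    (OneComplex (Sum.elim s₀ a) (Sum.elim t₀ b))
    (OneComplex (Sum.elim s₀ a') (Sum.elim t₀ b')) := by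
  refine ⟨slideMap α β, slideMap (fun i => (α i).symm) (fun i => (β i).symm),
    properFun_slideMap h₀ hα hβ, properFun_slideMap h₀ hα.symm hβ.symm,
    ⟨_, properFun_slideHomotopy h₀ hα hβ⟩, ?_⟩
  have : ProperlyHomotopic _ _ := ⟨_, properFun_slideHomotopy h₀ hα.symm hβ.symm⟩
  simpa only [Path.symm_symm] using this

end slide

/-! ### Flowing along a forest -/

section flow

variable {V E₁ : Type*} {p : V → V}

/-- The flow line starting at `v` in the complex with an edge from every `v` to `p v`; it stops
after `m` edges. -/
noncomputable def flow (p : V → V) : ℕ → V → ℝ → OneComplex id p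
  | 0, v, _ => vtx _ _ v
  | m + 1, v, x => if x ≤ 1 then (edgePath id p v).extend x else flow p m (p v) (x - 1)

theorem flow_of_nonpos (m : ℕ) (v : V) {x : ℝ} (hx : x ≤ 0) :
    flow p m v x = vtx _ _ v := by
  cases m with
  | zero => rfl
  | succ m => rw [flow, if_pos (by linarith), Path.extend_of_le_zero _ hx]; rfl

theorem flow_succ (m : ℕ) (v : V) {x : ℝ} (hx : 1 ≤ x) :
    flow p (m + 1) v x = flow p m (p v) (x - 1) := by
  rcases hx.lt_or_eq with h | rfl
  · rw [flow, if_neg h.not_ge]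
  · rw [flow, if_pos le_rfl, flow_of_nonpos _ _ (by simp), Path.extend_one]

theorem flow_edge (m : ℕ) (v : V) (r : I) : flow p (m + 1) v r = edge _ _ v r := by
  rw [flow, if_pos r.2.2, Path.extend_apply _ r.2]
  rfl

@[fun_prop]
theorem continuous_flow (m : ℕ) (v : V) : Continuous (flow p m v) := by
  induction m generalizing v with
  | zero => exact continuous_const
  | succ m ih =>
    refine Continuous.if_le (by fun_prop) ((ih (p v)).comp (by fun_prop)) continuous_id
      continuous_const ?_
    rintro x rfl
    rw [flow_of_nonpos _ _ (by simp), Path.extend_one]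

theorem flow_of_ge (m : ℕ) (v : V) {x : ℝ} (hx : m ≤ x) : flow p m v x = vtx _ _ (p^[m] v) := by
  induction m generalizing v x with
  | zero => rfl
  | succ m ih =>
    push_cast at hx
    rw [flow_succ _ _ (by linarith [(Nat.cast_nonneg m : (0 : ℝ) ≤ m)]), ih _ (by linarith)]
    rfl

theorem flow_mem (m : ℕ) (v : V) (x : ℝ) :
    (∃ j, flow p m v x = vtx _ _ (p^[j] v)) ∨ ∃ j r, flow p m v x = edge _ _ (p^[j] v) r := by
  induction m generalizing v x with
  | zero => exact .inl ⟨0, rfl⟩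
  | succ m ih =>
    rw [flow]
    split_ifs
    · exact .inr ⟨0, _, rfl⟩
    · rcases ih (p v) (x - 1) with ⟨j, h⟩ | ⟨j, r, h⟩
      · exact .inl ⟨j + 1, h⟩
      · exact .inr ⟨j + 1, r, h⟩

/-- Every point has finitely many predecessors under iteration of `p`. -/
def FinitePredecessors (p : V → V) : Prop := ∀ v, {u | ∃ j, p^[j] u = v}.Finite

theorem FinitePredecessors.locallyFinite (h : FinitePredecessors p) : LocallyFinite id p := fun v =>
  ⟨Set.finite_singleton v, (h v).subset fun _ hu => ⟨1, hu⟩⟩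

theorem FinitePredecessors.finite_flow (h : FinitePredecessors p) {K : Set (OneComplex id p)}
    (hK : IsCompact K) : {v | ∃ m x, flow p m v x ∈ K}.Finite := by
  refine (((finite_vertices hK).biUnion fun v _ => h v).union
    ((finite_edges h.locallyFinite hK).biUnion fun v _ => h v)).subset ?_
  rintro v ⟨m, x, hx⟩
  obtain ⟨j, hj⟩ | ⟨j, r, hj⟩ := flow_mem (p := p) m v x <;> rw [hj] at hx
  · exact .inl (Set.mem_biUnion (x := p^[j] v) hx ⟨j, rfl⟩)
  · exact .inr (Set.mem_biUnion (x := p^[j] v) ⟨r, hx⟩ ⟨j, rfl⟩)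

/-- The path from `v` to `p^[m] v` along the flow. -/
noncomputable def flowPath (p : V → V) (m : ℕ) (v : V) :
    Path (vtx id p v) (vtx id p (p^[m] v)) where
  toFun r := flow p m v (m * r)
  source' := flow_of_nonpos _ _ (by simp)
  target' := flow_of_ge _ _ (by simp)

theorem FinitePredecessors.locallyFinitePaths (h : FinitePredecessors p) {a : E₁ → V}
    (ha : ∀ v, {i | a i = v}.Finite) (m : E₁ → ℕ) :
    LocallyFinitePaths fun i => flowPath p (m i) (a i) := fun _ hK =>
  ((h.finite_flow hK).biUnion fun v _ => ha v).subset fun i ⟨_, hr⟩ =>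
    Set.mem_biUnion (x := a i) ⟨m i, _, hr⟩ rfl

theorem properHomotopyEquivalent_slide_flow (h : FinitePredecessors p) {a b a' b' : E₁ → V}
    (ha : ∀ v, {i | a i = v}.Finite) (hb : ∀ v, {i | b i = v}.Finite)
    (ha' : ∀ i, ∃ m, p^[m] (a i) = a' i) (hb' : ∀ i, ∃ m, p^[m] (b i) = b' i) :
    ProperHomotopyEquivalent (OneComplex (Sum.elim id a) (Sum.elim p b))
      (OneComplex (Sum.elim id a') (Sum.elim p b')) := by
  choose m hm using ha'
  choose n hn using hb'
  obtain rfl : (fun i => p^[m i] (a i)) = a' := funext hm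
  obtain rfl : (fun i => p^[n i] (b i)) = b' := funext hn
  exact properHomotopyEquivalent_slide h.locallyFinite (h.locallyFinitePaths ha m)
    (h.locallyFinitePaths hb n)

end flow

end OneComplex

namespace OneComplex

/-! ### Trees with loops and the ray with loops -/

section ray

variable {V E₁ : Type*} {p : V → V}

/-- Any two points have a common iterate under `p`: the forest with an edge from every `v` to `p v`
is connected and, if it is infinite and `FinitePredecessors p` holds, a one-ended tree. -/
def Merging (p : V → V) : Prop := ∀ u v, ∃ m n, p^[m] u = p^[n] v

theorem Merging.injective_iterate [Infinite V] (hm : Merging p) (h : FinitePredecessors p)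
    (v : V) : Function.Injective fun n => p^[n] v := by
  by_contra hinj
  obtain ⟨w, k, hk, hw⟩ : ∃ w k, 0 < k ∧ Function.IsPeriodicPt p k w := by
    obtain ⟨m, n, hmn, hne⟩ := Function.not_injective_iff.1 hinj
    wlog hlt : m < n generalizing m n
    · exact this n m hmn.symm hne.symm (by lia)
    refine ⟨p^[m] v, n - m, by lia, ?_⟩
    rw [Function.IsPeriodicPt, Function.IsFixedPt, ← Function.iterate_add_apply,
      Nat.sub_add_cancel hlt.le]
    exact hmn.symm
  -- Every point flows to the periodic point `w`.
  refine Set.infinite_univ ((h w).subset fun u _ => ?_)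
  obtain ⟨a, b, hab⟩ := hm u w
  refine ⟨(k - 1) * b + a, ?_⟩
  rw [Function.iterate_add_apply, hab, ← Function.iterate_add_apply, ← Nat.succ_mul,
    Nat.succ_eq_add_one, Nat.sub_add_cancel hk]
  exact hw.mul_const b

section hitTime

variable (hm : Merging p) (v₀ : V)

open Classical in
/-- The number of steps from `v` to the ray starting at `v₀`. -/
noncomputable def hitTime (v : V) : ℕ := Nat.find (hm v v₀)

open Classical in
/-- The position at which the flow line of `v` meets the ray starting at `v₀`. -/
noncomputable def hitPos (v : V) : ℕ := (Nat.find_spec (hm v v₀)).choose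

theorem iterate_hitTime (v : V) : p^[hitTime hm v₀ v] v = p^[hitPos hm v₀ v] v₀ := by
  classical exact (Nat.find_spec (hm v v₀)).choose_spec

theorem hitTime_ray (n : ℕ) : hitTime hm v₀ (p^[n] v₀) = 0 := by
  classical exact (Nat.find_eq_zero _).2 ⟨n, rfl⟩

theorem eq_ray_of_hitTime_eq_zero {v : V} (h : hitTime hm v₀ v = 0) :
    v = p^[hitPos hm v₀ v] v₀ := by
  simpa [h] using iterate_hitTime hm v₀ v

theorem hitTime_eq_succ {v : V} (h : hitTime hm v₀ v ≠ 0) :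
    hitTime hm v₀ v = hitTime hm v₀ (p v) + 1 := by
  classical
  refine (Nat.find_eq_iff _).2 ⟨⟨_, iterate_hitTime hm v₀ (p v)⟩, fun k hk ⟨n, hn⟩ => ?_⟩
  cases k with
  | zero => exact h ((Nat.find_eq_zero _).2 ⟨n, hn⟩)
  | succ k => exact Nat.find_min (hm (p v) v₀) (Nat.lt_of_succ_lt_succ hk) ⟨n, hn⟩

variable {v₀} (hinj : Function.Injective fun n => p^[n] v₀)
include hinj

theorem hitPos_ray (n : ℕ) : hitPos hm v₀ (p^[n] v₀) = n := by
  have := iterate_hitTime hm v₀ (p^[n] v₀)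
  rw [hitTime_ray] at this
  exact (hinj this).symm

theorem hitPos_apply_of_ne_zero {v : V} (h : hitTime hm v₀ v ≠ 0) :
    hitPos hm v₀ (p v) = hitPos hm v₀ v := by
  refine hinj ?_
  simp only
  rw [← iterate_hitTime, ← iterate_hitTime, hitTime_eq_succ hm v₀ h]
  rfl

theorem hitPos_apply_of_eq_zero {v : V} (h : hitTime hm v₀ v = 0) :
    hitPos hm v₀ (p v) = hitPos hm v₀ v + 1 := by
  conv_lhs => rw [eq_ray_of_hitTime_eq_zero hm v₀ h, ← Function.iterate_succ_apply' p]
  exact hitPos_ray hm hinj _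

end hitTime

/-- The ray with vertices `0, 1, 2, …` and a loop at `n i` for every `i`. -/
abbrev LoopedRay (n : E₁ → ℕ) := OneComplex (Sum.elim id n) (Sum.elim Nat.succ n)

/-- The complex with an edge from every `v` to `p v` and a loop at `p^[n i] v₀` for every `i`. -/
abbrev LoopedTree (p : V → V) (v₀ : V) (n : E₁ → ℕ) :=
  OneComplex (Sum.elim id fun i => p^[n i] v₀) (Sum.elim p fun i => p^[n i] v₀)

/-- The inclusion of a looped ray into a looped tree. -/
def rayInclusion (p : V → V) (v₀ : V) (n : E₁ → ℕ) : C(LoopedRay n, LoopedTree p v₀ n) where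
  toFun := lift (fun k => vtx _ _ (p^[k] v₀))
    (Sum.rec (fun k r => edge _ _ (Sum.inl (p^[k] v₀)) r) fun i r => edge _ _ (Sum.inr i) r)
    (by rintro (k | i)
        · exact edge_zero _
        · exact edge_zero (Sum.inr i))
    (by rintro (k | i)
        · refine (edge_one _).trans ?_
          simp [Function.iterate_succ_apply']
        · exact edge_one (Sum.inr i))
  continuous_toFun := continuous_lift _ _ _ _ (by rintro (k | i) <;> exact continuous_edge _)

variable (hm : Merging p) {v₀ : V} (hinj : Function.Injective fun n => p^[n] v₀) (n : E₁ → ℕ)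

/-- The retraction of a looped tree onto a looped ray. -/
noncomputable def rayRetraction : C(LoopedTree p v₀ n, LoopedRay n) where
  toFun := lift (fun v => vtx _ _ (hitPos hm v₀ v))
    (Sum.rec (fun v r => if hitTime hm v₀ v = 0 then edge _ _ (Sum.inl (hitPos hm v₀ v)) r
      else vtx _ _ (hitPos hm v₀ v)) fun i r => edge _ _ (Sum.inr i) r)
    (by rintro (v | i)
        · simp only
          split_ifs
          · exact edge_zero _
          · rfl
        · refine (edge_zero _).trans ?_
          simp [hitPos_ray hm hinj])
    (by rintro (v | i)
        · simp only
          split_ifs with h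
          · refine (edge_one _).trans ?_
            simp [hitPos_apply_of_eq_zero hm hinj h]
          · exact congrArg _ (hitPos_apply_of_ne_zero hm hinj h).symm
        · refine (edge_one _).trans ?_
          simp [hitPos_ray hm hinj])
  continuous_toFun := continuous_lift _ _ _ _ (by
    rintro (v | i)
    · simp only
      split_ifs <;> fun_prop
    · exact continuous_edge _)

theorem rayRetraction_edge_inl (v : V) (r : I) :
    rayRetraction hm hinj n (edge _ _ (Sum.inl v) r) =
      if hitTime hm v₀ v = 0 then edge _ _ (Sum.inl (hitPos hm v₀ v)) r
      else vtx _ _ (hitPos hm v₀ v) := rfl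

theorem rayRetraction_comp_rayInclusion :
    (rayRetraction hm hinj n).comp (rayInclusion p v₀ n) = ContinuousMap.id _ := by
  ext x
  induction x using ind with
  | vtx k => exact congrArg (vtx _ _) (hitPos_ray hm hinj k)
  | edge e r =>
    rcases e with k | i
    · refine (rayRetraction_edge_inl hm hinj n _ r).trans ?_
      rw [if_pos (hitTime_ray hm v₀ k), hitPos_ray hm hinj]
      rfl
    · rfl

/-! ### The retraction of a looped tree onto a looped ray is proper -/

section proper

variable {n}

include hinj in
theorem FinitePredecessors.locallyFinite_loopedTree (h : FinitePredecessors p)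
    (hn : ∀ k, {i | n i = k}.Finite) :
    LocallyFinite (Sum.elim id fun i => p^[n i] v₀) (Sum.elim p fun i => p^[n i] v₀) := by
  have finite_loops (v : V) : {i | p^[n i] v₀ = v}.Finite := by
    by_cases hv : ∃ k, p^[k] v₀ = v
    · obtain ⟨k, rfl⟩ := hv
      exact (hn k).subset fun i hi => hinj hi
    · exact Set.finite_empty.subset fun i hi => hv ⟨_, hi⟩
  exact h.locallyFinite.sumElim finite_loops finite_loops

theorem finitePredecessors_succ : FinitePredecessors Nat.succ := fun n =>
  (Set.finite_Iic n).subset (by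
    rintro k ⟨j, rfl⟩
    simp [Nat.succ_iterate])

theorem locallyFinite_loopedRay (hn : ∀ k, {i | n i = k}.Finite) :
    LocallyFinite (Sum.elim id n) (Sum.elim Nat.succ n) :=
  finitePredecessors_succ.locallyFinite.sumElim hn hn

theorem properFun_rayRetraction (h : FinitePredecessors p) (hn : ∀ k, {i | n i = k}.Finite) :
    ProperFun (rayRetraction hm hinj n) := by
  have finite_hitPos {F : Set ℕ} (hF : F.Finite) : {v | hitPos hm v₀ v ∈ F}.Finite :=
    (hF.biUnion fun k _ => h (p^[k] v₀)).subset fun v hv =>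
      Set.mem_biUnion hv ⟨_, iterate_hitTime hm v₀ v⟩
  refine properFun_of_finite _ (fun K hK => finite_hitPos (finite_vertices hK)) fun K hK => ?_
  have hf := finite_edges (locallyFinite_loopedRay hn) hK
  refine (((finite_hitPos ((hf.preimage Sum.inl_injective.injOn).union
    (finite_vertices hK))).image Sum.inl).union
      ((hf.preimage Sum.inr_injective.injOn).image Sum.inr)).subset ?_
  rintro (v | i) ⟨r, hr⟩
  · rw [rayRetraction_edge_inl] at hr
    refine .inl ⟨v, ?_, rfl⟩
    split_ifs at hr
    exacts [.inl ⟨r, hr⟩, .inr hr]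
  · exact .inr ⟨i, ⟨r, hr⟩, rfl⟩

include hinj in
theorem properFun_rayInclusion (h : FinitePredecessors p) (hn : ∀ k, {i | n i = k}.Finite) :
    ProperFun (rayInclusion p v₀ n) := by
  refine properFun_of_finite _ (fun K hK => (finite_vertices hK).preimage
    (f := fun n => p^[n] v₀) hinj.injOn) fun K hK => ?_
  have hf := finite_edges (h.locallyFinite_loopedTree hinj hn) hK
  refine ((((hf.preimage Sum.inl_injective.injOn).preimage
    (f := fun n => p^[n] v₀) hinj.injOn).image Sum.inl).union
      ((hf.preimage Sum.inr_injective.injOn).image Sum.inr)).subset ?_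
  rintro (v | i) ⟨r, hr⟩
  · exact .inl ⟨v, ⟨r, hr⟩, rfl⟩
  · exact .inr ⟨i, ⟨r, hr⟩, rfl⟩

end proper

section homotopy

variable (v₀) in
/-- The flow line of a vertex until it meets the ray, parametrized by `[0, 1]`. -/
noncomputable def vertexTrack (v : V) : C(I, LoopedTree p v₀ n) where
  toFun τ := incl id p _ _ (flow p (hitTime hm v₀ v) v (τ * hitTime hm v₀ v))

theorem vertexTrack_of_eq_zero {v : V} (hv : hitTime hm v₀ v = 0) (τ : I) :
    vertexTrack hm v₀ n v τ = vtx _ _ v := by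
  simp only [vertexTrack, ContinuousMap.coe_mk, hv]
  rfl

theorem vertexTrack_zero (v : V) : vertexTrack hm v₀ n v 0 = vtx _ _ v := by
  simp [vertexTrack, flow_of_nonpos]

theorem vertexTrack_one (v : V) :
    vertexTrack hm v₀ n v 1 = vtx _ _ (p^[hitPos hm v₀ v] v₀) := by
  simp [vertexTrack, flow_of_ge, iterate_hitTime]

variable (v₀) in
/-- The homotopy of the edge from `v` to `p v` that moves every point along its flow line until it
meets the ray. -/
noncomputable def edgeTrack (v : V) : C(I × I, LoopedTree p v₀ n) where
  toFun x := if hitTime hm v₀ v = 0 then edge _ _ (Sum.inl v) x.1 else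
    incl id p _ _ (flow p (hitTime hm v₀ v) v (x.1 + x.2 * (hitTime hm v₀ v - x.1)))
  continuous_toFun := by split_ifs <;> fun_prop

theorem edgeTrack_apply (v : V) (r τ : I) : edgeTrack hm v₀ n v (r, τ) =
    if hitTime hm v₀ v = 0 then edge _ _ (Sum.inl v) r else
      incl id p _ _ (flow p (hitTime hm v₀ v) v (r + τ * (hitTime hm v₀ v - r))) := rfl

theorem edgeTrack_zero_left (v : V) (τ : I) :
    edgeTrack hm v₀ n v (0, τ) = vertexTrack hm v₀ n v τ := by
  rw [edgeTrack_apply]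
  split_ifs with hv
  · rw [vertexTrack_of_eq_zero hm n hv]
    exact edge_zero _
  · simp [vertexTrack]

theorem edgeTrack_one_left (v : V) (τ : I) :
    edgeTrack hm v₀ n v (1, τ) = vertexTrack hm v₀ n (p v) τ := by
  rw [edgeTrack_apply]
  split_ifs with hv
  · have hpv : hitTime hm v₀ (p v) = 0 := by
      rw [eq_ray_of_hitTime_eq_zero hm v₀ hv, ← Function.iterate_succ_apply' p]
      exact hitTime_ray hm v₀ _
    rw [vertexTrack_of_eq_zero hm n hpv]
    exact edge_one _
  · have h0 : (0 : ℝ) ≤ τ * hitTime hm v₀ (p v) := mul_nonneg τ.2.1 (Nat.cast_nonneg _)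
    rw [hitTime_eq_succ hm v₀ hv, flow_succ _ _ (by simpa using h0)]
    simp [vertexTrack]

theorem edgeTrack_zero_right (v : V) (r : I) :
    edgeTrack hm v₀ n v (r, 0) = edge _ _ (Sum.inl v) r := by
  rw [edgeTrack_apply]
  split_ifs with hv
  · rfl
  · have : flow p (hitTime hm v₀ v) v r = edge _ _ v r := by
      rw [hitTime_eq_succ hm v₀ hv, flow_edge]
    simp only [Set.Icc.coe_zero, zero_mul, add_zero, this]
    rfl

theorem edgeTrack_one_right (v : V) (r : I) : edgeTrack hm v₀ n v (r, 1) =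
    rayInclusion p v₀ n (rayRetraction hm hinj n (edge _ _ (Sum.inl v) r)) := by
  rw [edgeTrack_apply, rayRetraction_edge_inl]
  split_ifs with hv
  · exact congrArg (fun v => edge _ _ (Sum.inl v) r) (eq_ray_of_hitTime_eq_zero hm v₀ hv)
  · refine Eq.trans ?_ (vertexTrack_one hm n v)
    simp [vertexTrack]

/-- The homotopy that moves every point along its flow line until it meets the ray. -/
noncomputable def rayHomotopy : ContinuousMap.Homotopy (ContinuousMap.id _)
    ((rayInclusion p v₀ n).comp (rayRetraction hm hinj n)) :=
  homotopy _ _ (vertexTrack hm v₀ n)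
    (Sum.rec (edgeTrack hm v₀ n) fun i => ⟨fun x => edge _ _ (Sum.inr i) x.1, by fun_prop⟩)
    (by rintro (v | i) τ
        · exact edgeTrack_zero_left hm n v τ
        · exact (edge_zero _).trans
            (vertexTrack_of_eq_zero hm n (hitTime_ray hm v₀ _) τ).symm)
    (by rintro (v | i) τ
        · exact edgeTrack_one_left hm n v τ
        · exact (edge_one _).trans
            (vertexTrack_of_eq_zero hm n (hitTime_ray hm v₀ _) τ).symm)
    (vertexTrack_zero hm n) (vertexTrack_one hm n)
    (by rintro (v | i) r
        · exact edgeTrack_zero_right hm n v r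
        · rfl)
    (by rintro (v | i) r
        · exact edgeTrack_one_right hm hinj n v r
        · rfl)

variable {n}

theorem properFun_rayHomotopy (h : FinitePredecessors p) (hn : ∀ k, {i | n i = k}.Finite) :
    ProperFun (rayHomotopy hm hinj n) := by
  have hlf := h.locallyFinite_loopedTree hinj hn
  have finite_flow (K : Set (LoopedTree p v₀ n)) (hK : IsCompact K) :
      {v | ∃ m x, incl id p _ _ (flow p m v x) ∈ K}.Finite :=
    h.finite_flow (properFun_incl hlf K hK)
  refine properFun_prod_of_finite (rayHomotopy hm hinj n).toContinuousMap
    (fun K hK => (finite_flow K hK).subset fun v ⟨_, hτ⟩ => ⟨_, _, hτ⟩) fun K hK => ?_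
  have hf := finite_edges hlf hK
  refine ((((hf.preimage Sum.inl_injective.injOn).union (finite_flow K hK)).image Sum.inl).union
    ((hf.preimage Sum.inr_injective.injOn).image Sum.inr)).subset ?_
  rintro (v | i) ⟨τ, r, hr⟩
  · refine .inl ⟨v, ?_, rfl⟩
    change edgeTrack hm v₀ n v (r, τ) ∈ K at hr
    rw [edgeTrack_apply] at hr
    split_ifs at hr
    exacts [.inl ⟨r, hr⟩, .inr ⟨_, _, hr⟩]
  · exact .inr ⟨i, ⟨r, hr⟩, rfl⟩

include hm hinj in
theorem properHomotopyEquivalent_loopedRay (h : FinitePredecessors p)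
    (hn : ∀ k, {i | n i = k}.Finite) :
    ProperHomotopyEquivalent (LoopedTree p v₀ n) (LoopedRay n) := by
  refine ⟨rayRetraction hm hinj n, rayInclusion p v₀ n, properFun_rayRetraction hm hinj h hn,
    properFun_rayInclusion hinj h hn,
    .symm ⟨_, properFun_rayHomotopy hm hinj h hn⟩, ?_⟩
  rw [rayRetraction_comp_rayInclusion]
  exact .refl fun K hK => hK

end homotopy

/-- The ends of the edges that are slid to the ray may be moved as far out as desired; this is what
makes the positions of the loops adjustable. -/
theorem exists_properHomotopyEquivalent_loopedRay [Infinite V] (h : FinitePredecessors p)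
    (hm : Merging p) {a b : E₁ → V} (ha : ∀ v, {i | a i = v}.Finite)
    (hb : ∀ v, {i | b i = v}.Finite) (f : E₁ → ℕ) :
    ∃ n : E₁ → ℕ, (∀ i, f i ≤ n i) ∧ ((∀ k, {i | n i = k}.Finite) → ProperHomotopyEquivalent
      (OneComplex (Sum.elim id a) (Sum.elim p b)) (LoopedRay n)) := by
  obtain ⟨v₀⟩ : Nonempty V := inferInstance
  have exists_position (i : E₁) :
      ∃ n, f i ≤ n ∧ (∃ m, p^[m] (a i) = p^[n] v₀) ∧ ∃ m, p^[m] (b i) = p^[n] v₀ := by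
    obtain ⟨m₁, n₁, h₁⟩ := hm (a i) v₀
    obtain ⟨m₂, n₂, h₂⟩ := hm (b i) v₀
    refine ⟨f i + n₁ + n₂, by lia, ⟨f i + n₂ + m₁, ?_⟩, ⟨f i + n₁ + m₂, ?_⟩⟩
    · rw [Function.iterate_add_apply, h₁, ← Function.iterate_add_apply, add_right_comm]
    · rw [Function.iterate_add_apply, h₂, ← Function.iterate_add_apply]
  choose n hfn hna hnb using exists_position
  exact ⟨n, hfn, fun hn => (properHomotopyEquivalent_slide_flow h ha hb hna hnb).trans
    (properHomotopyEquivalent_loopedRay hm (hm.injective_iterate h v₀) h hn)⟩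

/-- The realization of the Loch Ness Monster graph. -/
noncomputable def lochNessHomeo : LoopedRay (id : ℕ → ℕ) ≃ₜ lochNessMonster.Realization :=
  lochNessMonster.realizationHomeo (E := ℕ ⊕ ℕ) (Sum.elim id id) (Sum.elim Nat.succ id)
    (Equiv.refl _) (by rintro (n | n) <;> rfl)

theorem properHomotopyEquivalent_loopedRay_id (n : ℕ → ℕ) (hn : ∀ i, i ≤ n i) :
    ProperHomotopyEquivalent (LoopedRay (id : ℕ → ℕ)) (LoopedRay n) := by
  have hid (v : ℕ) : {i : ℕ | id i = v}.Finite := Set.finite_singleton v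
  have hsucc (i : ℕ) : ∃ m, Nat.succ^[m] (id i) = n i :=
    ⟨n i - i, by rw [Nat.succ_iterate]; exact Nat.add_sub_cancel' (hn i)⟩
  exact properHomotopyEquivalent_slide_flow finitePredecessors_succ hid hid hsucc hsucc

end ray

end OneComplex

/-! ### Generators of the fundamental group -/

section ClosesUp

variable {X : Type*} [TopologicalSpace X] {b : X}

theorem trans_symm_trans_cancel {x y z : X} (p : Path.Homotopic.Quotient x y)
    (q : Path.Homotopic.Quotient x z) : p.trans (p.symm.trans q) = q := by
  rw [← Path.Homotopic.Quotient.trans_assoc, Path.Homotopic.Quotient.trans_symm,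
    Path.Homotopic.Quotient.refl_trans]

theorem trans_mem {H : Subgroup (FundamentalGroup X b)} {p q : Path.Homotopic.Quotient b b}
    (hp : p ∈ H) (hq : q ∈ H) : p.trans q ∈ H :=
  H.mul_mem (x := q) (y := p) hq hp

theorem trans_mem_cancel_left {H : Subgroup (FundamentalGroup X b)}
    {p q : Path.Homotopic.Quotient b b} (hp : p ∈ H) : p.trans q ∈ H ↔ q ∈ H :=
  H.mul_mem_cancel_right (x := p) (y := q) hp

theorem trans_mem_cancel_right {H : Subgroup (FundamentalGroup X b)}
    {p q : Path.Homotopic.Quotient b b} (hq : q ∈ H) : p.trans q ∈ H ↔ p ∈ H :=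
  H.mul_mem_cancel_left (x := q) (y := p) hq

variable (H : Subgroup (FundamentalGroup X b)) (ρ : ∀ x, Path.Homotopic.Quotient x b)

/-- A path class closes up in the subgroup `H` if it becomes an element of `H` once its end points
are joined to the basepoint along the chosen path classes `ρ`. -/
def ClosesUp {x y : X} (q : Path.Homotopic.Quotient x y) : Prop :=
  (ρ x).symm.trans (q.trans (ρ y)) ∈ H

variable {H ρ}

theorem ClosesUp.refl (x : X) : ClosesUp H ρ (.refl x) := by
  rw [ClosesUp, Path.Homotopic.Quotient.refl_trans, Path.Homotopic.Quotient.symm_trans]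
  exact H.one_mem

theorem ClosesUp.trans {x y z : X} {p : Path.Homotopic.Quotient x y}
    {q : Path.Homotopic.Quotient y z} (hp : ClosesUp H ρ p) (hq : ClosesUp H ρ q) :
    ClosesUp H ρ (p.trans q) := by
  simpa only [ClosesUp, Path.Homotopic.Quotient.trans_assoc, trans_symm_trans_cancel]
    using trans_mem hp hq

theorem ClosesUp.of_subpath {x y : X} (γ : Path x y) (u : ℕ → I)
    (h : ∀ n, ClosesUp H ρ (.mk (γ.subpath (u n) (u (n + 1))))) (n : ℕ) :
    ClosesUp H ρ (.mk (γ.subpath (u 0) (u n))) := by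
  induction n with
  | zero =>
    rw [Path.subpath_self]
    exact .refl _
  | succ n ih =>
    rw [← Path.Homotopic.Quotient.eq.2 ⟨.subpathTransSubpath γ (u 0) (u n) (u (n + 1))⟩]
    exact ih.trans (h n)

theorem ClosesUp.mem {q : Path.Homotopic.Quotient b b} (hb : ρ b ∈ H) (h : ClosesUp H ρ q) :
    q ∈ H := by
  rwa [ClosesUp, ← trans_mem_cancel_left hb, trans_symm_trans_cancel, trans_mem_cancel_right hb]
    at h

theorem ClosesUp.mem_of_cast {γ : Path b b} {x y : X} {hx : x = b} {hy : y = b} (hb : ρ b ∈ H)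
    (h : ClosesUp H ρ (.mk (γ.cast hx hy))) : .mk γ ∈ H := by
  subst hx hy
  exact h.mem hb

end ClosesUp

namespace OneComplex

section generators

variable {V E : Type*} {s t : E → V}

/-- The initial segment of an edge, as a path. -/
def edgeTo (s t : E → V) (e : E) (r : I) (x : OneComplex s t) (hx : edge s t e r = x) :
    Path (vtx s t (s e)) x where
  toFun τ := edge s t e (τ * r)
  continuous_toFun := by fun_prop
  source' := by simp
  target' := by simp [hx]

theorem edgeTo_zero (e : E) : edgeTo s t e 0 _ (edge_zero e) = Path.refl _ := by
  ext τ
  change edge s t e (τ * 0) = vtx s t (s e)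
  rw [mul_zero, edge_zero]

theorem edgeTo_one (e : E) : edgeTo s t e 1 _ (edge_one e) = edgePath s t e := by
  ext τ
  change edge s t e (τ * 1) = edge s t e τ
  rw [mul_one]

theorem edgeTo_trans_mk {x y : OneComplex s t} (η : Path x y) (e : E) (μ : C(I, I))
    (h : ∀ τ, η τ = edge s t e (μ τ)) :
    (Path.Homotopic.Quotient.mk (edgeTo s t e (μ 0) x (by rw [← h, η.source]))).trans (.mk η) =
      .mk (edgeTo s t e (μ 1) y (by rw [← h, η.target])) := by
  let segment (r : I) : Path (0 : I) r := ⟨⟨fun τ => τ * r, by fun_prop⟩, by simp, by simp⟩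
  let f : C(I, OneComplex s t) := ⟨edge s t e, continuous_edge e⟩
  have segment_trans : ((segment (μ 0)).trans ⟨μ, rfl, rfl⟩).Homotopic (segment (μ 1)) := by
    have : ContractibleSpace I := (convex_Icc (0 : ℝ) 1).contractibleSpace ⟨0, by simp⟩
    exact SimplyConnectedSpace.paths_homotopic _ _
  have transport {z : OneComplex s t} (hz : z = edge s t e 0) :
      (Path.Homotopic.Quotient.mk (((segment (μ 0)).map f.continuous).cast hz
        (by rw [← η.source, h]; rfl))).trans (.mk η) =
      .mk (((segment (μ 1)).map f.continuous).cast hz (by rw [← η.target, h]; rfl)) := by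
    obtain rfl : x = f (μ 0) := by rw [← η.source, h]; rfl
    obtain rfl : y = f (μ 1) := by rw [← η.target, h]; rfl
    subst hz
    obtain rfl : η = (⟨μ, rfl, rfl⟩ : Path (μ 0) (μ 1)).map f.continuous := by
      ext τ
      exact h τ
    rw [← Path.Homotopic.Quotient.mk_trans]
    refine Path.Homotopic.Quotient.eq.2 ?_
    have := segment_trans.map f
    rwa [Path.map_trans] at this
  exact transport (edge_zero e).symm

theorem continuousMap_eq_edge_of_forall_mem {Z : Type*} [TopologicalSpace Z]
    (f : C(Z, OneComplex s t)) (e : E) (hf : ∀ z, ∃ r, r ≠ 0 ∧ r ≠ 1 ∧ f z = edge s t e r) :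
    ∃ μ : C(Z, I), ∀ z, f z = edge s t e (μ z) := by
  choose r h0 h1 hr using hf
  let a (z : Z) : ℝ × ℝ := (coordinates (f z)).2 e
  have ha : Continuous a :=
    (continuous_apply e).comp (continuous_snd.comp (continuous_coordinates.comp f.continuous))
  have ha_eq (z : Z) : a z = ((r z : ℝ) * (1 - r z), (r z : ℝ) ^ 2 * (1 - r z)) := by
    simp [a, hr z, coordinates]
  have ha_ne (z : Z) : (a z).1 ≠ 0 := by
    rw [ha_eq]
    exact mul_ne_zero (unitInterval.coe_ne_zero.2 (h0 z))
      (sub_ne_zero.2 (unitInterval.coe_ne_one.2 (h1 z)).symm)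
  have hr_eq (z : Z) : (r z : ℝ) = (a z).2 / (a z).1 := by
    rw [eq_div_iff (ha_ne z), ha_eq]
    ring
  refine ⟨⟨r, continuous_induced_rng.2 ?_⟩, hr⟩
  simp only [Function.comp_def, hr_eq]
  exact ha.snd.div ha.fst ha_ne

/-- The self-map of the unit interval that collapses the outer thirds to the end points. -/
noncomputable def stretchUnit : C(I, I) where
  toFun r := Set.projIcc 0 1 zero_le_one (3 * r - 1)
  continuous_toFun := continuous_projIcc.comp (by fun_prop)

theorem stretchUnit_of_le {r : I} (h : (r : ℝ) ≤ 1 / 3) : stretchUnit r = 0 :=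
  Set.projIcc_of_le_left zero_le_one (by linarith)

theorem stretchUnit_of_ge {r : I} (h : 2 / 3 ≤ (r : ℝ)) : stretchUnit r = 1 :=
  Set.projIcc_of_right_le zero_le_one (by linarith)

@[simp] theorem stretchUnit_zero : stretchUnit 0 = 0 := stretchUnit_of_le (by simp)

@[simp] theorem stretchUnit_one : stretchUnit 1 = 1 := stretchUnit_of_ge (by norm_num)

/-- The map that collapses the outer thirds of every edge to its ends.  It sends a neighborhood of
every vertex to that vertex, so a subdivided path becomes a concatenation of paths inside edges. -/
noncomputable def stretch (s t : E → V) : C(OneComplex s t, OneComplex s t) where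
  toFun := lift (vtx s t) (fun e r => edge s t e (stretchUnit r)) (by simp) (by simp)
  continuous_toFun := continuous_lift _ _ _ _ fun e => by fun_prop

/-- The linear homotopy from the identity of the unit interval to `stretchUnit`. -/
noncomputable def stretchParam : C(I × I, I) where
  toFun x := Set.Icc.convexComb x.1 (stretchUnit x.1) x.2
  continuous_toFun := Set.Icc.continuous_convexComb_prod.comp
    (f := fun x : I × I => (x.1, stretchUnit x.1, x.2)) (by fun_prop)

/-- The homotopy from the identity to `stretch` that is linear on every edge. -/
noncomputable def stretchHomotopy (s t : E → V) :
    ContinuousMap.Homotopy (ContinuousMap.id (OneComplex s t)) (stretch s t) :=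
  homotopy _ _ (fun v => .const _ (vtx s t v))
    (fun e => ⟨fun x => edge s t e (stretchParam x), by fun_prop⟩)
    (by simp [stretchParam]) (by simp [stretchParam]) (fun _ => rfl) (fun _ => rfl)
    (by simp [stretchParam]) (by simp [stretchParam, stretch])

theorem stretchHomotopy_vtx (τ : I) (v : V) : stretchHomotopy s t (τ, vtx s t v) = vtx s t v := rfl

theorem mk_map_stretch {v w : V} (γ : Path (vtx s t v) (vtx s t w)) :
    Path.Homotopic.Quotient.mk γ =
      .mk (γ.map (stretch s t).continuous : Path (vtx s t v) (vtx s t w)) := by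
  refine Path.Homotopic.Quotient.eq.2
    ⟨⟨⟨⟨fun x => stretchHomotopy s t (x.1, γ x.2), by fun_prop⟩,
      fun _ => (stretchHomotopy s t).apply_zero _, fun _ => (stretchHomotopy s t).apply_one _⟩, ?_⟩⟩
  rintro τ x (rfl | rfl)
  · change stretchHomotopy s t (τ, γ 0) = γ 0
    rw [γ.source, stretchHomotopy_vtx]
  · change stretchHomotopy s t (τ, γ 1) = γ 1
    rw [γ.target, stretchHomotopy_vtx]

/-- The open star of radius one third of a vertex. -/
def star (s t : E → V) (v : V) : Set (OneComplex s t) :=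
  {x | lift (fun w => w = v) (fun e (r : I) => ((r : ℝ) < 1 / 3 ∧ s e = v) ∨
    (2 / 3 < (r : ℝ) ∧ t e = v)) (fun e => by norm_num) (fun e => by norm_num) x}

/-- The interior of an edge. -/
def openCell (s t : E → V) (e : E) : Set (OneComplex s t) :=
  {x | ∃ r, r ≠ 0 ∧ r ≠ 1 ∧ x = edge s t e r}

theorem isOpen_star (v : V) : IsOpen (star s t v) := by
  refine isOpen_iff.2 fun e => ?_
  change IsOpen {r : I | ((r : ℝ) < 1 / 3 ∧ s e = v) ∨ (2 / 3 < (r : ℝ) ∧ t e = v)}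
  exact ((isOpen_lt continuous_subtype_val continuous_const).inter isOpen_const).union
    ((isOpen_lt continuous_const continuous_subtype_val).inter isOpen_const)

theorem isOpen_openCell (e : E) : IsOpen (openCell s t e) := by
  refine isOpen_iff.2 fun e' => ?_
  have : edge s t e' ⁻¹' openCell s t e = {r | e' = e ∧ r ≠ 0 ∧ r ≠ 1} := by
    ext r
    constructor
    · rintro ⟨r', h0, h1, h⟩
      obtain ⟨rfl, rfl⟩ := edge_eq_edge h0 h1 h
      exact ⟨rfl, h0, h1⟩
    · rintro ⟨rfl, h0, h1⟩
      exact ⟨r, h0, h1, rfl⟩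
  rw [this]
  exact isOpen_const.inter (isOpen_ne.inter isOpen_ne)

theorem exists_mem_star_or_openCell (x : OneComplex s t) :
    ∃ i : V ⊕ E, x ∈ Sum.elim (star s t) (openCell s t) i := by
  obtain ⟨v, rfl⟩ | ⟨e, hx⟩ := eq_vtx_or_eq_edge x
  · exact ⟨.inl v, rfl⟩
  · exact ⟨.inr e, hx⟩

theorem stretch_of_mem_star {v : V} {x : OneComplex s t} (hx : x ∈ star s t v) :
    stretch s t x = vtx s t v := by
  induction x using ind with
  | vtx w => exact congrArg (vtx s t) hx
  | edge e r =>
    change edge s t e (stretchUnit r) = _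
    rcases (show ((r : ℝ) < 1 / 3 ∧ s e = v) ∨ (2 / 3 < (r : ℝ) ∧ t e = v) from hx) with
      ⟨h, rfl⟩ | ⟨h, rfl⟩
    · rw [stretchUnit_of_le h.le, edge_zero]
    · rw [stretchUnit_of_ge h.le, edge_one]

theorem stretch_comp_eq_edge (hs : Function.Surjective s) {Z : Type*} [TopologicalSpace Z]
    (f : C(Z, OneComplex s t)) (i : V ⊕ E)
    (hf : ∀ z, f z ∈ Sum.elim (star s t) (openCell s t) i) :
    ∃ (e : E) (μ : C(Z, I)), ∀ z, stretch s t (f z) = edge s t e (μ z) := by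
  obtain v | e := i
  · obtain ⟨e, rfl⟩ := hs v
    exact ⟨e, .const Z 0, fun z => (stretch_of_mem_star (hf z)).trans (edge_zero e).symm⟩
  · obtain ⟨μ, hμ⟩ := continuousMap_eq_edge_of_forall_mem f e hf
    exact ⟨e, stretchUnit.comp μ, fun z => by rw [hμ z]; rfl⟩

variable {v₀ : V} {c : ∀ v, Path.Homotopic.Quotient (vtx s t v₀) (vtx s t v)}
  {H : Subgroup (FundamentalGroup (OneComplex s t) (vtx s t v₀))}

theorem exists_return
    (hH : ∀ e, ((c (s e)).trans (.mk (edgePath s t e))).trans (c (t e)).symm ∈ H)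
    (x : OneComplex s t) : ∃ ρ : Path.Homotopic.Quotient x (vtx s t v₀),
      ∀ e r hx, ((c (s e)).trans (.mk (edgeTo s t e r x hx))).trans ρ ∈ H := by
  obtain ⟨v, rfl⟩ | ⟨e', r', h0, h1, rfl⟩ := eq_vtx_or_eq_edge x
  · refine ⟨(c v).symm, fun e r hx => ?_⟩
    rcases edge_eq_vtx hx with ⟨rfl, rfl⟩ | ⟨rfl, rfl⟩
    · rw [edgeTo_zero, Path.Homotopic.Quotient.mk_refl, Path.Homotopic.Quotient.trans_refl,
        Path.Homotopic.Quotient.trans_symm]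
      exact H.one_mem
    · rw [edgeTo_one]
      exact hH e
  · refine ⟨((c (s e')).trans (.mk (edgeTo s t e' r' _ rfl))).symm, fun e r hx => ?_⟩
    obtain ⟨rfl, rfl⟩ := edge_eq_edge h0 h1 hx
    rw [Path.Homotopic.Quotient.trans_symm]
    exact H.one_mem

theorem closesUp_of_eq_edge {ρ : ∀ x, Path.Homotopic.Quotient x (vtx s t v₀)}
    (hρ : ∀ x e r hx, ((c (s e)).trans (.mk (edgeTo s t e r x hx))).trans (ρ x) ∈ H)
    {x y : OneComplex s t} (η : Path x y) (e : E) (μ : C(I, I))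
    (h : ∀ τ, η τ = edge s t e (μ τ)) : ClosesUp H ρ (.mk η) := by
  rw [ClosesUp, ← trans_mem_cancel_left (hρ x e (μ 0) (by rw [← h, η.source]))]
  have hy := hρ y e (μ 1) (by rw [← h, η.target])
  rw [← edgeTo_trans_mk η e μ h] at hy
  simpa only [Path.Homotopic.Quotient.trans_assoc, trans_symm_trans_cancel] using hy

theorem mem_of_map_stretch (hs : Function.Surjective s)
    {ρ : ∀ x, Path.Homotopic.Quotient x (vtx s t v₀)}
    (hρ : ∀ x e r hx, ((c (s e)).trans (.mk (edgeTo s t e r x hx))).trans (ρ x) ∈ H)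
    (hb : ρ (vtx s t v₀) ∈ H) (γ : Path (vtx s t v₀) (vtx s t v₀)) :
    Path.Homotopic.Quotient.mk
      (γ.map (stretch s t).continuous : Path (vtx s t v₀) (vtx s t v₀)) ∈ H := by
  set δ : Path (vtx s t v₀) (vtx s t v₀) := γ.map (stretch s t).continuous
  obtain ⟨u, hu0, hmono, ⟨N, hN⟩, hcover⟩ := exists_monotone_Icc_subset_open_cover_unitInterval
    (c := fun i : V ⊕ E => γ ⁻¹' (Sum.elim (star s t) (openCell s t) i))
    (by
      rintro (v | e)
      exacts [(isOpen_star v).preimage γ.continuous, (isOpen_openCell e).preimage γ.continuous])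
    (fun τ _ => Set.mem_iUnion.2 (exists_mem_star_or_openCell (γ τ)))
  have closesUp_step (n : ℕ) : ClosesUp H ρ (.mk (δ.subpath (u n) (u (n + 1)))) := by
    obtain ⟨i, hi⟩ := hcover n
    have hle : u n ≤ u (n + 1) := hmono n.le_succ
    obtain ⟨e, μ, hμ⟩ := stretch_comp_eq_edge hs
      ⟨fun τ => γ (Set.Icc.convexComb (u n) (u (n + 1)) τ), by fun_prop⟩ i
      fun τ => hi ⟨Set.Icc.le_convexComb hle τ, Set.Icc.convexComb_le hle τ⟩
    exact closesUp_of_eq_edge hρ _ e μ hμ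
  have closesUp_subpath := ClosesUp.of_subpath δ u closesUp_step N
  rw [hN N le_rfl, hu0, Path.subpath_zero_one] at closesUp_subpath
  exact closesUp_subpath.mem_of_cast hb

theorem eq_top_of_edgePath_mem (hs : Function.Surjective s) (hc : c v₀ = .refl _)
    (hH : ∀ e, ((c (s e)).trans (.mk (edgePath s t e))).trans (c (t e)).symm ∈ H) : H = ⊤ := by
  choose ρ hρ using exists_return hH
  have hb : ρ (vtx s t v₀) ∈ H := by
    obtain ⟨e, rfl⟩ := hs v₀
    have := hρ _ e 0 (edge_zero e)
    rwa [edgeTo_zero, hc, Path.Homotopic.Quotient.mk_refl, Path.Homotopic.Quotient.trans_refl,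
      Path.Homotopic.Quotient.refl_trans] at this
  refine (Subgroup.eq_top_iff' H).2 fun g => ?_
  obtain ⟨γ, rfl⟩ := Path.Homotopic.Quotient.mk_surjective g
  rw [mk_map_stretch]
  exact mem_of_map_stretch hs hρ hb γ

end generators

end OneComplex

/-! ### Ends and rank of a ray with loops -/

theorem oneEnded_of_joinedIn {X : Type*} [TopologicalSpace X] [NoncompactSpace X]
    (h : ∀ K : Set X, IsCompact K → ∃ L, IsCompact L ∧ ∀ x ∉ L, ∀ y ∉ L, JoinedIn Kᶜ x y) :
    OneEnded X := by
  choose L hL joined using h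
  choose x hx using fun K hK => (Set.ne_univ_iff_exists_notMem (L K hK)).1 (hL K hK).ne_univ
  have hxK (K hK) : x K hK ∈ Kᶜ := (joined K hK _ (hx K hK) _ (hx K hK)).source_mem
  let ε : EndSpace X := .mk (fun K hK => .mk ⟨x K hK, hxK K hK⟩) fun K K' hK hK' hKK' => by
    obtain ⟨z, hz⟩ := (Set.ne_univ_iff_exists_notMem _).1 ((hL K hK).union (hL K' hK')).ne_univ
    have h₁ := (joined K' hK' _ (hx K' hK') z fun h => hz (.inr h)).mono
      (Set.compl_subset_compl.2 hKK')
    have h₂ := joined K hK z (fun h => hz (.inl h)) _ (hx K hK)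
    exact ZerothHomotopy.sound (h₁.trans h₂).joined_subtype.somePath
  refine ⟨⟨⟨ε⟩, fun ε' => ?_⟩⟩
  ext K hK
  rw [← ε'.piZeroCompl_comp hK (hK.union (hL K hK)) Set.subset_union_left]
  generalize ε'.comp _ _ = z
  induction z using ZerothHomotopy.rec with
  | mk y =>
    have := joined K hK y (fun h => y.2 (.inr h)) _ (hx K hK)
    exact ZerothHomotopy.sound (X := ↥Kᶜ) this.joined_subtype.somePath

theorem circle_loop_ne_refl (γ : Path (0 : AddCircle (1 : ℝ)) 0)
    (h : ∀ τ : I, γ τ = ((τ : ℝ) : AddCircle (1 : ℝ))) :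
    Path.Homotopic.Quotient.mk γ ≠ .refl 0 := fun hγ => by
  have cov := AddCircle.isCoveringMap_coe (1 : ℝ)
  let γ' : Path (0 : ℝ) 1 := ⟨⟨fun τ => τ, by fun_prop⟩, rfl, rfl⟩
  have monodromy_eq : cov.monodromy (.mk γ) ⟨0, rfl⟩ = ⟨1, AddCircle.coe_period 1⟩ := by
    refine cov.monodromy_eq_of_map_eq (.mk γ') ?_
    refine congrArg Path.Homotopic.Quotient.mk (?_ : γ'.map cov.continuous = γ.cast rfl
      (AddCircle.coe_period 1))
    exact Path.ext (funext fun τ => (h τ).symm)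
  rw [hγ, cov.monodromy_refl] at monodromy_eq
  exact zero_ne_one (congrArg Subtype.val monodromy_eq)

open CategoryTheory in
theorem map_eq_id_of_map_conj_eq_id {C D : Type*} [Groupoid C] [Groupoid D] (F : C ⥤ D) {x y : C}
    (p : x ⟶ y) (q : y ⟶ y) (h : F.map ((p ≫ q) ≫ Groupoid.inv p) = 𝟙 _) : F.map q = 𝟙 _ := by
  rw [Groupoid.inv_eq_inv, F.map_comp, F.map_comp, F.map_inv, IsIso.comp_inv_eq, Category.id_comp]
    at h
  rwa [← cancel_epi (F.map p), Category.comp_id]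

namespace OneComplex

section ray

variable {V E E₁ : Type*} {s t : E → V} (n : E₁ → ℕ)

theorem joinedIn_edge {F : Set (OneComplex s t)} {e : E} (h : ∀ r, edge s t e r ∈ F) (r : I) :
    JoinedIn F (vtx s t (s e)) (edge s t e r) :=
  ⟨edgeTo s t e r _ rfl, fun τ => h (τ * r)⟩

theorem joinedIn_tgt {F : Set (OneComplex s t)} {e : E} (h : ∀ r, edge s t e r ∈ F) :
    JoinedIn F (vtx s t (s e)) (vtx s t (t e)) :=
  ⟨edgePath s t e, h⟩

theorem joinedIn_ray {F : Set (LoopedRay n)} {N : ℕ} (h0 : vtx _ _ N ∈ F)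
    (h : ∀ k, N ≤ k → ∀ r, edge _ _ (Sum.inl k) r ∈ F) {k : ℕ} (hk : N ≤ k) :
    JoinedIn F (vtx _ _ N) (vtx _ _ k) := by
  induction k, hk using Nat.le_induction with
  | base => exact .refl h0
  | succ k hk ih => exact ih.trans (joinedIn_tgt (e := (Sum.inl k : ℕ ⊕ E₁)) (h k hk))

theorem pathConnectedSpace_of_joined_vtx {v₀ : V}
    (h : ∀ v, Joined (vtx s t v₀) (vtx s t v)) : PathConnectedSpace (OneComplex s t) := by
  have joined (x : OneComplex s t) : Joined (vtx s t v₀) x := by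
    induction x using ind with
    | vtx v => exact h v
    | edge e r =>
      exact (h _).trans (joinedIn_univ.1 (joinedIn_edge (F := Set.univ) (fun _ => trivial) r))
  exact ⟨⟨vtx s t v₀⟩, fun x y => (joined x).symm.trans (joined y)⟩

instance pathConnectedSpace_loopedRay : PathConnectedSpace (LoopedRay n) :=
  pathConnectedSpace_of_joined_vtx fun k =>
    joinedIn_univ.1 (joinedIn_ray n (F := Set.univ) trivial (fun _ _ _ => trivial) k.zero_le)

instance noncompactSpace_loopedRay : NoncompactSpace (LoopedRay n) :=
  ⟨fun h => Set.infinite_univ ((finite_vertices h).subset fun _ _ => trivial)⟩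

variable {n}

theorem exists_forall_edge_notMem (hn : ∀ k, {i | n i = k}.Finite) {K : Set (LoopedRay n)}
    (hK : IsCompact K) :
    ∃ N, ∀ e : ℕ ⊕ E₁, N ≤ Sum.elim id n e → ∀ r, edge _ _ e r ∉ K := by
  obtain ⟨N, hN⟩ := ((finite_edges (locallyFinite_loopedRay hn) hK).image (Sum.elim id n)).bddAbove
  exact ⟨N + 1, fun e he r hr => (hN ⟨e, ⟨r, hr⟩, rfl⟩).not_gt he⟩

theorem exists_edge_of_notMem_subcomplex {N : ℕ} {x : LoopedRay n}
    (hx : x ∉ subcomplex _ _ ∅ {e | Sum.elim id n e < N}) :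
    ∃ e r, N ≤ Sum.elim id n e ∧ x = edge _ _ e r := by
  obtain ⟨e, r, rfl⟩ : ∃ e r, x = edge _ _ e r := by
    induction x using ind with
    | vtx k => exact ⟨.inl k, 0, (edge_zero (s := Sum.elim id n) (Sum.inl k)).symm⟩
    | edge e r => exact ⟨e, r, rfl⟩
  exact ⟨e, r, not_lt.1 fun h => hx (.inr (Set.mem_biUnion (x := e) h ⟨r, rfl⟩)), rfl⟩

theorem oneEnded_loopedRay (hn : ∀ k, {i | n i = k}.Finite) : OneEnded (LoopedRay n) := by
  refine oneEnded_of_joinedIn fun K hK => ?_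
  obtain ⟨N, hN⟩ := exists_forall_edge_notMem hn hK
  have finite_lt : {e : ℕ ⊕ E₁ | Sum.elim id n e < N}.Finite :=
    ((Set.finite_Iio N).biUnion fun k _ => (locallyFinite_loopedRay hn k).1).subset
      fun e he => Set.mem_biUnion (x := Sum.elim id n e) he rfl
  have joined_vtx {k : ℕ} (hk : N ≤ k) : JoinedIn Kᶜ (vtx _ _ N) (vtx _ _ k) :=
    joinedIn_ray n (edge_zero (s := Sum.elim id n) (.inl N) ▸ hN (.inl N) le_rfl 0)
      (fun k hk => hN (.inl k) hk) hk
  have joined (x) (hx : x ∉ subcomplex _ _ ∅ {e | Sum.elim id n e < N}) :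
      JoinedIn Kᶜ (vtx _ _ N) x := by
    obtain ⟨e, r, he, rfl⟩ := exists_edge_of_notMem_subcomplex hx
    exact (joined_vtx he).trans (joinedIn_edge (hN e he) r)
  exact ⟨_, isCompact_subcomplex Set.finite_empty finite_lt,
    fun x hx y hy => (joined x hx).symm.trans (joined y hy)⟩

variable (n)

/-- The class of the path along the ray from its origin to a vertex. -/
noncomputable def rayPath : ∀ k : ℕ, Path.Homotopic.Quotient
    (vtx (Sum.elim id n) (Sum.elim Nat.succ n) 0) (vtx (Sum.elim id n) (Sum.elim Nat.succ n) k)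
  | 0 => .refl _
  | k + 1 => (rayPath k).trans (.mk (edgePath (Sum.elim id n) (Sum.elim Nat.succ n) (Sum.inl k)))

/-- The element of the fundamental group that runs around a loop attached to the ray. -/
noncomputable def rayLoop (i : E₁) : FundamentalGroup (LoopedRay n) (vtx _ _ 0) :=
  ((rayPath n (n i)).trans (.mk (edgePath (Sum.elim id n) (Sum.elim Nat.succ n) (Sum.inr i)))).trans
    (rayPath n (n i)).symm

theorem closure_range_rayLoop : Subgroup.closure (Set.range (rayLoop n)) = ⊤ := by
  refine eq_top_of_edgePath_mem (c := rayPath n) (fun v => ⟨Sum.inl v, rfl⟩) rfl ?_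
  rintro (k | i)
  · exact (congrArg (· ∈ _) (Path.Homotopic.Quotient.trans_symm (rayPath n (k + 1)))).mpr
      (one_mem _)
  · exact Subgroup.subset_closure ⟨i, rfl⟩

theorem groupRank_loopedRay_ne_top [Finite E₁] :
    groupRank (FundamentalGroup (LoopedRay n) (vtx _ _ 0)) ≠ ⊤ :=
  ((iInf_le _ ⟨_, closure_range_rayLoop n⟩).trans_lt (Set.finite_range _).encard_lt_top).ne

open Classical in
/-- The map to the circle that winds once around the loop `i` and is constant elsewhere. -/
noncomputable def loopCollapse (i : E₁) : C(LoopedRay n, AddCircle (1 : ℝ)) where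
  toFun := lift (fun _ => 0)
    (fun e r => if e = .inr i then ((r : ℝ) : AddCircle (1 : ℝ)) else 0)
    (by simp) (by simp [AddCircle.coe_period])
  continuous_toFun := continuous_lift _ _ _ _ fun e => by
    split_ifs
    · exact (AddCircle.isCoveringMap_coe (1 : ℝ)).continuous.comp continuous_subtype_val
    · exact continuous_const

theorem loopCollapse_eq_zero {i : E₁} {F : Set (LoopedRay n)}
    (hF : ∀ r, r ≠ 0 → r ≠ 1 → edge _ _ (Sum.inr i) r ∉ F) {x : LoopedRay n} (hx : x ∈ F) :
    loopCollapse n i x = 0 := by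
  obtain ⟨v, rfl⟩ | ⟨e, r, h0, h1, rfl⟩ := eq_vtx_or_eq_edge x
  · rfl
  · refine if_neg ?_
    rintro rfl
    exact hF r h0 h1 hx

theorem map_loopCollapse_rayLoop_ne_one (i : E₁) :
    FundamentalGroup.map (loopCollapse n i) (vtx _ _ 0) (rayLoop n i) ≠ 1 := by
  intro h
  let ℓ : Path.Homotopic.Quotient (vtx _ _ (n i) : LoopedRay n) (vtx _ _ (n i)) :=
    .mk (edgePath _ _ (Sum.inr i))
  have map_ℓ : ℓ.map (loopCollapse n i) = .refl _ :=
    map_eq_id_of_map_conj_eq_id (FundamentalGroupoid.map (loopCollapse n i)) (x := ⟨vtx _ _ 0⟩)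
      (y := ⟨vtx _ _ (n i)⟩) (rayPath n (n i)) ℓ h
  exact circle_loop_ne_refl ((edgePath _ _ (Sum.inr i)).map (loopCollapse n i).continuous)
    (fun τ => if_pos rfl) map_ℓ

theorem groupRank_loopedRay [Infinite E₁] :
    groupRank (FundamentalGroup (LoopedRay n) (vtx _ _ 0)) = ⊤ := by
  refine iInf_eq_top.2 fun ⟨S, hS⟩ => Set.encard_eq_top_iff.2 fun hfin => ?_
  choose γ hγ using fun g : FundamentalGroup (LoopedRay n) (vtx _ _ 0) =>
    Path.Homotopic.Quotient.mk_surjective g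
  obtain ⟨i, hi⟩ := (hfin.biUnion fun g _ =>
    (finite_openEdges (isCompact_range (γ g).continuous)).preimage (f := Sum.inr)
      Sum.inr_injective.injOn).exists_notMem
  have map_eq_one : FundamentalGroup.map (loopCollapse n i) (vtx _ _ 0) = 1 := by
    refine MonoidHom.eq_of_eqOn_dense hS fun g hg => ?_
    rw [← hγ g]
    refine congrArg Path.Homotopic.Quotient.mk (Path.ext (funext fun τ => ?_))
    exact loopCollapse_eq_zero n
      (fun r h0 h1 hr => hi (Set.mem_biUnion hg ⟨r, h0, h1, hr⟩)) ⟨τ, rfl⟩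
  exact map_loopCollapse_rayLoop_ne_one n i (DFunLike.congr_fun map_eq_one _)

end ray

end OneComplex

/-! ### One-ended spanning trees -/

section oneEndedGraph

variable {V : Type*} {G : SimpleGraph V} {A B : Set V} {u v : V}

/-- The edges of `G` with both ends in `A`, as a graph on all vertices. -/
abbrev inducedOn (G : SimpleGraph V) (A : Set V) : SimpleGraph V := (G.induce A).spanningCoe

theorem inducedOn_adj : (inducedOn G A).Adj u v ↔ u ∈ A ∧ v ∈ A ∧ G.Adj u v := by
  simp only [SimpleGraph.map_adj, SimpleGraph.comap_adj, Function.Embedding.subtype_apply,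
    Subtype.exists, exists_and_left, exists_prop]
  grind

theorem inducedOn_mono (h : A ⊆ B) : inducedOn G A ≤ inducedOn G B := fun u v huv => by
  rw [inducedOn_adj] at huv ⊢
  exact ⟨h huv.1, h huv.2.1, huv.2.2⟩

theorem inducedOn_reachable_of_adj (hu : u ∈ A) (hv : v ∈ A) (h : G.Adj u v) :
    (inducedOn G A).Reachable u v :=
  (inducedOn_adj.2 ⟨hu, hv, h⟩).reachable

theorem exists_finite_of_inducedOn_reachable (h : (inducedOn G A).Reachable u v) (hu : u ∈ A) :
    ∃ C ⊆ A, C.Finite ∧ u ∈ C ∧ v ∈ C ∧ ∀ x ∈ C, (inducedOn G C).Reachable u x := by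
  obtain ⟨w⟩ := h
  induction w with
  | nil => exact ⟨{_}, by simpa, Set.finite_singleton _, rfl, rfl, by rintro _ rfl; exact .rfl⟩
  | @cons u y v huy _ ih =>
    obtain ⟨-, hy, huy⟩ := inducedOn_adj.1 huy
    obtain ⟨C, hCA, hC, hyC, hvC, reach⟩ := ih hy
    have reach_y : (inducedOn G (insert u C)).Reachable u y :=
      inducedOn_reachable_of_adj (.inl rfl) (.inr hyC) huy
    refine ⟨insert u C, Set.insert_subset hu hCA, hC.insert u, .inl rfl, .inr hvC, ?_⟩
    rintro x (rfl | hx)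
    · exact .rfl
    · exact reach_y.trans ((reach x hx).mono (inducedOn_mono (Set.subset_insert u C)))

theorem inducedOn_component_reachable (h : (inducedOn G A).Reachable u v) :
    (inducedOn G {x | (inducedOn G A).Reachable u x}).Reachable u v := by
  obtain ⟨w⟩ := h.symm
  induction w with
  | nil => exact .rfl
  | cons hvy w ih =>
    have hy := w.reverse.reachable
    exact (ih hy).trans (inducedOn_reachable_of_adj hy (hy.trans hvy.symm.reachable)
      (inducedOn_adj.1 hvy.symm).2.2)

/-- The vertex analogue of `OneEnded`. -/
def OneEndedGraph (G : SimpleGraph V) : Prop :=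
  ∀ D : Set V, D.Finite →
    ∃ A : Set V, Aᶜ.Finite ∧ Disjoint A D ∧ ∀ u ∈ A, ∀ v ∈ A, (inducedOn G A).Reachable u v

theorem mem_of_inducedOn_reachable (h : (inducedOn G A).Reachable u v) (hu : u ∈ A) : v ∈ A := by
  obtain ⟨C, hCA, -, -, hv, -⟩ := exists_finite_of_inducedOn_reachable h hu
  exact hCA hv

theorem inducedOn_diff_component_reachable {C : Set V} {b n x : V} (hCA : C ⊆ A) (hb : b ∈ A \ C)
    (hC : ∀ y ∈ C, (inducedOn G C).Reachable y n) (hx : x ∈ A)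
    (hbx : ¬(inducedOn G (A \ C)).Reachable b x) (hxn : (inducedOn G A).Reachable x n) :
    (inducedOn G (A \ {y | (inducedOn G (A \ C)).Reachable b y})).Reachable x n := by
  obtain ⟨w⟩ := hxn
  induction w with
  | nil => exact .rfl
  | @cons x y n hxy _ ih =>
    by_cases hxC : x ∈ C
    · refine (hC x hxC).mono (inducedOn_mono fun z hz => ⟨hCA hz, fun hbz => ?_⟩)
      exact (mem_of_inducedOn_reachable hbz hb).2 hz
    · obtain ⟨-, hy, hxy⟩ := inducedOn_adj.1 hxy
      have hby : ¬(inducedOn G (A \ C)).Reachable b y := fun hby =>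
        hbx (hby.trans (inducedOn_reachable_of_adj (mem_of_inducedOn_reachable hby hb) ⟨hx, hxC⟩
          hxy.symm))
      exact .trans (inducedOn_reachable_of_adj (Set.mem_sdiff_of_mem hx hbx)
        (Set.mem_sdiff_of_mem hy hby) hxy) (ih hC hy hby)

theorem OneEndedGraph.exists_layer [Infinite V] (hG : OneEndedGraph G) {n : V} (v : V)
    (hA : Aᶜ.Finite) (conn : ∀ x ∈ A, ∀ y ∈ A, (inducedOn G A).Reachable x y) (hn : n ∈ A) :
    ∃ A' ⊆ A, A'ᶜ.Finite ∧ (∀ x ∈ A', ∀ y ∈ A', (inducedOn G A').Reachable x y) ∧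
      n ∉ A' ∧ v ∉ A' ∧ ∃ c ∈ A \ A', (∃ n' ∈ A', G.Adj c n') ∧
      ∀ x ∈ A \ A', (inducedOn G (A \ A')).Reachable x c := by
  classical
  obtain ⟨C, hCA, hC, hnC, hvC, reach⟩ := exists_finite_of_inducedOn_reachable
    (v := if v ∈ A then v else n) (conn n hn _ (by split_ifs <;> assumption)) hn
  obtain ⟨B, hB, hBD, conn_B⟩ := hG (Aᶜ ∪ C) (hA.union hC)
  have hBAC : B ⊆ A \ C := fun x hx => by
    simpa [not_or] using Set.disjoint_left.1 hBD hx
  obtain ⟨b, hb⟩ : B.Nonempty := (compl_compl B ▸ hB.infinite_compl).nonempty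
  set A' := {x | (inducedOn G (A \ C)).Reachable b x} with hA'_def
  have hA'AC : A' ⊆ A \ C := fun x hx => mem_of_inducedOn_reachable hx (hBAC hb)
  have reach_n {x} (hx : x ∈ A \ A') : (inducedOn G (A \ A')).Reachable x n :=
    inducedOn_diff_component_reachable hCA (hBAC hb) (fun y hy => (reach y hy).symm) hx.1 hx.2
      (conn x hx.1 n hn)
  have reach_b {x} (hx : x ∈ A') : (inducedOn G A').Reachable b x :=
    inducedOn_component_reachable hx
  obtain ⟨w⟩ := conn n hn b (hBAC hb).1
  obtain ⟨d, -, hd, hd'⟩ := w.exists_boundary_dart A'ᶜ (fun h => (hA'AC h).2 hnC)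
    (not_not.2 .rfl)
  obtain ⟨hdA, -, hadj⟩ := inducedOn_adj.1 d.adj
  refine ⟨A', fun x hx => (hA'AC hx).1, hB.subset (Set.compl_subset_compl.2 fun x hx =>
    (conn_B b hb x hx).mono (inducedOn_mono hBAC)), fun x hx y hy => (reach_b hx).symm.trans
    (reach_b hy), fun h => (hA'AC h).2 hnC, fun h => ?_, d.fst, ⟨hdA, hd⟩,
    ⟨d.snd, not_not.1 hd', hadj⟩, fun x hx => (reach_n hx).trans (reach_n ⟨hdA, hd⟩).symm⟩
  rw [if_pos (hA'AC h).1] at hvC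
  exact (hA'AC h).2 hvC

theorem OneEndedGraph.exists_layers [Infinite V] [Countable V] (hG : OneEndedGraph G)
    (hconn : G.Preconnected) :
    ∃ (A : ℕ → Set V) (n c : ℕ → V), A 0 = Set.univ ∧ Antitone A ∧ (∀ j, (A j)ᶜ.Finite) ∧
      (∀ v, ∃ j, v ∉ A (j + 1)) ∧ ∀ j, n j ∈ A j \ A (j + 1) ∧ c j ∈ A j \ A (j + 1) ∧
        G.Adj (c j) (n (j + 1)) ∧
        ∀ v ∈ A j \ A (j + 1), (inducedOn G (A j \ A (j + 1))).Reachable v (c j) := by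
  obtain ⟨f, hf⟩ := exists_surjective_nat V
  let Stage := {x : Set V × V // x.1ᶜ.Finite ∧
    (∀ u ∈ x.1, ∀ v ∈ x.1, (inducedOn G x.1).Reachable u v) ∧ x.2 ∈ x.1}
  have exists_next (j : ℕ) (x : Stage) : ∃ (y : Stage) (c : V), y.1.1 ⊆ x.1.1 ∧ x.1.2 ∉ y.1.1 ∧
      f j ∉ y.1.1 ∧ c ∈ x.1.1 \ y.1.1 ∧ G.Adj c y.1.2 ∧
      ∀ z ∈ x.1.1 \ y.1.1, (inducedOn G (x.1.1 \ y.1.1)).Reachable z c := by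
    obtain ⟨⟨A, n⟩, hA, conn, hn⟩ := x
    obtain ⟨A', hA'A, hA', conn', hnA', hfA', c, hc, ⟨n', hn', hadj⟩, reach⟩ :=
      hG.exists_layer (f j) hA conn hn
    exact ⟨⟨⟨A', n'⟩, hA', conn', hn'⟩, c, hA'A, hnA', hfA', hc, hadj, reach⟩
  choose next exit next_subset entry_notMem f_notMem exit_mem exit_adj reach using exists_next
  let S : ℕ → Stage := Nat.rec ⟨⟨Set.univ, f 0⟩, by simp,
    fun u _ v _ => (hconn u v).mono (G.spanningCoe_induce_univ).ge, trivial⟩ next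
  refine ⟨fun j => (S j).1.1, fun j => (S j).1.2, fun j => exit j (S j), rfl,
    antitone_nat_of_succ_le fun j => next_subset j (S j), fun j => (S j).2.1, fun v => ?_,
    fun j => ⟨⟨(S j).2.2.2, entry_notMem j _⟩, exit_mem j _, exit_adj j _, reach j _⟩⟩
  obtain ⟨j, rfl⟩ := hf v
  exact ⟨j, f_notMem j (S j)⟩

theorem OneEndedGraph.exists_levels [Infinite V] [Countable V] (hG : OneEndedGraph G)
    (hconn : G.Preconnected) :
    ∃ (lev : V → ℕ) (c : ℕ → V), (∀ j, {v | lev v ≤ j}.Finite) ∧ (∀ j, lev (c j) = j) ∧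
      (∀ j, ∃ n, lev n = j + 1 ∧ G.Adj (c j) n) ∧
      ∀ v, (inducedOn G {x | lev x = lev v}).Reachable v (c (lev v)) := by
  classical
  obtain ⟨A, n, c, A_zero, anti, cofinite, exists_notMem, hA⟩ := hG.exists_layers hconn
  let lev (v : V) : ℕ := Nat.find (exists_notMem v)
  have lev_eq_iff {v j} : lev v = j ↔ v ∈ A j \ A (j + 1) := by
    refine ⟨?_, fun hv => (Nat.find_eq_iff _).2
      ⟨hv.2, fun k hk => not_not.2 (anti (Nat.succ_le_of_lt hk) hv.1)⟩⟩
    rintro rfl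
    refine ⟨?_, Nat.find_spec (exists_notMem v)⟩
    rcases h : lev v with _ | j
    · exact A_zero ▸ trivial
    · exact not_not.1 (Nat.find_min (exists_notMem v) (h.symm ▸ j.lt_succ_self : j < lev v))
  refine ⟨lev, c, fun j => (cofinite (j + 1)).subset fun v hv hvA => ?_,
    fun j => lev_eq_iff.2 (hA j).2.1, fun j => ⟨n (j + 1), ?_, (hA j).2.2.1⟩, fun v => ?_⟩
  · exact (lev_eq_iff.1 (rfl : lev v = lev v)).2 (anti (Nat.succ_le_succ hv) hvA)
  · exact lev_eq_iff.2 (hA (j + 1)).1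
  · simp_rw [lev_eq_iff]
    exact (hA _).2.2.2 v (lev_eq_iff.1 rfl)

theorem exists_adj_dist_lt (h : G.Reachable u v) (hne : u ≠ v) :
    ∃ y, G.Adj u y ∧ G.dist y v < G.dist u v := by
  obtain ⟨w, hw⟩ := h.exists_walk_length_eq_dist
  cases w with
  | nil => exact absurd rfl hne
  | cons huy w => exact ⟨_, huy, hw ▸ (SimpleGraph.dist_le w).trans_lt w.length.lt_succ_self⟩

theorem OneEndedGraph.exists_tree [Infinite V] [Countable V] (hG : OneEndedGraph G)
    (hconn : G.Preconnected) : ∃ p : V → V,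
      (∀ v, G.Adj v (p v)) ∧ OneComplex.FinitePredecessors p ∧ OneComplex.Merging p := by
  obtain ⟨lev, c, finite_le, lev_c, exists_entry, reach⟩ := hG.exists_levels hconn
  let d (v : V) : ℕ := (inducedOn G {x | lev x = lev v}).dist v (c (lev v))
  have exists_step (v : V) : ∃ y, G.Adj v y ∧ (v = c (lev v) ∧ lev y = lev v + 1 ∨
      v ≠ c (lev v) ∧ lev y = lev v ∧ d y < d v) := by
    by_cases hv : v = c (lev v)
    · obtain ⟨n, hn, hadj⟩ := exists_entry (lev v)
      exact ⟨n, hv ▸ hadj, .inl ⟨hv, hn⟩⟩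
    · obtain ⟨y, hvy, hy⟩ := exists_adj_dist_lt (reach v) hv
      obtain ⟨-, lev_y, hvy⟩ := inducedOn_adj.1 hvy
      exact ⟨y, hvy, .inr ⟨hv, lev_y, by simpa only [d, show lev y = lev v from lev_y] using hy⟩⟩
  choose p adj hp using exists_step
  have lev_le (v : V) : lev v ≤ lev (p v) := by
    rcases hp v with ⟨-, h⟩ | ⟨-, h, -⟩ <;> omega
  have reaches_exit (v : V) : ∃ m, p^[m] v = c (lev v) := by
    induction hd : d v using Nat.strong_induction_on generalizing v with
    | _ k ih =>
      rcases hp v with ⟨hv, -⟩ | ⟨-, hlev, hlt⟩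
      · exact ⟨0, hv⟩
      · obtain ⟨m, hm⟩ := ih _ (hd ▸ hlt) (p v) rfl
        exact ⟨m + 1, hlev ▸ hm⟩
  have reaches_later_exit (v : V) (i : ℕ) : ∃ m, p^[m] v = c (lev v + i) := by
    induction i with
    | zero => exact reaches_exit v
    | succ i ih =>
      obtain ⟨m, hm⟩ := ih
      obtain ⟨m', hm'⟩ := reaches_exit (p (c (lev v + i)))
      have lev_p : lev (p (c (lev v + i))) = lev v + (i + 1) := by
        rcases hp (c (lev v + i)) with ⟨-, h⟩ | ⟨h, -⟩
        · rw [h, lev_c, add_assoc]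
        · exact absurd (by rw [lev_c]) h
      refine ⟨m' + (m + 1), ?_⟩
      rw [Function.iterate_add_apply, Function.iterate_succ_apply', hm, hm', lev_p]
  refine ⟨p, adj, fun v => (finite_le (lev v)).subset ?_, fun u v => ?_⟩
  · rintro u ⟨j, rfl⟩
    exact monotone_nat_of_le_succ (f := fun j => lev (p^[j] u))
      (fun j => Function.iterate_succ_apply' p j u ▸ lev_le _) j.zero_le
  · obtain ⟨m, hm⟩ := reaches_later_exit u (lev v)
    obtain ⟨m', hm'⟩ := reaches_later_exit v (lev u)
    exact ⟨m, m', by rw [hm, hm', add_comm]⟩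

end oneEndedGraph

/-! ### From the ends of the realization to the graph -/

namespace OneComplex

section openStar

variable {V E : Type*} {s t : E → V} {S D : Set V}

/-- The union of the half-open edges that issue from the vertices in `S`. -/
def openStar (s t : E → V) (S : Set V) : Set (OneComplex s t) :=
  {x | lift (· ∈ S) (fun e (r : I) => r ≠ 1 ∧ s e ∈ S ∨ r ≠ 0 ∧ t e ∈ S) (by simp) (by simp) x}

theorem isOpen_openStar : IsOpen (openStar s t S) :=
  isOpen_iff.2 fun e => show IsOpen {r : I | r ≠ 1 ∧ s e ∈ S ∨ r ≠ 0 ∧ t e ∈ S} from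
    (isOpen_ne.inter isOpen_const).union (isOpen_ne.inter isOpen_const)

theorem isClosed_openStar_union (hs : ∀ e, s e ∈ S → t e ∈ S ∪ D)
    (ht : ∀ e, t e ∈ S → s e ∈ S ∪ D) :
    IsClosed (openStar s t S ∪ vtx s t '' D) := by
  refine isClosed_iff.2 fun e => ?_
  have vtx_mem {v} (hv : v ∈ S ∪ D) : vtx s t v ∈ openStar s t S ∪ vtx s t '' D :=
    hv.imp id (Set.mem_image_of_mem _)
  have edge_mem {r} (h : r ≠ 1 ∧ s e ∈ S ∨ r ≠ 0 ∧ t e ∈ S) :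
      edge s t e r ∈ openStar s t S ∪ vtx s t '' D := .inl h
  by_cases h : s e ∈ S ∨ t e ∈ S
  · convert isClosed_univ
    refine Set.eq_univ_of_forall fun r => ?_
    by_cases h0 : r = 0
    · rw [Set.mem_preimage, h0, edge_zero]
      exact vtx_mem (h.elim .inl (ht e))
    by_cases h1 : r = 1
    · rw [Set.mem_preimage, h1, edge_one]
      exact vtx_mem (h.elim (hs e) .inl)
    exact edge_mem (h.imp (⟨h1, ·⟩) (⟨h0, ·⟩))
  · refine ((Set.toFinite {0, 1}).subset fun r hr => ?_).isClosed
    rcases hr with hr | ⟨v, -, hr⟩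
    · exact absurd (Or.imp And.right And.right hr) h
    · exact (edge_eq_vtx hr.symm).imp And.left And.left

theorem mem_of_isPreconnected (hs : ∀ e, s e ∈ S → t e ∈ S ∪ D) (ht : ∀ e, t e ∈ S → s e ∈ S ∪ D)
    {F : Set (OneComplex s t)} (hF : IsPreconnected F) (hFD : Disjoint F (vtx s t '' D)) {u v : V}
    (huF : vtx s t u ∈ F) (hvF : vtx s t v ∈ F) (hu : u ∈ S) : v ∈ S := by
  refine hF.subset_left_of_subset_union (isOpen_openStar (S := S))
    (isClosed_openStar_union hs ht).isOpen_compl ?_ (fun x hx => ?_) ⟨_, huF, hu⟩ hvF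
  · exact disjoint_compl_right.mono_left Set.subset_union_left
  · have := Set.disjoint_left.1 hFD hx
    by_cases hxS : x ∈ openStar s t S
    exacts [.inl hxS, .inr (not_or.2 ⟨hxS, this⟩)]

end openStar

end OneComplex

namespace PointedGraph

variable {Γ : PointedGraph} {u v : Γ.V}

/-- All vertices have finite degree. -/
def LocallyFinite (Γ : PointedGraph) : Prop := ∀ v, Γ.degree v < ⊤

theorem LocallyFinite.finite_incident (h : Γ.LocallyFinite) (v : Γ.V) :
    {e | v ∈ Γ.ends e}.Finite :=
  Set.encard_lt_top_iff.1 (lt_of_le_of_lt le_self_add (h v))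

theorem src_mem (e : Γ.E) : Γ.src e ∈ Γ.ends e := by rw [← mk_src_tgt]; simp

theorem tgt_mem (e : Γ.E) : Γ.tgt e ∈ Γ.ends e := by rw [← mk_src_tgt]; simp

theorem mem_ends {e : Γ.E} : v ∈ Γ.ends e ↔ v = Γ.src e ∨ v = Γ.tgt e := by
  rw [← mk_src_tgt, Sym2.mem_iff]

theorem LocallyFinite.oneComplex (h : Γ.LocallyFinite) :
    OneComplex.LocallyFinite Γ.src Γ.tgt := fun v =>
  ⟨(h.finite_incident v).subset fun e (he : Γ.src e = v) => he ▸ src_mem e,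
    (h.finite_incident v).subset fun e (he : Γ.tgt e = v) => he ▸ tgt_mem e⟩

theorem LocallyFinite.finite_adj (h : Γ.LocallyFinite) (u : Γ.V) :
    {v | Γ.adjGraph.Adj u v}.Finite := by
  refine ((h.finite_incident u).biUnion fun e _ => Set.Subsingleton.finite
    (s := {v | Γ.ends e = s(u, v)}) fun v hv w hw => ?_).subset ?_
  · exact Sym2.congr_right.1 (hv.symm.trans hw)
  · rintro v ⟨-, e, he⟩
    exact Set.mem_biUnion (x := e) (show u ∈ Γ.ends e by rw [he]; exact Sym2.mem_mk_left u v) he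

theorem exists_edge_of_adj (h : Γ.adjGraph.Adj u v) :
    ∃ e, Γ.src e = u ∧ Γ.tgt e = v ∨ Γ.src e = v ∧ Γ.tgt e = u := by
  obtain ⟨-, e, he⟩ := h
  exact ⟨e, Sym2.eq_iff.1 ((mk_src_tgt Γ e).trans he)⟩

theorem reachable_src_tgt {A : Set Γ.V} {e : Γ.E} (hs : Γ.src e ∈ A) (ht : Γ.tgt e ∈ A) :
    (inducedOn Γ.adjGraph A).Reachable (Γ.src e) (Γ.tgt e) := by
  by_cases h : Γ.src e = Γ.tgt e
  · rw [h]
  · exact inducedOn_reachable_of_adj hs ht ⟨h, e, (mk_src_tgt Γ e).symm⟩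

theorem height_base : Γ.height Γ.base = 0 := SimpleGraph.edist_self

theorem height_le_succ_of_adj (h : Γ.adjGraph.Adj u v) : Γ.height v ≤ Γ.height u + 1 :=
  SimpleGraph.edist_eq_one_iff_adj.2 h ▸ Γ.adjGraph.edist_triangle

theorem exists_adj_of_height {n : ℕ} (h : Γ.height v = (n + 1 : ℕ)) :
    ∃ u, Γ.adjGraph.Adj u v ∧ Γ.height u = n := by
  obtain ⟨w, hw⟩ := SimpleGraph.exists_walk_of_edist_eq_coe (SimpleGraph.edist_comm.trans h)
  cases w with
  | nil => simp at hw
  | @cons _ u _ hvu w =>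
    refine ⟨u, hvu.symm, le_antisymm ?_ ?_⟩
    · calc Γ.height u = Γ.adjGraph.edist u Γ.base := SimpleGraph.edist_comm
        _ ≤ w.length := SimpleGraph.edist_le w
        _ = n := by rw [Nat.succ_injective hw]
    · have h_le := height_le_succ_of_adj hvu.symm
      rw [h, Nat.cast_succ] at h_le
      exact (ENat.add_le_add_iff_right ENat.one_ne_top).1 h_le

theorem exists_height_eq (hc : Γ.adjGraph.Preconnected) (v : Γ.V) : ∃ n : ℕ, Γ.height v = n :=
  ⟨_, (hc Γ.base v).coe_dist_eq_edist.symm⟩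

theorem LocallyFinite.finite_height_le (h : Γ.LocallyFinite) (r : ℕ) :
    {v | Γ.height v ≤ r}.Finite := by
  induction r with
  | zero =>
    refine (Set.finite_singleton Γ.base).subset fun v (hv : Γ.height v ≤ (0 : ℕ)) => ?_
    exact (SimpleGraph.edist_eq_zero_iff.1 (nonpos_iff_eq_zero.1 hv)).symm
  | succ r ih =>
    refine (ih.union (ih.biUnion fun u _ => h.finite_adj u)).subset fun v hv => ?_
    by_cases hr : Γ.height v ≤ r
    · exact .inl hr
    · obtain ⟨u, hadj, hu⟩ := exists_adj_of_height
        (le_antisymm hv (Nat.cast_succ (R := ℕ∞) r ▸ Order.add_one_le_of_lt (not_le.1 hr)))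
      exact .inr (Set.mem_biUnion (x := u) hu.le hadj)

theorem LocallyFinite.countable (h : Γ.LocallyFinite) (hc : Γ.adjGraph.Preconnected) :
    Countable Γ.V := by
  have : (Set.univ : Set Γ.V) = ⋃ r : ℕ, {v | Γ.height v ≤ r} :=
    (Set.eq_univ_of_forall fun v => Set.mem_iUnion.2
      ((exists_height_eq hc v).imp fun _ hn => hn.le)).symm
  rw [← Set.countable_univ_iff, this]
  exact Set.countable_iUnion fun r => (h.finite_height_le r).countable

theorem exists_height_le (hc : Γ.adjGraph.Preconnected) {D : Set Γ.V} (hD : D.Finite) :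
    ∃ r : ℕ, ∀ v ∈ D, Γ.height v ≤ r := by
  choose f hf using exists_height_eq hc
  obtain ⟨r, hr⟩ := (hD.image f).bddAbove
  exact ⟨r, fun v hv => (hf v).trans_le (Nat.cast_le.2 (hr ⟨v, hv, rfl⟩))⟩

theorem exists_reachable_sphere (hc : Γ.adjGraph.Preconnected) {r R : ℕ} (hrR : r < R) (v : Γ.V)
    (hv : R ≤ Γ.height v) :
    ∃ w, Γ.height w = R ∧ (inducedOn Γ.adjGraph {x | r < Γ.height x}).Reachable v w := by
  obtain ⟨n, hn⟩ := exists_height_eq hc v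
  rw [hn, Nat.cast_le] at hv
  induction n, hv using Nat.le_induction generalizing v with
  | base => exact ⟨v, hn, .rfl⟩
  | succ n hRn ih =>
    obtain ⟨u, hadj, hu⟩ := exists_adj_of_height hn
    obtain ⟨w, hw, huw⟩ := ih u hu
    refine ⟨w, hw, (inducedOn_reachable_of_adj ?_ ?_ hadj.symm).trans huw⟩
    · exact (Nat.cast_lt.2 (by omega)).trans_eq hn.symm
    · exact (Nat.cast_lt.2 (by omega)).trans_eq hu.symm

theorem joinedIn_of_reachable {F : Set (OneComplex Γ.src Γ.tgt)} {A : Set Γ.V}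
    (h : (inducedOn Γ.adjGraph A).Reachable u v) (hu : OneComplex.vtx _ _ u ∈ F)
    (hF : ∀ e, Γ.src e ∈ A → Γ.tgt e ∈ A → ∀ r, OneComplex.edge _ _ e r ∈ F) :
    JoinedIn F (OneComplex.vtx _ _ u) (OneComplex.vtx _ _ v) := by
  obtain ⟨w⟩ := h
  induction w with
  | nil => exact .refl hu
  | @cons u y _ h _ ih =>
    obtain ⟨hu, hy, hadj⟩ := inducedOn_adj.1 h
    have joined : JoinedIn F (OneComplex.vtx _ _ u) (OneComplex.vtx _ _ y) := by
      obtain ⟨e, ⟨rfl, rfl⟩ | ⟨rfl, rfl⟩⟩ := exists_edge_of_adj hadj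
      · exact OneComplex.joinedIn_tgt (hF e hu hy)
      · exact (OneComplex.joinedIn_tgt (hF e hy hu)).symm
    exact joined.trans (ih joined.target_mem)

theorem reachable_of_isPreconnected {D : Set Γ.V} {F : Set (OneComplex Γ.src Γ.tgt)}
    (hF : IsPreconnected F) (hFD : Disjoint F (OneComplex.vtx _ _ '' D))
    (hu : OneComplex.vtx _ _ u ∈ F) (hv : OneComplex.vtx _ _ v ∈ F) :
    (inducedOn Γ.adjGraph Dᶜ).Reachable u v := by
  have huD : u ∈ Dᶜ := fun h => Set.disjoint_left.1 hFD hu ⟨u, h, rfl⟩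
  refine OneComplex.mem_of_isPreconnected (S := {w | (inducedOn Γ.adjGraph Dᶜ).Reachable u w})
    (fun e hs => ?_) (fun e ht => ?_) hF hFD hu hv .rfl
  · refine or_iff_not_imp_right.2 fun htD => hs.trans ?_
    exact reachable_src_tgt (mem_of_inducedOn_reachable hs huD) htD
  · refine or_iff_not_imp_right.2 fun hsD => ht.trans ?_
    exact (reachable_src_tgt hsD (mem_of_inducedOn_reachable ht huD)).symm

theorem preconnected_of_connectedSpace [ConnectedSpace Γ.Realization] :
    Γ.adjGraph.Preconnected := fun u v => by
  have : ConnectedSpace (OneComplex Γ.src Γ.tgt) :=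
    Γ.complexHomeo.symm.surjective.connectedSpace Γ.complexHomeo.symm.continuous
  refine (reachable_of_isPreconnected (D := ∅) isPreconnected_univ (by simp)
    trivial trivial).mono ?_
  exact SimpleGraph.spanningCoe_induce_le _ _

theorem pathConnectedSpace_realization (h : Γ.adjGraph.Preconnected) :
    PathConnectedSpace Γ.Realization := by
  have : PathConnectedSpace (OneComplex Γ.src Γ.tgt) :=
    OneComplex.pathConnectedSpace_of_joined_vtx fun v => joinedIn_univ.1 <|
      joinedIn_of_reachable ((h Γ.base v).mono Γ.adjGraph.spanningCoe_induce_univ.ge) trivial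
        fun _ _ _ _ => trivial
  exact Γ.complexHomeo.surjective.pathConnectedSpace Γ.complexHomeo.continuous

theorem exists_finite_forall_joinedIn (hlf : Γ.LocallyFinite) (hc : Γ.adjGraph.Preconnected)
    {K : Set (OneComplex Γ.src Γ.tgt)} (hK : IsCompact K) :
    ∃ W : Set Γ.V, W.Finite ∧ ∀ᶠ v in Filter.cofinite,
      ∃ w ∈ W, JoinedIn Kᶜ (OneComplex.vtx _ _ v) (OneComplex.vtx _ _ w) := by
  obtain ⟨r, hr⟩ := exists_height_le hc ((OneComplex.finite_vertices hK).union
    ((OneComplex.finite_edges hlf.oneComplex hK).image Γ.src))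
  refine ⟨{w | Γ.height w ≤ (r + 1 : ℕ)}, hlf.finite_height_le _,
    (hlf.finite_height_le r).subset fun v hv =>
      show Γ.height v ≤ r from not_lt.1 fun hrv => hv ?_⟩
  obtain ⟨w, hw, hvw⟩ := exists_reachable_sphere hc r.lt_succ_self v
    (Nat.cast_succ (R := ℕ∞) r ▸ Order.add_one_le_of_lt hrv)
  refine ⟨w, hw.le, joinedIn_of_reachable hvw (fun hvK => hrv.not_ge (hr v (.inl hvK))) ?_⟩
  exact fun e he _ ρ hρ => (not_le.2 he) (hr _ (.inr ⟨e, ⟨ρ, hρ⟩, rfl⟩))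

theorem exists_end_of_ultrafilter (hlf : Γ.LocallyFinite) (hc : Γ.adjGraph.Preconnected)
    (𝒰 : Ultrafilter Γ.V) (h𝒰 : (𝒰 : Filter Γ.V) ≤ Filter.cofinite) :
    ∃ ε : EndSpace (OneComplex Γ.src Γ.tgt), ∀ K hK,
      {v | ∃ h : OneComplex.vtx _ _ v ∈ Kᶜ, ZerothHomotopy.mk ⟨_, h⟩ = ε.comp K hK} ∈ 𝒰 := by
  have exists_component (K : Set (OneComplex Γ.src Γ.tgt)) (hK : IsCompact K) :
      ∃ z : ZerothHomotopy ↥Kᶜ,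
        {v | ∃ h : OneComplex.vtx _ _ v ∈ Kᶜ, ZerothHomotopy.mk ⟨_, h⟩ = z} ∈ 𝒰 := by
    obtain ⟨W, hW, joined⟩ := exists_finite_forall_joinedIn hlf hc hK
    obtain ⟨w, -, hw⟩ := (Ultrafilter.finite_biUnion_mem_iff (s := fun w =>
      {v | JoinedIn Kᶜ (OneComplex.vtx Γ.src Γ.tgt v) (OneComplex.vtx _ _ w)}) hW).1 <|
      Filter.mem_of_superset (h𝒰 joined) fun v ⟨w, hw, hvw⟩ => Set.mem_biUnion hw hvw
    obtain ⟨v₀, hv₀⟩ := Ultrafilter.nonempty_of_mem hw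
    exact ⟨.mk ⟨_, hv₀.target_mem⟩, Filter.mem_of_superset hw fun v hv =>
      ⟨hv.source_mem, ZerothHomotopy.sound hv.joined_subtype.somePath⟩⟩
  choose z hz using exists_component
  refine ⟨.mk z fun K L hK hL hKL => ?_, hz⟩
  obtain ⟨v, ⟨_, hvK⟩, ⟨_, hvL⟩⟩ := Ultrafilter.nonempty_of_mem
    (Filter.inter_mem (hz K hK) (hz L hL))
  rw [← hvK, ← hvL]
  rfl

theorem oneEndedGraph_of_oneEnded (hlf : Γ.LocallyFinite) (hc : Γ.adjGraph.Preconnected)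
    (h : OneEnded Γ.Realization) : OneEndedGraph Γ.adjGraph := by
  intro D hD
  obtain ⟨uniq⟩ := h.of_properHomotopyEquivalent (.of_homeomorph Γ.complexHomeo.symm)
  set ε := uniq.default
  have hK : IsCompact (OneComplex.vtx Γ.src Γ.tgt '' D) := (hD.image _).isCompact
  let A : Set Γ.V := {v | ∃ h : OneComplex.vtx Γ.src Γ.tgt v ∈ (OneComplex.vtx _ _ '' D)ᶜ,
    ZerothHomotopy.mk ⟨_, h⟩ = ε.comp _ hK}
  have vtx_mem {v} : OneComplex.vtx Γ.src Γ.tgt v ∈ (OneComplex.vtx _ _ '' D)ᶜ ↔ v ∈ Dᶜ :=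
    not_congr OneComplex.vtx_injective.mem_set_image
  have edge_mem (e) (hs : Γ.src e ∈ Dᶜ) (ht : Γ.tgt e ∈ Dᶜ) (r) :
      OneComplex.edge Γ.src Γ.tgt e r ∈ (OneComplex.vtx _ _ '' D)ᶜ := by
    rintro ⟨v, hv, hr⟩
    rcases OneComplex.edge_eq_vtx hr.symm with ⟨-, rfl⟩ | ⟨-, rfl⟩
    exacts [hs hv, ht hv]
  have reachable {v w} (hv : v ∈ A) (hw : w ∈ A) : (inducedOn Γ.adjGraph Dᶜ).Reachable v w := by
    obtain ⟨⟨hv, hv'⟩, ⟨hw, hw'⟩⟩ := hv, hw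
    obtain ⟨γ, hγ⟩ := (joinedIn_iff_joined hv hw).2 (Quotient.exact (hv'.trans hw'.symm))
    exact reachable_of_isPreconnected (isPreconnected_range γ.continuous)
      (Set.disjoint_left.2 fun x ⟨τ, hτ⟩ => hτ ▸ hγ τ) ⟨0, γ.source⟩ ⟨1, γ.target⟩
  have mem_of_reachable {v w} (hv : v ∈ A) (h : (inducedOn Γ.adjGraph Dᶜ).Reachable v w) :
      w ∈ A := by
    obtain ⟨hv, hv'⟩ := hv
    have joined := joinedIn_of_reachable h hv edge_mem
    exact ⟨joined.target_mem,
      (ZerothHomotopy.sound joined.symm.joined_subtype.somePath).trans hv'⟩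
  refine ⟨A, Filter.mem_cofinite.1 <| Filter.mem_iff_ultrafilter.2 fun 𝒰 h𝒰 => ?_,
    Set.disjoint_left.2 fun v hv => vtx_mem.1 hv.1, fun v hv w hw =>
    (inducedOn_component_reachable (reachable hv hw)).mono
      (inducedOn_mono fun _ => mem_of_reachable hv)⟩
  obtain ⟨ε', hε'⟩ := exists_end_of_ultrafilter hlf hc 𝒰 h𝒰
  rw [uniq.uniq ε'] at hε'
  exact hε' _ hK

end PointedGraph

/-! ### Graphs with a one-ended spanning tree -/

namespace PointedGraph

variable {Γ : PointedGraph}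

/-- Some finite subgraph has at least `n` more edges than vertices.  A connected graph has infinite
rank if and only if this holds for every `n`. -/
def HasExcess (Γ : PointedGraph) (n : ℕ) : Prop :=
  ∃ (S : Finset Γ.V) (F : Finset Γ.E), (∀ e ∈ F, ∀ v ∈ Γ.ends e, v ∈ S) ∧ S.card + n ≤ F.card

/-- A one-ended spanning tree, directed towards its end: every vertex has a parent and an edge to
it, only finitely many descendants, and an ancestor in common with every other vertex. -/
structure EndTree (Γ : PointedGraph) where
  /-- the parent of a vertex -/
  parent : Γ.V → Γ.V
  /-- the edge from a vertex to its parent -/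
  edge : Γ.V → Γ.E
  ends_edge : ∀ v, Γ.ends (edge v) = s(v, parent v)
  finitePredecessors : OneComplex.FinitePredecessors parent
  merging : OneComplex.Merging parent

theorem exists_endTree [Infinite Γ.V] (hlf : Γ.LocallyFinite) (hc : Γ.adjGraph.Preconnected)
    (h : OneEndedGraph Γ.adjGraph) : Nonempty (EndTree Γ) := by
  have := hlf.countable hc
  obtain ⟨p, hadj, hp, hm⟩ := h.exists_tree hc
  choose τ hτ using fun v => (hadj v).2
  exact ⟨p, τ, hτ, hp, hm⟩

instance : T2Space Γ.Realization := Γ.complexHomeo.t2Space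

namespace EndTree

variable (T : EndTree Γ)

/-- The edges outside of the tree. -/
abbrev chords : Set Γ.E := (Set.range T.edge)ᶜ

theorem edge_injective [Infinite Γ.V] : Function.Injective T.edge := by
  intro u v huv
  have h := T.ends_edge u
  rw [huv, T.ends_edge v, Sym2.eq_iff] at h
  rcases h with ⟨h, -⟩ | ⟨hvu, huv⟩
  · exact h.symm
  · have h_period : T.parent^[0] v = T.parent^[2] v := by
      change v = T.parent (T.parent v)
      rw [huv, ← hvu]
    have := T.merging.injective_iterate T.finitePredecessors v h_period
    omega

/-- The realization as a complex in which the edges of the tree and the chords are separated. -/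
noncomputable def complexHomeo [Infinite Γ.V] {E₁ : Type*} (ν : E₁ ≃ T.chords) :
    OneComplex (Sum.elim id fun i => Γ.src (ν i)) (Sum.elim T.parent fun i => Γ.tgt (ν i)) ≃ₜ
      Γ.Realization := by
  classical
  refine Γ.realizationHomeo _ _ (((Equiv.ofInjective T.edge T.edge_injective).sumCongr ν).trans
    (Equiv.Set.sumCompl (Set.range T.edge))) ?_
  rintro (v | i)
  · exact (T.ends_edge v).symm
  · exact mk_src_tgt Γ _

theorem exists_properHomotopyEquivalent_loopedRay [Infinite Γ.V] (hlf : Γ.LocallyFinite)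
    {E₁ : Type*} (ν : E₁ ≃ T.chords) (f : E₁ → ℕ) :
    ∃ n : E₁ → ℕ, (∀ i, f i ≤ n i) ∧ ((∀ k, {i | n i = k}.Finite) →
      ProperHomotopyEquivalent Γ.Realization (OneComplex.LoopedRay n)) := by
  have hν : Function.Injective fun i => (ν i : Γ.E) := Subtype.val_injective.comp ν.injective
  obtain ⟨n, hn, h⟩ := OneComplex.exists_properHomotopyEquivalent_loopedRay
    T.finitePredecessors T.merging (a := fun i => Γ.src (ν i)) (b := fun i => Γ.tgt (ν i))
    (fun v => (hlf.oneComplex v).1.preimage hν.injOn)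
    (fun v => (hlf.oneComplex v).2.preimage hν.injOn) f
  exact ⟨n, hn, fun hfin => (ProperHomotopyEquivalent.of_homeomorph
    (T.complexHomeo ν).symm).trans (h hfin)⟩

theorem properHomotopyEquivalent_lochNessMonster [Infinite Γ.V] (hlf : Γ.LocallyFinite)
    (hc : Γ.adjGraph.Preconnected) (hinf : T.chords.Infinite) :
    ProperHomotopyEquivalent Γ.Realization lochNessMonster.Realization := by
  have := hlf.countable hc
  have : Countable Γ.E := by
    refine Set.countable_univ_iff.1 <|
      (Set.countable_iUnion fun v => (hlf.finite_incident v).countable).mono fun e _ => ?_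
    exact Set.mem_iUnion.2 ⟨Γ.src e, src_mem e⟩
  have : Infinite T.chords := hinf.to_subtype
  obtain ⟨_⟩ := nonempty_denumerable T.chords
  obtain ⟨n, hn, h⟩ :=
    T.exists_properHomotopyEquivalent_loopedRay hlf (Denumerable.eqv T.chords).symm id
  have finite_fiber (k : ℕ) : {i | n i = k}.Finite :=
    (Set.finite_Iic k).subset fun i hi => (hn i).trans hi.le
  exact ((h finite_fiber).trans (OneComplex.properHomotopyEquivalent_loopedRay_id n hn).symm).trans
    (.of_homeomorph OneComplex.lochNessHomeo)

theorem rank_ne_top [Infinite Γ.V] (hlf : Γ.LocallyFinite) (hfin : T.chords.Finite) :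
    Γ.rank ≠ ⊤ := by
  have : Finite T.chords := hfin
  obtain ⟨n, -, h⟩ := T.exists_properHomotopyEquivalent_loopedRay hlf (Equiv.refl _) fun _ => 0
  obtain ⟨e⟩ := (h fun k => Set.toFinite _).nonempty_homotopyEquiv
  rw [rank, groupRank_fundamentalGroup_congr e _ (OneComplex.vtx _ _ 0)]
  exact OneComplex.groupRank_loopedRay_ne_top n

theorem exists_common_ancestor (W : Finset Γ.V) : ∃ x, ∀ w ∈ W, ∃ j, T.parent^[j] w = x := by
  classical
  induction W using Finset.induction_on with
  | empty => exact ⟨Γ.base, by simp⟩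
  | insert a W _ ih =>
    obtain ⟨x, hx⟩ := ih
    obtain ⟨m, n, hmn⟩ := T.merging a x
    refine ⟨T.parent^[n] x, fun w hw => ?_⟩
    rcases Finset.mem_insert.1 hw with rfl | hw
    · exact ⟨m, hmn⟩
    · obtain ⟨j, hj⟩ := hx w hw
      exact ⟨n + j, by rw [Function.iterate_add_apply, hj]⟩

/-- The descendants of `x`, including `x` itself. -/
noncomputable def descendants (x : Γ.V) : Finset Γ.V := (T.finitePredecessors x).toFinset

theorem mem_descendants {x v : Γ.V} : v ∈ T.descendants x ↔ ∃ j, T.parent^[j] v = x :=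
  Set.Finite.mem_toFinset _

theorem self_mem_descendants (x : Γ.V) : x ∈ T.descendants x := T.mem_descendants.2 ⟨0, rfl⟩

theorem parent_mem_descendants {x v : Γ.V} (hv : v ∈ T.descendants x) (hvx : v ≠ x) :
    T.parent v ∈ T.descendants x := by
  obtain ⟨j, hj⟩ := T.mem_descendants.1 hv
  cases j with
  | zero => exact absurd hj hvx
  | succ j => exact T.mem_descendants.2 ⟨j, hj⟩

/-- The descendants of a common ancestor `x` of the ends of `n + 1` chords span these chords and one
tree edge for every vertex other than `x`. -/
theorem hasExcess [Infinite Γ.V] (hinf : T.chords.Infinite) (n : ℕ) : Γ.HasExcess n := by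
  classical
  obtain ⟨F, hF, hcard⟩ := hinf.exists_subset_card_eq (n + 1)
  obtain ⟨x, hx⟩ := T.exists_common_ancestor (F.image Γ.src ∪ F.image Γ.tgt)
  have hdisj : Disjoint F (((T.descendants x).erase x).image T.edge) :=
    Finset.disjoint_left.2 fun e he he' => hF he <| by
      obtain ⟨u, -, rfl⟩ := Finset.mem_image.1 he'
      exact ⟨u, rfl⟩
  refine ⟨T.descendants x, F ∪ ((T.descendants x).erase x).image T.edge, fun e he v hv => ?_, ?_⟩
  · rcases Finset.mem_union.1 he with he | he
    · refine T.mem_descendants.2 (hx v (Finset.mem_union.2 ?_))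
      rcases mem_ends.1 hv with rfl | rfl
      exacts [.inl (Finset.mem_image_of_mem _ he), .inr (Finset.mem_image_of_mem _ he)]
    · obtain ⟨u, hu, rfl⟩ := Finset.mem_image.1 he
      obtain ⟨hux, hu⟩ := Finset.mem_erase.1 hu
      rw [T.ends_edge, Sym2.mem_iff] at hv
      rcases hv with rfl | rfl
      exacts [hu, T.parent_mem_descendants hu hux]
  · have := Finset.card_pos.2 ⟨x, T.self_mem_descendants x⟩
    rw [Finset.card_union_of_disjoint hdisj, Finset.card_image_of_injective _ T.edge_injective,
      hcard, Finset.card_erase_of_mem (T.self_mem_descendants x)]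
    omega

theorem infinite_chords (h : ∀ n, Γ.HasExcess n) : T.chords.Infinite := by
  classical
  intro hfin
  obtain ⟨S, F, hF, hcard⟩ := h (hfin.toFinset.card + 1)
  have hsub : F ⊆ S.image T.edge ∪ hfin.toFinset := fun e he => by
    by_cases h : e ∈ Set.range T.edge
    · obtain ⟨v, rfl⟩ := h
      have hv : v ∈ S := hF _ he v (by rw [T.ends_edge]; exact Sym2.mem_mk_left _ _)
      exact Finset.mem_union_left _ (Finset.mem_image_of_mem _ hv)
    · exact Finset.mem_union_right _ (hfin.mem_toFinset.2 h)
  have : F.card ≤ S.card + hfin.toFinset.card := calc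
    F.card ≤ (S.image T.edge).card + hfin.toFinset.card :=
      (Finset.card_le_card hsub).trans (Finset.card_union_le _ _)
    _ ≤ S.card + hfin.toFinset.card := by gcongr; exact Finset.card_image_le
  omega

end EndTree

theorem oneEnded_lochNessMonster : OneEnded lochNessMonster.Realization :=
  (OneComplex.oneEnded_loopedRay fun k => Set.finite_singleton k).of_properHomotopyEquivalent
    (.of_homeomorph OneComplex.lochNessHomeo)

theorem rank_eq_top_of_properHomotopyEquivalent
    (h : ProperHomotopyEquivalent Γ.Realization lochNessMonster.Realization) : Γ.rank = ⊤ := by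
  obtain ⟨e⟩ := (h.trans (.of_homeomorph OneComplex.lochNessHomeo.symm)).nonempty_homotopyEquiv
  rw [rank, groupRank_fundamentalGroup_congr e _ (OneComplex.vtx _ _ 0)]
  exact OneComplex.groupRank_loopedRay _

theorem oneEnded_and_rank_eq_top_of_properHomotopyEquivalent
    (h : ProperHomotopyEquivalent Γ.Realization lochNessMonster.Realization) :
    OneEnded Γ.Realization ∧ Γ.rank = ⊤ :=
  ⟨oneEnded_lochNessMonster.of_properHomotopyEquivalent h.symm,
    rank_eq_top_of_properHomotopyEquivalent h⟩

theorem oneEndedGraph_and_hasExcess [Infinite Γ.V] (hlf : Γ.LocallyFinite)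
    (hc : Γ.adjGraph.Preconnected) (h : OneEnded Γ.Realization) (hr : Γ.rank = ⊤) :
    OneEndedGraph Γ.adjGraph ∧ ∀ n, Γ.HasExcess n := by
  have hG := oneEndedGraph_of_oneEnded hlf hc h
  obtain ⟨T⟩ := exists_endTree hlf hc hG
  exact ⟨hG, T.hasExcess fun hfin => T.rank_ne_top hlf hfin hr⟩

theorem properHomotopyEquivalent_lochNessMonster [Infinite Γ.V] (hlf : Γ.LocallyFinite)
    (hc : Γ.adjGraph.Preconnected) (h : OneEndedGraph Γ.adjGraph) (he : ∀ n, Γ.HasExcess n) :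
    ProperHomotopyEquivalent Γ.Realization lochNessMonster.Realization := by
  obtain ⟨T⟩ := exists_endTree hlf hc h
  exact T.properHomotopyEquivalent_lochNessMonster hlf hc (T.infinite_chords he)

theorem oneEnded_and_rank_eq_top_iff [Infinite Γ.V] (hlf : Γ.LocallyFinite)
    (hc : Γ.adjGraph.Preconnected) : OneEnded Γ.Realization ∧ Γ.rank = ⊤ ↔
      OneEndedGraph Γ.adjGraph ∧ ∀ n, Γ.HasExcess n :=
  ⟨fun h => oneEndedGraph_and_hasExcess hlf hc h.1 h.2, fun h =>
    oneEnded_and_rank_eq_top_of_properHomotopyEquivalent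
      (properHomotopyEquivalent_lochNessMonster hlf hc h.1 h.2)⟩

theorem properHomotopyEquivalent_lochNessMonster_iff [Infinite Γ.V] (hlf : Γ.LocallyFinite)
    (hc : Γ.adjGraph.Preconnected) :
    ProperHomotopyEquivalent Γ.Realization lochNessMonster.Realization ↔
      OneEnded Γ.Realization ∧ Γ.rank = ⊤ :=
  ⟨oneEnded_and_rank_eq_top_of_properHomotopyEquivalent, fun h =>
    have ⟨hG, he⟩ := oneEndedGraph_and_hasExcess hlf hc h.1 h.2
    properHomotopyEquivalent_lochNessMonster hlf hc hG he⟩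

end PointedGraph

/-! ### Balls and local properties -/

namespace PointedGraph

variable {Γ Δ Θ : PointedGraph} {r s : ℕ}

theorem height_map_le (α : Γ.V → Δ.V) (hb : α Γ.base = Δ.base) {v : Γ.V}
    (h : ∀ u w, Γ.height u < Γ.height v → Γ.adjGraph.Adj u w → Δ.adjGraph.Adj (α u) (α w)) :
    Δ.height (α v) ≤ Γ.height v := by
  by_cases hv : Γ.height v = ⊤
  · exact hv ▸ le_top
  obtain ⟨n, hn⟩ := ENat.ne_top_iff_exists.1 hv
  induction n generalizing v with
  | zero =>
    obtain rfl : Γ.base = v := SimpleGraph.edist_eq_zero_iff.1 hn.symm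
    rw [hb, height_base]
    exact zero_le
  | succ n ih =>
    obtain ⟨u, huv, hu⟩ := exists_adj_of_height hn.symm
    have huv_lt : Γ.height u < Γ.height v := by
      rw [hu, ← hn]
      exact Nat.cast_lt.2 n.lt_succ_self
    calc Δ.height (α v) ≤ Δ.height (α u) + 1 := height_le_succ_of_adj (h u v huv_lt huv)
      _ ≤ Γ.height u + 1 := by
        gcongr
        exact ih (fun x w hx => h x w (hx.trans huv_lt)) (hu ▸ ENat.natCast_ne_top n) hu.symm
      _ = Γ.height v := by rw [hu, ← hn, Nat.cast_succ]

/-- The inclusion of the vertices of a ball. -/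
def ofBall (v : (Γ.ball r).V) : Γ.V := Subtype.val v

/-- The inclusion of the edges of a ball. -/
def ofBallEdge (e : (Γ.ball r).E) : Γ.E := Subtype.val e

/-- A vertex of small height, as a vertex of a ball. -/
def toBall (v : Γ.V) (h : Γ.height v ≤ r) : (Γ.ball r).V := ⟨v, h⟩

/-- An edge with an end of small height, as an edge of a ball. -/
def toBallEdge (e : Γ.E) (h : ∃ v ∈ Γ.ends e, Γ.height v < r) : (Γ.ball r).E := ⟨e, h⟩

theorem height_ofBall_le (v : (Γ.ball r).V) : Γ.height (ofBall v) ≤ r := Subtype.prop v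

theorem exists_height_lt_ofBallEdge (e : (Γ.ball r).E) :
    ∃ v ∈ Γ.ends (ofBallEdge e), Γ.height v < r :=
  Subtype.prop e

theorem ofBall_injective : Function.Injective (ofBall : (Γ.ball r).V → Γ.V) :=
  Subtype.val_injective

theorem ofBallEdge_injective : Function.Injective (ofBallEdge : (Γ.ball r).E → Γ.E) :=
  Subtype.val_injective

theorem map_ofBall_ends (e : (Γ.ball r).E) :
    ((Γ.ball r).ends e).map ofBall = Γ.ends (ofBallEdge e) :=
  Sym2.attachWith_map_subtypeVal _

theorem mem_ends_ball {e : (Γ.ball r).E} {v : (Γ.ball r).V} :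
    v ∈ (Γ.ball r).ends e ↔ ofBall v ∈ Γ.ends (ofBallEdge e) := by
  rw [← map_ofBall_ends, Sym2.mem_map]
  exact ⟨fun h => ⟨v, h, rfl⟩, fun ⟨w, hw, h⟩ => ofBall_injective h ▸ hw⟩

theorem adj_ofBall {u v : (Γ.ball r).V} (h : (Γ.ball r).adjGraph.Adj u v) :
    Γ.adjGraph.Adj (ofBall u) (ofBall v) := by
  obtain ⟨hne, e, he⟩ := h
  exact ⟨fun h => hne (ofBall_injective h), ofBallEdge e, by rw [← map_ofBall_ends, he]; rfl⟩

theorem adj_toBall {u v : Γ.V} (h : Γ.adjGraph.Adj u v) (hr : Γ.height u < r)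
    (hv : Γ.height v ≤ r) : (Γ.ball r).adjGraph.Adj (toBall u hr.le) (toBall v hv) := by
  obtain ⟨hne, e, he⟩ := h
  refine ⟨fun h => hne (congrArg ofBall h), toBallEdge e ⟨u, by rw [he]; simp, hr⟩, ?_⟩
  exact Sym2.map.injective ofBall_injective ((map_ofBall_ends _).trans he)

theorem height_ball (v : (Γ.ball r).V) : (Γ.ball r).height v = Γ.height (ofBall v) := by
  classical
  refine le_antisymm ?_ (height_map_le ofBall rfl fun u w _ => adj_ofBall)
  let α (v : Γ.V) : (Γ.ball r).V :=
    if h : Γ.height v ≤ r then toBall v h else (Γ.ball r).base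
  have hα (v) (h : Γ.height v ≤ r) : α v = toBall v h := dif_pos h
  have h_le := height_map_le (Δ := Γ.ball r) (v := ofBall v) α
    (hα _ (height_base.trans_le (zero_le))) fun u w hu huw => by
      have hur := hu.trans_le (height_ofBall_le v)
      have hw := (height_le_succ_of_adj huw).trans (Order.add_one_le_of_lt hur)
      rw [hα u hur.le, hα w hw]
      exact adj_toBall huw hur hw
  rwa [hα _ (height_ofBall_le v)] at h_le

namespace Iso

theorem adj (f : Iso Γ Δ) {u v : Γ.V} (h : Γ.adjGraph.Adj u v) :
    Δ.adjGraph.Adj (f.onV u) (f.onV v) := by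
  obtain ⟨hne, e, he⟩ := h
  exact ⟨fun h => hne (f.onV.injective h), f.onE e, by rw [f.ends_onE, he]; rfl⟩

theorem height_eq (f : Iso Γ Δ) (v : Γ.V) : Δ.height (f.onV v) = Γ.height v := by
  refine le_antisymm (height_map_le f.onV f.onV_base fun u w _ => f.adj) ?_
  have := height_map_le f.symm.onV f.symm.onV_base (v := f.onV v) fun u w _ => f.symm.adj
  rwa [show f.symm.onV (f.onV v) = v from f.onV.symm_apply_apply v] at this

theorem exists_height_lt_iff (f : Iso Γ Δ) (r : ℕ) (e : Γ.E) :
    (∃ v ∈ Δ.ends (f.onE e), Δ.height v < r) ↔ ∃ v ∈ Γ.ends e, Γ.height v < r := by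
  simp only [f.ends_onE, Sym2.mem_map, exists_exists_and_eq_and, f.height_eq]

/-- The isomorphism of balls induced by an isomorphism. -/
def ball (f : Iso Γ Δ) (r : ℕ) : Iso (Γ.ball r) (Δ.ball r) where
  onV := f.onV.subtypeEquiv fun v => by rw [f.height_eq]
  onE := f.onE.subtypeEquiv fun e => (f.exists_height_lt_iff r e).symm
  ends_onE e := by
    refine Sym2.map.injective ofBall_injective ?_
    rw [map_ofBall_ends, Sym2.map_map]
    change Δ.ends (f.onE (ofBallEdge e)) = Sym2.map (f.onV ∘ ofBall) _
    rw [f.ends_onE, ← map_ofBall_ends, Sym2.map_map]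
  onV_base := ofBall_injective f.onV_base

theorem height_ofBall (f : Iso (Γ.ball r) (Δ.ball r)) (v : (Γ.ball r).V) :
    Δ.height (ofBall (f.onV v)) = Γ.height (ofBall v) := by
  rw [← height_ball, f.height_eq, height_ball]

end Iso

theorem exists_height_lt_ball_iff (e : (Γ.ball s).E) :
    (∃ v ∈ (Γ.ball s).ends e, (Γ.ball s).height v < r) ↔
      ∃ v ∈ Γ.ends (ofBallEdge e), Γ.height v < r := by
  simp only [← map_ofBall_ends, Sym2.mem_map, exists_exists_and_eq_and, height_ball]

/-- A ball of a larger ball is a ball. -/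
noncomputable def ballBall (Γ : PointedGraph) (h : r ≤ s) :
    Iso ((Γ.ball s).ball r) (Γ.ball r) where
  onV :=
    { toFun v := toBall (ofBall (ofBall v)) (by rw [← height_ball]; exact height_ofBall_le v)
      invFun v := toBall (toBall (ofBall v) ((height_ofBall_le v).trans (Nat.cast_le.2 h)))
        (by rw [height_ball]; exact height_ofBall_le v)
      left_inv _ := rfl
      right_inv _ := rfl }
  onE :=
    { toFun e := toBallEdge (ofBallEdge (ofBallEdge e))
        ((exists_height_lt_ball_iff _).1 (exists_height_lt_ofBallEdge e))
      invFun e := toBallEdge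
        (toBallEdge (ofBallEdge e) ((exists_height_lt_ofBallEdge e).imp fun _ hv =>
          ⟨hv.1, hv.2.trans_le (Nat.cast_le.2 h)⟩))
        ((exists_height_lt_ball_iff _).2 (exists_height_lt_ofBallEdge e))
      left_inv _ := rfl
      right_inv _ := rfl }
  ends_onE e := by
    refine Sym2.map.injective ofBall_injective ?_
    rw [map_ofBall_ends, Sym2.map_map]
    change Γ.ends (ofBallEdge (ofBallEdge e)) = Sym2.map (ofBall ∘ ofBall) _
    rw [← Sym2.map_map, map_ofBall_ends, map_ofBall_ends]
  onV_base := rfl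

theorem BallIso.refl (r : ℕ) (Γ : PointedGraph) : BallIso r Γ Γ := ⟨.refl _⟩

theorem BallIso.trans : BallIso r Γ Δ → BallIso r Δ Θ → BallIso r Γ Θ :=
  fun ⟨f⟩ ⟨g⟩ => ⟨f.trans g⟩

theorem BallIso.mono (h : r ≤ s) : BallIso s Γ Δ → BallIso r Γ Δ :=
  fun ⟨f⟩ => ⟨((Γ.ballBall h).symm.trans (f.ball r)).trans (Δ.ballBall h)⟩

/-- A property of pointed graphs is local if, whenever a graph has it, so do all graphs with the
same ball of a suitable radius.  Such properties define open sets of graphs. -/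
def IsLocal (P : PointedGraph → Prop) : Prop :=
  ∀ Γ, P Γ → ∃ s, ∀ Δ, BallIso s Γ Δ → P Δ

theorem IsLocal.and {P Q : PointedGraph → Prop} (hP : IsLocal P) (hQ : IsLocal Q) :
    IsLocal fun Γ => P Γ ∧ Q Γ := by
  rintro Γ ⟨hΓP, hΓQ⟩
  obtain ⟨s, hs⟩ := hP Γ hΓP
  obtain ⟨t, ht⟩ := hQ Γ hΓQ
  exact ⟨max s t, fun Δ h => ⟨hs Δ (h.mono (le_max_left _ _)), ht Δ (h.mono (le_max_right _ _))⟩⟩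

theorem isLocal_ballIso (r : ℕ) (Γ : PointedGraph) : IsLocal (BallIso r Γ) :=
  fun _ h => ⟨r, fun _ h' => h.trans h'⟩

/-- The graph spanned by the vertices `v` with `r < height v ≤ R`. -/
def shell (Γ : PointedGraph) (r R : ℕ) : SimpleGraph Γ.V :=
  inducedOn Γ.adjGraph {v | r < Γ.height v ∧ Γ.height v ≤ R}

/-- Some sphere of radius larger than `r` is connected within a shell around the ball of radius
`r`.  This is the local form of being one-ended. -/
def ConnectedShell (r : ℕ) (Γ : PointedGraph) : Prop :=
  ∃ R R' : ℕ, r < R ∧ R ≤ R' ∧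
    ∀ u v, Γ.height u = R → Γ.height v = R → (Γ.shell r R').Reachable u v

theorem connectedShell_of_oneEndedGraph (hlf : Γ.LocallyFinite) (hc : Γ.adjGraph.Preconnected)
    (h : OneEndedGraph Γ.adjGraph) (r : ℕ) : Γ.ConnectedShell r := by
  obtain ⟨A, hA, hdisj, hl⟩ := h _ (hlf.finite_height_le r)
  obtain ⟨R₀, hR₀⟩ := exists_height_le hc hA
  set R := max R₀ r + 1
  have sphere_subset {v} (hv : Γ.height v = R) : v ∈ A := by
    by_contra hvA
    have := hR₀ v hvA
    rw [hv, Nat.cast_le] at this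
    omega
  have finite_sphere : {v | Γ.height v = R}.Finite :=
    (hlf.finite_height_le R).subset fun v hv => le_of_eq hv
  have exists_finite (u v) (hu : Γ.height u = R) (hv : Γ.height v = R) :
      ∃ C ⊆ A, C.Finite ∧ (inducedOn Γ.adjGraph C).Reachable u v := by
    obtain ⟨C, hCA, hC, -, hvC, reach⟩ := exists_finite_of_inducedOn_reachable
      (hl u (sphere_subset hu) v (sphere_subset hv)) (sphere_subset hu)
    exact ⟨C, hCA, hC, reach v hvC⟩
  choose! C hCA hC reach using exists_finite
  obtain ⟨R', hR'⟩ := exists_height_le hc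
    (finite_sphere.biUnion fun u hu => finite_sphere.biUnion fun v hv => hC u v hu hv)
  refine ⟨R, max R R', by omega, le_max_left _ _, fun u v hu hv =>
    (reach u v hu hv).mono (inducedOn_mono fun x hx => ⟨not_le.1 fun hxr => ?_, ?_⟩)⟩
  · exact Set.disjoint_left.1 hdisj (hCA u v hu hv hx) hxr
  · exact (hR' x (Set.mem_biUnion hu (Set.mem_biUnion hv hx))).trans
      (Nat.cast_le.2 (le_max_right _ _))

theorem oneEndedGraph_of_connectedShell (hlf : Γ.LocallyFinite) (hc : Γ.adjGraph.Preconnected)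
    (h : ∀ r, Γ.ConnectedShell r) : OneEndedGraph Γ.adjGraph := by
  intro D hD
  obtain ⟨r, hr⟩ := exists_height_le hc hD
  obtain ⟨R, R', hrR, -, hR⟩ := h r
  refine ⟨{v | r < Γ.height v ∧ ∃ w, Γ.height w = R ∧
    (inducedOn Γ.adjGraph {x | r < Γ.height x}).Reachable v w}, ?_, ?_, ?_⟩
  · refine (hlf.finite_height_le R).subset fun v hv => show Γ.height v ≤ R from ?_
    by_contra! hvR
    exact hv ⟨(Nat.cast_lt.2 hrR).trans hvR, exists_reachable_sphere hc hrR v hvR.le⟩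
  · exact Set.disjoint_left.2 fun v hv hvD => hv.1.not_ge (hr v hvD)
  · rintro u ⟨hu, w, hw, huw⟩ v ⟨-, w', hw', hvw'⟩
    have huv := (huw.trans ((hR w w' hw hw').mono (inducedOn_mono fun x hx => hx.1))).trans
      hvw'.symm
    exact (inducedOn_component_reachable huv).mono (inducedOn_mono fun x
      (hux : (inducedOn Γ.adjGraph {x | r < Γ.height x}).Reachable u x) =>
      ⟨mem_of_inducedOn_reachable (A := {x | r < Γ.height x}) hux hu, w, hw, hux.symm.trans huw⟩)

theorem oneEndedGraph_iff (hlf : Γ.LocallyFinite) (hc : Γ.adjGraph.Preconnected) :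
    OneEndedGraph Γ.adjGraph ↔ ∀ r, Γ.ConnectedShell r :=
  ⟨connectedShell_of_oneEndedGraph hlf hc, oneEndedGraph_of_connectedShell hlf hc⟩

theorem Iso.reachable_shell {R : ℕ} (f : Iso (Γ.ball (R + 1)) (Δ.ball (R + 1)))
    {u v : (Γ.ball (R + 1)).V} (h : (Γ.shell r R).Reachable (ofBall u) (ofBall v)) :
    (Δ.shell r R).Reachable (ofBall (f.onV u)) (ofBall (f.onV v)) := by
  obtain ⟨w⟩ := h
  generalize hx : ofBall u = x at w
  generalize hz : ofBall v = z at w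
  induction w generalizing u with
  | nil => rw [ofBall_injective (hx.trans hz.symm)]
  | @cons x y z hxy _ ih =>
    obtain ⟨hxr, hyr, hadj⟩ := inducedOn_adj.1 hxy
    have hR : (R : ℕ∞) < (R + 1 : ℕ) := Nat.cast_lt.2 R.lt_succ_self
    have hy : Γ.height y ≤ (R + 1 : ℕ) := hyr.2.trans hR.le
    subst hx
    refine (inducedOn_reachable_of_adj ?_ ?_ (adj_ofBall (f.adj (adj_toBall hadj
      (hxr.2.trans_lt hR) hy)))).trans (ih (u := toBall y hy) rfl hz)
    · rw [Set.mem_ofPred_eq, f.height_ofBall]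
      exact hxr
    · rw [Set.mem_ofPred_eq, f.height_ofBall]
      exact hyr

theorem isLocal_connectedShell (r : ℕ) : IsLocal (ConnectedShell r) := by
  rintro Γ ⟨R, R', hr, hR, h⟩
  refine ⟨R' + 1, fun Δ ⟨f⟩ => ⟨R, R', hr, hR, fun u v hu hv => ?_⟩⟩
  have hR_le : (R : ℕ∞) ≤ (R' + 1 : ℕ) := Nat.cast_le.2 (hR.trans R'.le_succ)
  obtain ⟨u', hu'⟩ := f.onV.surjective (toBall u (hu.trans_le hR_le))
  obtain ⟨v', hv'⟩ := f.onV.surjective (toBall v (hv.trans_le hR_le))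
  obtain rfl : ofBall (f.onV u') = u := congrArg ofBall hu'
  obtain rfl : ofBall (f.onV v') = v := congrArg ofBall hv'
  rw [f.height_ofBall] at hu hv
  exact f.reachable_shell (h _ _ hu hv)

theorem HasExcess.map {n : ℕ} {α : Γ.V → Δ.V} {β : Γ.E → Δ.E} (h : Γ.HasExcess n)
    (hα : Function.Injective α) (hβ : Function.Injective β)
    (hαβ : ∀ e, Δ.ends (β e) = (Γ.ends e).map α) : Δ.HasExcess n := by
  obtain ⟨S, F, hF, hcard⟩ := h
  refine ⟨S.map ⟨α, hα⟩, F.map ⟨β, hβ⟩, fun e he v hv => ?_, by simpa⟩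
  obtain ⟨e', he', rfl⟩ := Finset.mem_map.1 he
  rw [Function.Embedding.coeFn_mk, hαβ, Sym2.mem_map] at hv
  obtain ⟨w, hw, rfl⟩ := hv
  exact Finset.mem_map_of_mem _ (hF e' he' w hw)

theorem isLocal_hasExcess_ball (n : ℕ) : IsLocal fun Γ => ∃ s, (Γ.ball s).HasExcess n :=
  fun _ ⟨s, h⟩ => ⟨s, fun _ ⟨f⟩ => ⟨s, h.map f.onV.injective f.onE.injective f.ends_onE⟩⟩

theorem hasExcess_iff_exists_ball (hc : Γ.adjGraph.Preconnected) (n : ℕ) :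
    Γ.HasExcess n ↔ ∃ s, (Γ.ball s).HasExcess n := by
  refine ⟨fun ⟨S, F, hF, hcard⟩ => ?_, fun ⟨s, h⟩ =>
    h.map ofBall_injective ofBallEdge_injective fun e => (map_ofBall_ends e).symm⟩
  obtain ⟨s, hs⟩ := exists_height_le hc S.finite_toSet
  have hs_lt (v) (hv : v ∈ S) : Γ.height v < (s + 1 : ℕ) :=
    (hs v hv).trans_lt (Nat.cast_lt.2 s.lt_succ_self)
  let α : {v // v ∈ S} ↪ (Γ.ball (s + 1)).V :=
    ⟨fun v => toBall v.1 (hs_lt v.1 v.2).le, fun _ _ h => Subtype.ext (congrArg ofBall h)⟩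
  let β : {e // e ∈ F} ↪ (Γ.ball (s + 1)).E :=
    ⟨fun e => toBallEdge e.1 ⟨Γ.src e, src_mem _, hs_lt _ (hF e e.2 _ (src_mem _))⟩,
      fun _ _ h => Subtype.ext (congrArg ofBallEdge h)⟩
  refine ⟨s + 1, S.attach.map α, F.attach.map β, fun e he v hv => ?_, by simpa⟩
  obtain ⟨e, -, rfl⟩ := Finset.mem_map.1 he
  exact Finset.mem_map.2 ⟨⟨ofBall v, hF _ e.2 _ (mem_ends_ball.1 hv)⟩, S.mem_attach _, rfl⟩

end PointedGraph

namespace GraphIn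

variable {D : Set ℕ∞}

theorem locallyFinite (hD : ∀ d ∈ D, d < ⊤) (Γ : GraphIn D) : Γ.graph.LocallyFinite :=
  fun v => hD _ (Γ.degree_mem v)

theorem preconnected (Γ : GraphIn D) : Γ.graph.adjGraph.Preconnected :=
  have := Γ.connected
  PointedGraph.preconnected_of_connectedSpace

theorem infinite_vertices (hD : ∀ d ∈ D, d < ⊤) (Γ : GraphIn D) : Infinite Γ.graph.V := by
  refine Γ.infinite.elim id fun _ => not_finite_iff_infinite.1 fun _ => ?_
  refine Set.infinite_univ (α := Γ.graph.E) ((Set.finite_iUnion fun v =>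
    (Γ.locallyFinite hD).finite_incident v).subset fun e _ => ?_)
  exact Set.mem_iUnion.2 ⟨Γ.graph.src e, PointedGraph.src_mem e⟩

end GraphIn

namespace GraphSpace

open PointedGraph

variable {D : Set ℕ∞} {P : PointedGraph → Prop}

theorem classes_congr {Q : PointedGraph → Prop} (h : ∀ Γ : GraphIn D, P Γ.graph ↔ Q Γ.graph) :
    (classes P : Set (GraphSpace D)) = classes Q :=
  congrArg (Quotient.mk (GraphIn.isoSetoid D) '' ·) (Set.ext h)

/-- The isomorphism class of a graph. -/
def mk (Γ : GraphIn D) : GraphSpace D := Quotient.mk _ Γ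

theorem mk_surjective : Function.Surjective (mk : GraphIn D → GraphSpace D) :=
  Quotient.exists_rep

theorem mk_mem_classes (hP : IsLocal P) (Γ : GraphIn D) : mk Γ ∈ classes P ↔ P Γ.graph := by
  refine ⟨fun ⟨Δ, hΔ, h⟩ => ?_, fun h => ⟨Γ, h, rfl⟩⟩
  obtain ⟨f⟩ : Nonempty (Iso Δ.graph Γ.graph) := Quotient.exact h
  obtain ⟨s, hs⟩ := hP _ hΔ
  exact hs _ ⟨f.ball s⟩

theorem mk_mem_basicSet (Γ Δ : GraphIn D) (r : ℕ) :
    mk Δ ∈ basicSet Γ r ↔ BallIso r Γ.graph Δ.graph :=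
  mk_mem_classes (isLocal_ballIso r Γ.graph) Δ

theorem isOpen_classes (hP : IsLocal P) : IsOpen (classes P : Set (GraphSpace D)) := by
  refine isOpen_iff_forall_mem_open.2 fun _ ⟨Γ, hΓ, hx⟩ => hx ▸ ?_
  obtain ⟨s, hs⟩ := hP _ hΓ
  refine ⟨basicSet Γ s, ?_, .basic _ ⟨Γ, s, rfl⟩, (mk_mem_basicSet Γ Γ s).2 (.refl _ _)⟩
  rintro _ ⟨Δ, hΔ, rfl⟩
  exact ⟨Δ, hs _ hΔ, rfl⟩

theorem exists_basicSet_subset {U : Set (GraphSpace D)} (hU : IsOpen U) (Γ : GraphIn D)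
    (h : mk Γ ∈ U) : ∃ r, basicSet Γ r ⊆ U := by
  induction hU with
  | basic U hU =>
    obtain ⟨Δ, r, rfl⟩ := hU
    refine ⟨r, ?_⟩
    rintro _ ⟨Θ, hΘ, rfl⟩
    exact (mk_mem_basicSet Δ Θ r).2 (((mk_mem_basicSet Δ Γ r).1 h).trans hΘ)
  | univ => exact ⟨0, Set.subset_univ _⟩
  | inter U V _ _ ihU ihV =>
    obtain ⟨r, hr⟩ := ihU h.1
    obtain ⟨s, hs⟩ := ihV h.2
    refine ⟨max r s, ?_⟩
    rintro _ ⟨Θ, hΘ, rfl⟩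
    exact ⟨hr ⟨Θ, hΘ.mono (le_max_left _ _), rfl⟩, hs ⟨Θ, hΘ.mono (le_max_right _ _), rfl⟩⟩
  | sUnion S _ ih =>
    obtain ⟨U, hU, hΓ⟩ := h
    obtain ⟨r, hr⟩ := ih U hU hΓ
    exact ⟨r, hr.trans (Set.subset_sUnion_of_mem hU)⟩

theorem dense_classes
    (h : ∀ (Γ : GraphIn D) (r : ℕ), ∃ Δ : GraphIn D, BallIso r Γ.graph Δ.graph ∧ P Δ.graph) :
    Dense (classes P : Set (GraphSpace D)) := by
  refine dense_iff_inter_open.2 fun U hU ⟨x, hx⟩ => ?_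
  obtain ⟨Γ, rfl⟩ := mk_surjective x
  obtain ⟨r, hr⟩ := exists_basicSet_subset hU Γ hx
  obtain ⟨Δ, hΔ, hP⟩ := h Γ r
  exact ⟨_, hr ⟨Δ, hΔ, rfl⟩, Δ, hP, rfl⟩

theorem isGδ_classes {P : ℕ → PointedGraph → Prop} (hP : ∀ n, IsLocal (P n)) :
    IsGδ (classes (fun Γ => ∀ n, P n Γ) : Set (GraphSpace D)) := by
  have classes_eq : (classes (fun Γ => ∀ n, P n Γ) : Set (GraphSpace D)) =
      ⋂ n, classes (P n) := by
    refine Set.Subset.antisymm (fun _ ⟨Δ, hΔ, h⟩ => Set.mem_iInter.2 fun n => ⟨Δ, hΔ n, h⟩) ?_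
    intro x hx
    obtain ⟨Γ, rfl⟩ := mk_surjective x
    exact ⟨Γ, fun n => (mk_mem_classes (hP n) Γ).1 (Set.mem_iInter.1 hx n), rfl⟩
  rw [classes_eq]
  exact .iInter_of_isOpen fun n => isOpen_classes (hP n)

theorem oneEndedInfiniteRank_eq (hD : ∀ d ∈ D, d < ⊤) : oneEndedInfiniteRank D =
    classes fun Γ => OneEndedGraph Γ.adjGraph ∧ ∀ n, Γ.HasExcess n :=
  classes_congr fun Γ =>
    have := Γ.infinite_vertices hD
    oneEnded_and_rank_eq_top_iff (Γ.locallyFinite hD) Γ.preconnected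

theorem properHomotopyClass_lochNessMonster (hD : ∀ d ∈ D, d < ⊤) :
    properHomotopyClass D lochNessMonster = oneEndedInfiniteRank D :=
  classes_congr fun Γ =>
    have := Γ.infinite_vertices hD
    properHomotopyEquivalent_lochNessMonster_iff (Γ.locallyFinite hD) Γ.preconnected

theorem isGδ_oneEndedInfiniteRank (hD : ∀ d ∈ D, d < ⊤) : IsGδ (oneEndedInfiniteRank D) := by
  have classes_eq : oneEndedInfiniteRank D =
      classes fun Γ => ∀ n, ConnectedShell n Γ ∧ ∃ s, (Γ.ball s).HasExcess n := by
    rw [oneEndedInfiniteRank_eq hD]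
    refine classes_congr fun Γ => ?_
    rw [oneEndedGraph_iff (Γ.locallyFinite hD) Γ.preconnected, forall_and]
    exact and_congr_right' (forall_congr' (hasExcess_iff_exists_ball Γ.preconnected))
  rw [classes_eq]
  exact isGδ_classes fun n => (isLocal_connectedShell n).and (isLocal_hasExcess_ball n)

end GraphSpace

/-! ### Attaching a one-ended tail of infinite rank -/

section counting

theorem encard_eq_add_preimage {α β : Type*} (S : Set (α ⊕ β)) :
    S.encard = (Sum.inl ⁻¹' S).encard + (Sum.inr ⁻¹' S).encard := by
  conv_lhs => rw [← Set.image_preimage_inl_union_image_preimage_inr S]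
  rw [Set.encard_union_eq, Sum.inl_injective.encard_image, Sum.inr_injective.encard_image]
  exact Set.disjoint_image_inl_image_inr

theorem encard_sigma_fst_eq {ι : Type*} (f : ι → ℕ) (i : ι) :
    {x : Σ i, Fin (f i) | x.1 = i}.encard = f i := by
  have : {x : Σ i, Fin (f i) | x.1 = i} = Set.range (Sigma.mk i) := (Set.range_sigmaMk i).symm
  rw [this, ← Set.image_univ, sigma_mk_injective.encard_image, Set.encard_univ]
  simp

theorem encard_pred_eq {H : Type*} {N : ℕ} (φ : H ≃ Fin N) (j : ℕ) :
    {h | (φ h : ℕ) - 1 = j}.encard =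
      (min N (j + 2) - if j = 0 then 0 else j + 1 : ℕ) := by
  have image_eq : (fun h => (φ h : ℕ)) '' {h | (φ h : ℕ) - 1 = j} =
      Finset.Ico (if j = 0 then 0 else j + 1) (min N (j + 2)) := by
    ext i
    simp only [Set.mem_image, Set.mem_ofPred_eq, Finset.coe_Ico, Set.mem_Ico, lt_min_iff]
    constructor
    · rintro ⟨h, hh, rfl⟩
      have := (φ h).isLt
      split_ifs <;> omega
    · rintro ⟨hji, hiN, hij⟩
      refine ⟨φ.symm ⟨i, hiN⟩, ?_, by simp⟩
      rw [Equiv.apply_symm_apply]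
      change i - 1 = j
      split_ifs at hji <;> omega
  rw [← (Fin.val_injective.comp φ.injective).encard_image, Function.comp_def, image_eq,
    Set.encard_coe_eq_coe_finsetCard, Nat.card_Ico]

theorem exists_ray_multiplicities {K : ℕ} {c : ℕ → ℕ} (hK : c 0 < K) (hc₁ : c 1 < c 0)
    (hc : ∀ j, c (j + 2) ≤ c (j + 1)) : ∃ m : ℕ → ℕ, (∀ j, 1 ≤ m j) ∧ c 0 + m 0 = K ∧
      ∀ j, c (j + 1) + m j + m (j + 1) = K := by
  let m (j : ℕ) : ℕ := Nat.rec (K - c 0) (fun j x => K - x - c (j + 1)) j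
  have m_zero : m 0 = K - c 0 := rfl
  have m_succ (j) : m (j + 1) = K - m j - c (j + 1) := rfl
  have bounds (j) : 1 ≤ m j ∧ m j + c (j + 1) < K := by
    induction j with
    | zero =>
      rw [m_zero, zero_add]
      omega
    | succ j ih =>
      rw [m_succ]
      have : c (j + 1 + 1) ≤ c (j + 1) := hc j
      omega
  refine ⟨m, fun j => (bounds j).1, by omega, fun j => ?_⟩
  have := bounds j
  have := m_succ j
  omega

/-- The half-edges `H` are attached to the vertices `0, 0, 1, 2, …` of the ray, in this order: the
second one at `0` prevents the multiplicities of the edges of the ray from dropping to `0`. -/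
theorem exists_regular_ray (H : Type*) [Finite H] [Nonempty H] {K : ℕ} (hK : 3 ≤ K) :
    ∃ (b : H → ℕ) (m : ℕ → ℕ), (∀ j, 1 ≤ m j) ∧ (∃ h, b h = 0) ∧
      {h | b h = 0}.encard + m 0 = K ∧ (∀ j, {h | b h = j + 1}.encard + m j + m (j + 1) = K) ∧
      ∃ J, ∀ j, J ≤ j → m j + m (j + 1) = K := by
  obtain ⟨N, ⟨φ⟩⟩ := Finite.exists_equiv_fin H
  have hN : 0 < N := Fin.pos (φ (Classical.arbitrary H))
  let c (j : ℕ) : ℕ := min N (j + 2) - if j = 0 then 0 else j + 1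
  have c_zero : c 0 = min N 2 := rfl
  have c_succ (j) : c (j + 1) = min N (j + 3) - (j + 2) := rfl
  obtain ⟨m, hm, h_zero, h_succ⟩ := exists_ray_multiplicities (K := K) (c := c)
    (by omega) (by rw [c_zero, c_succ]; omega) (fun j => by rw [c_succ, c_succ]; omega)
  refine ⟨fun h => (φ h : ℕ) - 1, m, hm, ⟨φ.symm ⟨0, hN⟩, by simp⟩, ?_, fun j => ?_, N,
    fun j hj => ?_⟩
  · rw [encard_pred_eq]
    exact_mod_cast h_zero
  · rw [encard_pred_eq]
    exact_mod_cast h_succ j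
  · have := h_succ j
    rw [c_succ] at this
    omega

end counting

namespace PointedGraph

variable {Γ : PointedGraph}

theorem le_height_of_adj_le {g : Γ.V → ℕ∞} (hb : g Γ.base = 0)
    (h : ∀ u v, Γ.adjGraph.Adj u v → g v ≤ g u + 1) (v : Γ.V) : g v ≤ Γ.height v := by
  have le_length {u v} (w : Γ.adjGraph.Walk u v) : g v ≤ g u + w.length := by
    induction w with
    | nil => exact le_self_add
    | cons huy w ih =>
      calc _ ≤ _ := ih
        _ ≤ _ := add_le_add_left (h _ _ huy) _
        _ = _ := by rw [SimpleGraph.Walk.length_cons, Nat.cast_succ, add_assoc, add_comm 1]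
  exact le_iInf fun w => (le_length w).trans_eq (by rw [hb, zero_add])

section tail

variable (B : PointedGraph) {H : Type} (a : H → B.V) (b : H → ℕ) (m : ℕ → ℕ)

/-- The graph `B` with a ray attached: the ray has `m j` edges from its vertex `j` to its vertex
`j + 1`, and the edges `h : H` join the vertex `a h` of `B` to the vertex `b h` of the ray. -/
def withTail : PointedGraph where
  V := B.V ⊕ ℕ
  E := B.E ⊕ H ⊕ Σ j, Fin (m j)
  ends := Sum.elim (fun e => (B.ends e).map Sum.inl)
    (Sum.elim (fun h => s(Sum.inl (a h), Sum.inr (b h))) fun x => s(Sum.inr x.1, Sum.inr (x.1 + 1)))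
  base := Sum.inl B.base

/-- A vertex of `B`, in `B` with a ray attached. -/
def tailInl (v : B.V) : (B.withTail a b m).V := Sum.inl v

/-- A vertex of the ray. -/
def tailInr (j : ℕ) : (B.withTail a b m).V := Sum.inr j

theorem tailInl_or_tailInr (x : (B.withTail a b m).V) :
    (∃ v, x = B.tailInl a b m v) ∨ ∃ j, x = B.tailInr a b m j :=
  x.casesOn (fun v => .inl ⟨v, rfl⟩) fun j => .inr ⟨j, rfl⟩

/-- An edge of `B`, in `B` with a ray attached. -/
def tailEdge (e : B.E) : (B.withTail a b m).E := Sum.inl e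

/-- An edge between `B` and the ray. -/
def tailBridge (h : H) : (B.withTail a b m).E := Sum.inr (Sum.inl h)

/-- An edge of the ray. -/
def tailRung (x : Σ j, Fin (m j)) : (B.withTail a b m).E := Sum.inr (Sum.inr x)

theorem ends_tailEdge (e : B.E) :
    (B.withTail a b m).ends (B.tailEdge a b m e) = (B.ends e).map (B.tailInl a b m) := rfl

theorem ends_tailBridge (h : H) : (B.withTail a b m).ends (B.tailBridge a b m h) =
    s(B.tailInl a b m (a h), B.tailInr a b m (b h)) := rfl

theorem ends_tailRung (x : Σ j, Fin (m j)) : (B.withTail a b m).ends (B.tailRung a b m x) =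
    s(B.tailInr a b m x.1, B.tailInr a b m (x.1 + 1)) := rfl

theorem tailInl_injective : Function.Injective (B.tailInl a b m) := Sum.inl_injective

theorem tailInr_injective : Function.Injective (B.tailInr a b m) := Sum.inr_injective

theorem tailInl_ne_tailInr (v : B.V) (j : ℕ) : B.tailInl a b m v ≠ B.tailInr a b m j :=
  Sum.inl_ne_inr

theorem tailInl_mem_ends_tailEdge {e : B.E} {v : B.V} :
    B.tailInl a b m v ∈ (B.withTail a b m).ends (B.tailEdge a b m e) ↔ v ∈ B.ends e := by
  simp only [ends_tailEdge, Sym2.mem_map, (tailInl_injective B a b m).eq_iff, exists_eq_right]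

theorem encard_withTail_edges (S : Set (B.withTail a b m).E) : S.encard =
    {e | B.tailEdge a b m e ∈ S}.encard + ({h | B.tailBridge a b m h ∈ S}.encard +
      {x | B.tailRung a b m x ∈ S}.encard) :=
  (encard_eq_add_preimage _).trans (congrArg _ (encard_eq_add_preimage _))

theorem degree_tailInl (v : B.V) :
    (B.withTail a b m).degree (B.tailInl a b m v) = B.degree v + {h | a h = v}.encard := by
  have loop_iff (e) : (B.withTail a b m).ends (B.tailEdge a b m e) =
      s(B.tailInl a b m v, B.tailInl a b m v) ↔ B.ends e = s(v, v) :=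
    (Sym2.map.injective (tailInl_injective B a b m)).eq_iff (b := s(v, v))
  rw [degree, degree, encard_withTail_edges, encard_withTail_edges]
  simp only [Set.mem_ofPred_eq, loop_iff, tailInl_mem_ends_tailEdge, ends_tailBridge,
    ends_tailRung, Sym2.mem_iff, tailInl_ne_tailInr, (tailInl_ne_tailInr B a b m _ _).symm,
    (tailInl_injective B a b m).eq_iff, Sym2.eq_iff, or_false, and_false, Set.ofPred_false,
    Set.encard_empty, add_zero, or_self, eq_comm (a := v)]
  exact add_right_comm _ _ _

theorem degree_tailInr (j : ℕ) : (B.withTail a b m).degree (B.tailInr a b m j) =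
    {h | b h = j}.encard + {x : Σ j, Fin (m j) | x.1 = j ∨ x.1 + 1 = j}.encard := by
  have notMem (e) : B.tailInr a b m j ∉ (B.ends e).map (B.tailInl a b m) := by
    simp [Sym2.mem_map, tailInl_ne_tailInr]
  have ends_ne (e) :
      (B.ends e).map (B.tailInl a b m) ≠ s(B.tailInr a b m j, B.tailInr a b m j) :=
    fun h => notMem e (h ▸ Sym2.mem_mk_left _ _)
  have not_loop (i : ℕ) : ¬ (i = j ∧ i + 1 = j) := by omega
  rw [degree, encard_withTail_edges, encard_withTail_edges]
  simp only [Set.mem_ofPred_eq, ends_tailEdge, ends_tailBridge, ends_tailRung, notMem, ends_ne,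
    not_loop, Sym2.mem_iff, tailInl_ne_tailInr, (tailInl_ne_tailInr B a b m _ _).symm,
    (tailInr_injective B a b m).eq_iff, Sym2.eq_iff, false_or, false_and,
    Set.ofPred_false, Set.encard_empty, add_zero, zero_add, or_self, eq_comm (a := j)]

theorem degree_tailInr_zero :
    (B.withTail a b m).degree (B.tailInr a b m 0) = {h | b h = 0}.encard + m 0 := by
  rw [degree_tailInr, ← encard_sigma_fst_eq m 0]
  simp

theorem degree_tailInr_succ (j : ℕ) : (B.withTail a b m).degree (B.tailInr a b m (j + 1)) =
    {h | b h = j + 1}.encard + m j + m (j + 1) := by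
  rw [degree_tailInr, ← encard_sigma_fst_eq m j, ← encard_sigma_fst_eq m (j + 1), add_assoc,
    add_comm {x : Σ j, Fin (m j) | x.1 = j}.encard, ← Set.encard_union_eq]
  · congr 2
    ext x
    simp
  · refine Set.disjoint_left.2 fun x (hx : x.1 = j + 1) (hx' : x.1 = j) => ?_
    omega

variable {B a b m}

theorem adj_tailInl {u v : B.V} (h : B.adjGraph.Adj u v) :
    (B.withTail a b m).adjGraph.Adj (B.tailInl a b m u) (B.tailInl a b m v) := by
  obtain ⟨hne, e, he⟩ := h
  exact ⟨fun h => hne (tailInl_injective B a b m h), B.tailEdge a b m e,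
    by rw [ends_tailEdge, he]; rfl⟩

theorem adj_tailInl_tailInr (h : H) :
    (B.withTail a b m).adjGraph.Adj (B.tailInl a b m (a h)) (B.tailInr a b m (b h)) :=
  ⟨tailInl_ne_tailInr B a b m _ _, B.tailBridge a b m h, rfl⟩

theorem adj_tailInr {j : ℕ} (hm : 1 ≤ m j) :
    (B.withTail a b m).adjGraph.Adj (B.tailInr a b m j) (B.tailInr a b m (j + 1)) :=
  ⟨fun h => j.succ_ne_self (tailInr_injective B a b m h).symm, B.tailRung a b m ⟨j, 0, hm⟩, rfl⟩

theorem reachable_tailInr (hm : ∀ j, 1 ≤ m j) {J j : ℕ} (hj : J ≤ j) :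
    (inducedOn (B.withTail a b m).adjGraph (B.tailInr a b m '' Set.Ici J)).Reachable
      (B.tailInr a b m J) (B.tailInr a b m j) := by
  induction j, hj using Nat.le_induction with
  | base => exact .rfl
  | succ j hj ih =>
    exact ih.trans (inducedOn_reachable_of_adj ⟨j, hj, rfl⟩ ⟨j + 1, Nat.le_succ_of_le hj, rfl⟩
      (adj_tailInr (hm j)))

variable {r : ℕ}

theorem le_height_withTail (ha : ∀ h, B.height (a h) = r) (x : (B.withTail a b m).V) :
    Sum.elim B.height (fun _ => (r + 1 : ℕ∞)) x ≤ (B.withTail a b m).height x := by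
  refine le_height_of_adj_le (Γ := B.withTail a b m) (g := Sum.elim B.height fun _ => (r + 1 : ℕ∞))
    height_base ?_ x
  rintro u v ⟨hne, e | h | x, he⟩
  · change (B.ends e).map Sum.inl = s(u, v) at he
    rw [← mk_src_tgt] at he
    have hadj (h : B.src e ≠ B.tgt e) : B.adjGraph.Adj (B.src e) (B.tgt e) :=
      ⟨h, e, (mk_src_tgt B e).symm⟩
    rcases Sym2.eq_iff.1 he with ⟨rfl, rfl⟩ | ⟨rfl, rfl⟩
    · exact height_le_succ_of_adj (hadj fun h => hne (congrArg Sum.inl h))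
    · exact height_le_succ_of_adj (hadj fun h => hne (congrArg Sum.inl h.symm)).symm
  · change s(Sum.inl (a h), Sum.inr (b h)) = s(u, v) at he
    rcases Sym2.eq_iff.1 he with ⟨rfl, rfl⟩ | ⟨rfl, rfl⟩
    · simp [ha]
    · simp only [Sum.elim_inl, Sum.elim_inr, ha]
      exact le_self_add.trans le_self_add
  · change s(Sum.inr x.1, Sum.inr (x.1 + 1)) = s(u, v) at he
    rcases Sym2.eq_iff.1 he with ⟨rfl, rfl⟩ | ⟨rfl, rfl⟩ <;> exact le_self_add

theorem height_tailInl (ha : ∀ h, B.height (a h) = r) (v : B.V) :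
    (B.withTail a b m).height (B.tailInl a b m v) = B.height v :=
  le_antisymm (height_map_le (B.tailInl a b m) rfl fun _ _ _ => adj_tailInl)
    (le_height_withTail ha (B.tailInl a b m v))

theorem lt_height_tailInr (ha : ∀ h, B.height (a h) = r) (j : ℕ) :
    r < (B.withTail a b m).height (B.tailInr a b m j) :=
  lt_of_lt_of_le (show (r : ℕ∞) < r + 1 by exact_mod_cast r.lt_succ_self)
    (le_height_withTail ha (B.tailInr a b m j))

theorem exists_eq_tailInl_of_height_le (ha : ∀ h, B.height (a h) = r) {x : (B.withTail a b m).V}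
    (hx : (B.withTail a b m).height x ≤ r) : ∃ v, x = B.tailInl a b m v := by
  refine (tailInl_or_tailInr B a b m x).resolve_right ?_
  rintro ⟨j, rfl⟩
  exact (lt_height_tailInr ha j).not_ge hx

theorem exists_eq_tailEdge_of_height_lt (ha : ∀ h, B.height (a h) = r) {e : (B.withTail a b m).E}
    (he : ∃ v ∈ (B.withTail a b m).ends e, (B.withTail a b m).height v < r) :
    ∃ e', e = B.tailEdge a b m e' := by
  obtain ⟨x, hx, hxr⟩ := he
  obtain ⟨v, rfl⟩ := exists_eq_tailInl_of_height_le ha hxr.le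
  rw [height_tailInl ha] at hxr
  rcases e with e | h | y
  · exact ⟨e, rfl⟩
  · rcases Sym2.mem_iff.1 hx with h_eq | h_eq
    · rw [tailInl_injective B a b m h_eq, ha] at hxr
      exact (hxr.ne rfl).elim
    · exact (tailInl_ne_tailInr B a b m _ _ h_eq).elim
  · rcases Sym2.mem_iff.1 hx with h_eq | h_eq <;>
      exact (tailInl_ne_tailInr B a b m _ _ h_eq).elim

theorem nonempty_iso_ball_withTail (ha : ∀ h, B.height (a h) = r) (hB : ∀ v, B.height v ≤ r)
    (hE : ∀ e, ∃ v ∈ B.ends e, B.height v < r) :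
    Nonempty (Iso B ((B.withTail a b m).ball r)) := by
  let α (v : B.V) : ((B.withTail a b m).ball r).V :=
    toBall (B.tailInl a b m v) ((height_tailInl ha v).trans_le (hB v))
  let β (e : B.E) : ((B.withTail a b m).ball r).E :=
    toBallEdge (B.tailEdge a b m e) ((hE e).elim fun v hv => ⟨B.tailInl a b m v,
      (tailInl_mem_ends_tailEdge B a b m).2 hv.1, (height_tailInl ha v).trans_lt hv.2⟩)
  have hα : Function.Bijective α := by
    refine ⟨fun u v h => tailInl_injective B a b m (congrArg ofBall h), fun x => ?_⟩
    obtain ⟨v, hv⟩ := exists_eq_tailInl_of_height_le ha (height_ofBall_le x)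
    exact ⟨v, ofBall_injective hv.symm⟩
  have hβ : Function.Bijective β := by
    refine ⟨fun e e' h => Sum.inl_injective (congrArg ofBallEdge h), fun x => ?_⟩
    obtain ⟨e, he⟩ := exists_eq_tailEdge_of_height_lt ha (exists_height_lt_ofBallEdge x)
    exact ⟨e, ofBallEdge_injective he.symm⟩
  exact ⟨{
    onV := .ofBijective α hα
    onE := .ofBijective β hβ
    ends_onE e := by
      refine Sym2.map.injective ofBall_injective ?_
      rw [map_ofBall_ends, Sym2.map_map]
      rfl
    onV_base := rfl }⟩

theorem preconnected_withTail (ha : ∀ h, B.height (a h) = r) (hB : ∀ v, B.height v ≤ r)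
    (hm : ∀ j, 1 ≤ m j) (hb : ∃ h, b h = 0) : (B.withTail a b m).adjGraph.Preconnected := by
  have reachable_tailInl (v) :
      (B.withTail a b m).adjGraph.Reachable (B.withTail a b m).base (B.tailInl a b m v) :=
    SimpleGraph.reachable_of_edist_ne_top (ne_top_of_le_ne_top (ENat.natCast_ne_top r)
      ((height_tailInl ha v).trans_le (hB v)))
  obtain ⟨h, hh⟩ := hb
  have reachable_base (x) : (B.withTail a b m).adjGraph.Reachable (B.withTail a b m).base x := by
    obtain ⟨v, rfl⟩ | ⟨j, rfl⟩ := tailInl_or_tailInr B a b m x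
    · exact reachable_tailInl v
    · have bridge := (reachable_tailInl (a h)).trans (adj_tailInl_tailInr h).reachable
      rw [hh] at bridge
      exact bridge.trans
        ((reachable_tailInr hm j.zero_le).mono (SimpleGraph.spanningCoe_induce_le _ _))
  exact fun u v => (reachable_base u).symm.trans (reachable_base v)

theorem oneEndedGraph_withTail [Finite B.V] (hm : ∀ j, 1 ≤ m j) :
    OneEndedGraph (B.withTail a b m).adjGraph := by
  intro D hD
  obtain ⟨J, hJ⟩ := (hD.preimage (tailInr_injective B a b m).injOn).bddAbove
  refine ⟨B.tailInr a b m '' Set.Ici (J + 1), ?_, ?_, ?_⟩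
  · refine ((Set.finite_range (B.tailInl a b m)).union
      ((Set.finite_Iic J).image (B.tailInr a b m))).subset fun x hx => ?_
    obtain ⟨v, rfl⟩ | ⟨j, rfl⟩ := tailInl_or_tailInr B a b m x
    · exact .inl ⟨v, rfl⟩
    · exact .inr ⟨j, Set.mem_Iic.2 (not_lt.1 fun hj => hx ⟨j, hj, rfl⟩), rfl⟩
  · refine Set.disjoint_left.2 ?_
    rintro _ ⟨j, hj, rfl⟩ hjD
    exact (Nat.lt_of_succ_le hj).not_ge (hJ hjD)
  · rintro _ ⟨i, hi, rfl⟩ _ ⟨j, hj, rfl⟩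
    exact (reachable_tailInr hm hi).symm.trans (reachable_tailInr hm hj)

theorem three_mul_le_sum_Ico {J : ℕ} (hJ : ∀ j, J ≤ j → 3 ≤ m j + m (j + 1)) (t : ℕ) :
    3 * t ≤ ∑ j ∈ Finset.Ico J (J + 2 * t), m j := by
  induction t with
  | zero => simp
  | succ t ih =>
    have := hJ (J + 2 * t) (by omega)
    rw [show J + 2 * (t + 1) = J + 2 * t + 1 + 1 by ring, Finset.sum_Ico_succ_top (by omega),
      Finset.sum_Ico_succ_top (by omega)]
    omega

theorem hasExcess_withTail {J : ℕ} (hJ : ∀ j, J ≤ j → 3 ≤ m j + m (j + 1)) (n : ℕ) :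
    (B.withTail a b m).HasExcess n := by
  let α : ℕ ↪ (B.withTail a b m).V := ⟨B.tailInr a b m, tailInr_injective B a b m⟩
  let β : (Σ j, Fin (m j)) ↪ (B.withTail a b m).E :=
    ⟨B.tailRung a b m, Sum.inr_injective.comp Sum.inr_injective⟩
  refine ⟨(Finset.Icc J (J + 2 * (n + 1))).map α,
    ((Finset.Ico J (J + 2 * (n + 1))).sigma fun _ => Finset.univ).map β, fun e he v hv => ?_, ?_⟩
  · obtain ⟨x, hx, rfl⟩ := Finset.mem_map.1 he
    have hx := Finset.mem_Ico.1 (Finset.mem_sigma.1 hx).1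
    obtain rfl | rfl := Sym2.mem_iff.1 hv
    · exact Finset.mem_map.2 ⟨x.1, Finset.mem_Icc.2 (by omega), rfl⟩
    · exact Finset.mem_map.2 ⟨x.1 + 1, Finset.mem_Icc.2 (by omega), rfl⟩
  · have := three_mul_le_sum_Ico hJ (n + 1)
    simp only [Finset.card_map, Finset.card_sigma, Finset.card_univ, Fintype.card_fin, Nat.card_Icc]
    omega

end tail

end PointedGraph

/-! ### Density -/

namespace PointedGraph

variable {Γ B : PointedGraph} {r K : ℕ}

theorem encard_incident_ball (v : (Γ.ball r).V) : {e | v ∈ (Γ.ball r).ends e}.encard =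
    {e | ofBall v ∈ Γ.ends e ∧ ∃ w ∈ Γ.ends e, Γ.height w < r}.encard := by
  rw [← ofBallEdge_injective.encard_image]
  congr 1
  ext e
  constructor
  · rintro ⟨e, he, rfl⟩
    exact ⟨mem_ends_ball.1 he, exists_height_lt_ofBallEdge e⟩
  · exact fun he => ⟨toBallEdge e he.2, mem_ends_ball.2 he.1, rfl⟩

theorem encard_loops_ball (v : (Γ.ball r).V) : {e | (Γ.ball r).ends e = s(v, v)}.encard =
    {e | Γ.ends e = s(ofBall v, ofBall v) ∧ ∃ w ∈ Γ.ends e, Γ.height w < r}.encard := by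
  rw [← ofBallEdge_injective.encard_image]
  congr 1
  ext e
  constructor
  · rintro ⟨e, he, rfl⟩
    exact ⟨by rw [← map_ofBall_ends, he]; rfl, exists_height_lt_ofBallEdge e⟩
  · exact fun he => ⟨toBallEdge e he.2,
      Sym2.map.injective ofBall_injective ((map_ofBall_ends _).trans he.1), rfl⟩

theorem degree_ball_le (v : (Γ.ball r).V) : (Γ.ball r).degree v ≤ Γ.degree (ofBall v) := by
  rw [degree, degree, encard_incident_ball, encard_loops_ball]
  exact add_le_add (Set.encard_le_encard fun _ h => h.1) (Set.encard_le_encard fun _ h => h.1)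

theorem degree_ball_of_height_lt {v : (Γ.ball r).V} (hv : Γ.height (ofBall v) < r) :
    (Γ.ball r).degree v = Γ.degree (ofBall v) := by
  refine le_antisymm (degree_ball_le v) ?_
  rw [degree, degree, encard_incident_ball, encard_loops_ball]
  exact add_le_add (Set.encard_le_encard fun e he => ⟨he, _, he, hv⟩)
    (Set.encard_le_encard fun e he => ⟨he, _, by rw [he]; exact Sym2.mem_mk_left _ _, hv⟩)

theorem degree_ball_add_one_le {v : (Γ.ball r).V} {e : Γ.E} (hv : ofBall v ∈ Γ.ends e)
    (he : ∀ w ∈ Γ.ends e, r ≤ Γ.height w) :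
    (Γ.ball r).degree v + 1 ≤ Γ.degree (ofBall v) := by
  rw [degree, degree, encard_incident_ball, encard_loops_ball, add_right_comm]
  refine add_le_add ?_ (Set.encard_le_encard fun _ h => h.1)
  rw [← Set.encard_insert_of_notMem (a := e)]
  · exact Set.encard_le_encard (Set.insert_subset hv fun _ h => h.1)
  · rintro ⟨-, w, hw, hwr⟩
    exact (he w hw).not_gt hwr

theorem exists_degree_ball_lt [Infinite Γ.V] (hlf : Γ.LocallyFinite)
    (hc : Γ.adjGraph.Preconnected) (r : ℕ) :
    ∃ v : (Γ.ball r).V, Γ.height (ofBall v) = r ∧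
      (Γ.ball r).degree v + 1 ≤ Γ.degree (ofBall v) := by
  obtain ⟨x, hx⟩ := (hlf.finite_height_le r).exists_notMem
  obtain ⟨w, hw, -⟩ := exists_reachable_sphere hc r.lt_succ_self x <| by
    rw [Nat.cast_succ]
    exact Order.add_one_le_of_lt (not_le.1 hx)
  obtain ⟨u, ⟨-, e, he⟩, hu⟩ := exists_adj_of_height hw
  refine ⟨toBall u hu.le, hu, degree_ball_add_one_le (e := e) ?_ ?_⟩
  · rw [he]
    exact Sym2.mem_mk_left _ _
  · rw [he, Sym2.forall_mem_pair]
    exact ⟨hu.ge, hw.ge.trans' (Nat.cast_le.2 r.le_succ)⟩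

theorem exists_missing_half_edges [Finite B.V] {S : Set B.V} (hdeg : ∀ v ∈ S, B.degree v ≤ K) :
    ∃ (H : Type) (a : H → B.V), Finite H ∧ (∀ h, a h ∈ S) ∧
      ∀ v ∈ S, B.degree v + {h | a h = v}.encard = K := by
  have exists_missing (v : S) : ∃ n : ℕ, B.degree v + n = K := by
    obtain ⟨c, hc⟩ := exists_add_of_le (hdeg v v.2)
    obtain ⟨n, rfl⟩ := ENat.ne_top_iff_exists.1
      (ne_top_of_le_ne_top (ENat.natCast_ne_top K) (hc ▸ le_add_self))
    exact ⟨n, hc.symm⟩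
  choose f hf using exists_missing
  refine ⟨Σ v, Fin (f v), fun h => h.1, inferInstance, fun h => h.1.2, fun v hv => ?_⟩
  rw [← hf ⟨v, hv⟩, ← encard_sigma_fst_eq f ⟨v, hv⟩]
  simp only [Subtype.ext_iff]

theorem exists_extension [Finite B.V] (hK : 3 ≤ K) (hB : ∀ v, B.height v ≤ r)
    (hE : ∀ e, ∃ v ∈ B.ends e, B.height v < r) (hdeg : ∀ v, B.height v = r → B.degree v ≤ K)
    (hlt : ∃ v, B.height v = r ∧ B.degree v < K) :
    ∃ Δ : PointedGraph, Nonempty (Iso B (Δ.ball r)) ∧ Δ.adjGraph.Preconnected ∧ Infinite Δ.V ∧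
      (∀ x, Δ.degree x = K ∨ ∃ v, B.height v < r ∧ Δ.degree x = B.degree v) ∧
      OneEndedGraph Δ.adjGraph ∧ ∀ n, Δ.HasExcess n := by
  obtain ⟨H, a, _, ha, degree_add⟩ := exists_missing_half_edges (S := {v | B.height v = r}) hdeg
  have : Nonempty H := by
    obtain ⟨v, hv, hvK⟩ := hlt
    by_contra! hH
    rw [← degree_add v hv, Set.eq_empty_of_isEmpty {h | a h = v}, Set.encard_empty,
      add_zero] at hvK
    exact hvK.ne rfl
  obtain ⟨b, m, hm, hb, h_zero, h_succ, J, hJ⟩ := exists_regular_ray H hK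
  refine ⟨B.withTail a b m, nonempty_iso_ball_withTail ha hB hE, preconnected_withTail ha hB hm hb,
    .of_injective _ (B.tailInr_injective a b m), fun x => ?_, oneEndedGraph_withTail hm,
    hasExcess_withTail fun j hj => hK.trans (hJ j hj).ge⟩
  obtain ⟨v, rfl⟩ | ⟨_ | j, rfl⟩ := B.tailInl_or_tailInr a b m x
  · rw [degree_tailInl]
    by_cases hv : B.height v = r
    · exact .inl (degree_add v hv)
    · have fibre_empty : {h | a h = v} = ∅ :=
        Set.eq_empty_of_forall_notMem fun h (hh : a h = v) => hv (hh ▸ ha h)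
      exact .inr ⟨v, (hB v).lt_of_ne hv, by rw [fibre_empty, Set.encard_empty, add_zero]⟩
  · exact .inl (by rw [degree_tailInr_zero, h_zero])
  · exact .inl (by rw [degree_tailInr_succ, h_succ])

theorem exists_ballIso_oneEndedGraph_hasExcess [Infinite Γ.V] (hlf : Γ.LocallyFinite)
    (hc : Γ.adjGraph.Preconnected) (hK : 3 ≤ K) (hdeg : ∀ v, Γ.height v ≤ r → Γ.degree v ≤ K) :
    ∃ Δ : PointedGraph, BallIso r Γ Δ ∧ Δ.adjGraph.Preconnected ∧ Infinite Δ.V ∧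
      (∀ x, Δ.degree x = K ∨ ∃ v, Δ.degree x = Γ.degree v) ∧
      OneEndedGraph Δ.adjGraph ∧ ∀ n, Δ.HasExcess n := by
  have : Finite (Γ.ball r).V := (hlf.finite_height_le r).to_subtype
  have hB (v : (Γ.ball r).V) : (Γ.ball r).height v ≤ r := height_ball v ▸ height_ofBall_le v
  have hdeg_ball (v : (Γ.ball r).V) := hdeg _ (height_ofBall_le v)
  obtain ⟨v, hv, hlt⟩ := exists_degree_ball_lt hlf hc r
  obtain ⟨Δ, hΔ, hΔc, hΔi, degree_eq, h⟩ := exists_extension hK hB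
    (fun e => (exists_height_lt_ball_iff e).2 (exists_height_lt_ofBallEdge e))
    (fun v _ => (degree_ball_le v).trans (hdeg_ball v))
    ⟨v, (height_ball v).trans hv, ENat.add_one_le_natCast_iff.1 (hlt.trans (hdeg_ball v))⟩
  refine ⟨Δ, hΔ, hΔc, hΔi, fun x => (degree_eq x).imp_right fun ⟨v, hv, hx⟩ => ?_, h⟩
  exact ⟨ofBall v, hx.trans (degree_ball_of_height_lt (height_ball v ▸ hv))⟩

end PointedGraph

namespace GraphSpace

open PointedGraph

variable {D : Set ℕ∞}

theorem dense_oneEndedInfiniteRank (hD : ∀ d ∈ D, d < ⊤)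
    (hK : ∀ n : ℕ, (n : ℕ∞) ∈ D → ∃ K : ℕ, 3 ≤ K ∧ n ≤ K ∧ (K : ℕ∞) ∈ D) :
    Dense (oneEndedInfiniteRank D) := by
  rw [oneEndedInfiniteRank_eq hD]
  refine dense_classes fun Γ r => ?_
  have := Γ.infinite_vertices hD
  have hlf := Γ.locallyFinite hD
  obtain ⟨v, -, hv⟩ := (hlf.finite_height_le r).exists_maximalFor Γ.graph.degree _
    ⟨Γ.graph.base, height_base.trans_le zero_le⟩
  obtain ⟨n, hn⟩ := ENat.ne_top_iff_exists.1 (hlf v).ne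
  obtain ⟨K, hK, hnK, hKD⟩ := hK n (hn ▸ Γ.degree_mem v)
  have degree_le (w) (hw : Γ.graph.height w ≤ r) : Γ.graph.degree w ≤ K := calc
    _ ≤ Γ.graph.degree v := (le_total _ _).elim id (hv hw)
    _ ≤ K := hn ▸ Nat.cast_le.2 hnK
  obtain ⟨Δ, hΔ, hc, hΔi, hdeg, h⟩ :=
    exists_ballIso_oneEndedGraph_hasExcess hlf Γ.preconnected hK degree_le
  have := pathConnectedSpace_realization hc
  refine ⟨⟨Δ, inferInstance, .inl hΔi, fun x => ?_⟩, hΔ, h⟩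
  obtain h | ⟨w, h⟩ := hdeg x
  · exact h ▸ hKD
  · exact h ▸ Γ.degree_mem w

end GraphSpace

theorem proposition4p3_general {D : Set ℕ∞} (hD : ∀ d ∈ D, d < ⊤)
    (hK : ∀ n : ℕ, (n : ℕ∞) ∈ D → ∃ K : ℕ, 3 ≤ K ∧ n ≤ K ∧ (K : ℕ∞) ∈ D) :
    Dense (GraphSpace.oneEndedInfiniteRank D) ∧ IsGδ (GraphSpace.oneEndedInfiniteRank D) ∧
      GraphSpace.oneEndedInfiniteRank D = GraphSpace.properHomotopyClass D lochNessMonster :=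
  ⟨GraphSpace.dense_oneEndedInfiniteRank hD hK, GraphSpace.isGδ_oneEndedInfiniteRank hD,
    (GraphSpace.properHomotopyClass_lochNessMonster hD).symm⟩

theorem proposition4p3 :
    (∀ k : ℕ, 3 ≤ k →
      Dense (GraphSpace.oneEndedInfiniteRank {(k : ℕ∞)} : Set (RegularGraphs k)) ∧
      IsGδ (GraphSpace.oneEndedInfiniteRank {(k : ℕ∞)} : Set (RegularGraphs k)) ∧
      (GraphSpace.oneEndedInfiniteRank {(k : ℕ∞)} : Set (RegularGraphs k)) =
        GraphSpace.properHomotopyClass {(k : ℕ∞)} lochNessMonster) ∧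
    (∀ k : ℕ, 3 ≤ k →
      Dense (GraphSpace.oneEndedInfiniteRank (Set.Iic (k : ℕ∞)) : Set (BoundedDegreeGraphs k)) ∧
      IsGδ (GraphSpace.oneEndedInfiniteRank (Set.Iic (k : ℕ∞)) : Set (BoundedDegreeGraphs k)) ∧
      (GraphSpace.oneEndedInfiniteRank (Set.Iic (k : ℕ∞)) : Set (BoundedDegreeGraphs k)) =
        GraphSpace.properHomotopyClass (Set.Iic (k : ℕ∞)) lochNessMonster) ∧
    (Dense (GraphSpace.oneEndedInfiniteRank (Set.Iio (⊤ : ℕ∞)) : Set LocallyFiniteGraphs) ∧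
      IsGδ (GraphSpace.oneEndedInfiniteRank (Set.Iio (⊤ : ℕ∞)) : Set LocallyFiniteGraphs) ∧
      (GraphSpace.oneEndedInfiniteRank (Set.Iio (⊤ : ℕ∞)) : Set LocallyFiniteGraphs) =
        GraphSpace.properHomotopyClass (Set.Iio (⊤ : ℕ∞)) lochNessMonster) := by
  refine ⟨fun k hk => proposition4p3_general ?_ fun n hn => ⟨k, hk, ?_, rfl⟩,
    fun k hk => proposition4p3_general ?_ fun n hn => ⟨k, hk, ?_, Set.mem_Iic.2 le_rfl⟩,
    proposition4p3_general (fun _ h => h) fun n _ =>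
      ⟨max 3 n, le_max_left _ _, le_max_right _ _, ENat.natCast_lt_top _⟩⟩
  · rintro d rfl
    exact ENat.natCast_lt_top k
  · exact (Nat.cast_inj.1 (Set.mem_singleton_iff.1 hn)).le
  · exact fun d hd => lt_of_le_of_lt hd (ENat.natCast_lt_top k)
  · exact Nat.cast_le.1 (Set.mem_Iic.1 hn)
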